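/- Let $M$ be a smooth, Hausdorff, second countable manifold of dimension $n$, and let $g$ be a locally Lipschitz Lorentzian metric on $M$, i.e. a symmetric $(0,2)$-tensor field of signature $(-,+,\dots,+)$ at every point whose components in every smooth chart are locally Lipschitz functions. Let $h$ be any smooth Riemannian metric on $M$; the norms of tensors and the spaces $L^p(K)$ below are taken with respect to $h$ and its Riemannian volume. Fix a countable, locally finite cover of $M$ by relatively compact chart domains $(U_\alpha,\psi_\alpha)$, a smooth partition of unity $(\xi_\alpha)$ with $\operatorname{supp}\xi_\alpha\subseteq U_\alpha$, cut-off functions $\chi_\alpha\in C_c^\infty(U_\alpha)$ with $\chi_\alpha\equiv1$ on a neighbourhood of $\operatorname{supp}\xi_\alpha$, and a non-negative $\rho\in C_c^\infty(B_1(0))$, $B_1(0)\subseteq\mathbb R^n$, with $\int\rho=1$; put $\rho_\varepsilon(x)=\varepsilon^{-n}\rho(x/\varepsilon)$. For a distributional tensor field $T$ on $M$ define its manifold mollification $$T\star_M\rho_\varepsilon:=\sum_\alpha\chi_\alpha\,(\psi_\alpha)^*\Big[\big((\psi_\alpha)_*(\xi_\alpha T)\big)*\rho_\varepsilon\Big],$$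 where $*$ is the component-wise convolution on $\mathbb R^n$. Put $g_\varepsilon:=g\star_M\rho_\varepsilon$. Let $\mathrm{Ric}[g]$ be the distributional Ricci tensor of $g$, given in every chart by $$\mathrm{Ric}_{ij}=\partial_m\Gamma^m_{ij}-\partial_j\Gamma^m_{im}+\Gamma^m_{ij}\Gamma^k_{km}-\Gamma^m_{ik}\Gamma^k_{jm},\qquad \Gamma^m_{ij}=\tfrac12g^{ml}(\partial_ig_{jl}+\partial_jg_{il}-\partial_lg_{ij})\in L^\infty_{\mathrm{loc}},$$ with the derivatives of $\Gamma^m_{ij}$ taken in the sense of distributions. Then $g_\varepsilon$ is smooth for every $\varepsilon\in(0,1]$, and for every compact set $K\subseteq M$: (0) for all sufficiently small $\varepsilon>0$, $g_\varepsilon$ is Lorentzian at every point of $K$ (so that its classical Ricci tensor $\mathrm{Ric}[g_\varepsilon]$ is defined on $K$); (i) for every $1\le p<\infty$, $\mathrm{Ric}[g_\varepsilon]-\mathrm{Ric}[g]\star_M\rho_\varepsilon$ belongs to $L^p(K)$ for all sufficiently small $\varepsilon>0$, and $\big\|\mathrm{Ric}[g_\varepsilon]-\mathrm{Ric}[g]\star_M\rho_\varepsilon\big\|_{L^p(K)}\to0$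 as $\varepsilon\to0^+$; (ii) there is a constant $C_K>0$ such that $\big\|\mathrm{Ric}[g_\varepsilon]-\mathrm{Ric}[g]\star_M\rho_\varepsilon\big\|_{L^\infty(K)}\le C_K$ for all sufficiently small $\varepsilon>0$. -/

import Mathlib

open Set Filter Topology MeasureTheory TopologicalSpace
open scoped Manifold ContDiff ENNReal Distributions LineDeriv

noncomputable section

namespace LipRicci

/-- The model space `ℝⁿ` of an `n`-dimensional manifold. -/
abbrev Model (n : ℕ) : Type := EuclideanSpace ℝ (Fin n)

/-- The standard basis vectors of `ℝⁿ`. -/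
def e {n : ℕ} (i : Fin n) : Model n := EuclideanSpace.single i 1

/-- The charts of the maximal smooth atlas of `M`. -/
abbrev Chart (n : ℕ) (M : Type*) [TopologicalSpace M] [ChartedSpace (Model n) M] :=
  {ψ : OpenPartialHomeomorph M (Model n) // ψ ∈ IsManifold.maximalAtlas 𝓘(ℝ, Model n) ∞ M}

/-- Bilinear forms on the tangent space `T_x M`. -/
abbrev FormAt (n : ℕ) {M : Type*} [TopologicalSpace M] [ChartedSpace (Model n) M] (x : M) :=
  TangentSpace 𝓘(ℝ, Model n) x →L[ℝ] TangentSpace 𝓘(ℝ, Model n) x →L[ℝ] ℝ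

/-- (Everywhere defined, not necessarily regular) `(0,2)`-tensor fields on `M`. -/
abbrev TensorField (n : ℕ) (M : Type*) [TopologicalSpace M] [ChartedSpace (Model n) M] :=
  ∀ x : M, FormAt n x

section Local

variable {n : ℕ}

/-- The partial derivative `∂_k f` at `y` (for a locally Lipschitz `f` it exists at almost every
`y` and represents the distributional derivative). -/
def pd (k : Fin n) (f : Model n → ℝ) (y : Model n) : ℝ := fderiv ℝ f y (e k)

/-- The Christoffel symbols `Γ^m_{ij} = ½ g^{ml} (∂_i g_{jl} + ∂_j g_{il} - ∂_l g_{ij})` of the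
matrix of components `G = (g_{ij})`. -/
def christoffel (G : Model n → Matrix (Fin n) (Fin n) ℝ) (m i j : Fin n) (y : Model n) : ℝ :=
  (1 / 2 : ℝ) * ∑ l, (G y)⁻¹ m l *
    (pd i (fun z => G z j l) y + pd j (fun z => G z i l) y - pd l (fun z => G z i j) y)

/-- The part `Γ^m_{ij} Γ^k_{km} - Γ^m_{ik} Γ^k_{jm}` of the Ricci tensor without derivatives
of the Christoffel symbols. -/
def ricciQuad (G : Model n → Matrix (Fin n) (Fin n) ℝ) (i j : Fin n) (y : Model n) : ℝ :=
  ∑ m, ∑ k, (christoffel G m i j y * christoffel G k k m y -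
    christoffel G m i k y * christoffel G k j m y)

/-- The classical Ricci tensor
`R_{ij} = ∂_m Γ^m_{ij} - ∂_j Γ^m_{im} + Γ^m_{ij} Γ^k_{km} - Γ^m_{ik} Γ^k_{jm}`. -/
def ricciComp (G : Model n → Matrix (Fin n) (Fin n) ℝ) (y : Model n) :
    Matrix (Fin n) (Fin n) ℝ := fun i j =>
  ∑ m, (pd m (christoffel G m i j) y - pd j (christoffel G m i m) y) + ricciQuad G i j y

/-- The regular distribution `φ ↦ ∫ f φ` given by a locally integrable function `f` on `Ω`. -/
def regular (Ω : Opens (Model n)) (f : Model n → ℝ) : 𝓓'(Ω, ℝ) :=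
  (TestFunction.integralAgainstBilinCLM (ContinuousLinearMap.mul ℝ ℝ) volume f :
    𝓓(Ω, ℝ) →L[ℝ] ℝ)

/-- The distributional Ricci tensor: the same coordinate formula as `ricciComp`, with the
derivatives of the (locally bounded) Christoffel symbols taken in `𝓓'(Ω)`. -/
def distRicciComp (Ω : Opens (Model n)) (G : Model n → Matrix (Fin n) (Fin n) ℝ)
    (i j : Fin n) : 𝓓'(Ω, ℝ) :=
  ∑ m, (∂_{(e m : Model n)} (regular Ω (christoffel G m i j)) -
    ∂_{(e j : Model n)} (regular Ω (christoffel G m i m))) + regular Ω (ricciQuad G i j)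

end Local

section Global

variable {n : ℕ} {M : Type*} [TopologicalSpace M] [ChartedSpace (Model n) M]

/-- The components `T_{ij} = T(∂_i, ∂_j)` of a tensor field in a chart `ψ`, as functions on
`ψ(U)`. -/
def comp (T : TensorField n M) (ψ : OpenPartialHomeomorph M (Model n)) (y : Model n) :
    Matrix (Fin n) (Fin n) ℝ := fun i j =>
  T (ψ.symm y) (mfderiv 𝓘(ℝ, Model n) 𝓘(ℝ, Model n) ψ.symm y (e i))
    (mfderiv 𝓘(ℝ, Model n) 𝓘(ℝ, Model n) ψ.symm y (e j))

/-- The value at `x` of the pull-back `ψ^*(A_{ij} dx^i ⊗ dx^j)` along a chart `ψ`. -/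
def pull (ψ : OpenPartialHomeomorph M (Model n)) (A : Model n → Matrix (Fin n) (Fin n) ℝ)
    (x : M) : FormAt n x :=
  ∑ i, ∑ j, A (ψ x) i j •
    ((EuclideanSpace.proj i : Model n →L[ℝ] ℝ) ∘L
        mfderiv 𝓘(ℝ, Model n) 𝓘(ℝ, Model n) ψ x).smulRight
      ((EuclideanSpace.proj j : Model n →L[ℝ] ℝ) ∘L
        mfderiv 𝓘(ℝ, Model n) 𝓘(ℝ, Model n) ψ x)

/-- The Ricci tensor `Ric[g]` of a smooth metric `g`; at `x` it is computed in the preferred chart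
at `x` (for smooth metrics the result does not depend on the chart). -/
def ricci (g : TensorField n M) : TensorField n M := fun x =>
  pull (chartAt (Model n) x) (ricciComp (comp g (chartAt (Model n) x))) x

/-- A symmetric bilinear form of signature `(-,+,…,+)`. -/
def IsLorentzForm {x : M} (B : FormAt n x) : Prop :=
  (∀ v w, B v w = B w v) ∧ ∃ v, B v v < 0 ∧ ∀ w, w ≠ 0 → B v w = 0 → 0 < B w w

variable (n M) in
/-- A locally Lipschitz Lorentzian metric on `M`. -/
structure LipschitzLorentzMetric where
  toField : TensorField n M
  lorentz : ∀ x, IsLorentzForm (toField x)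
  lipschitz : ∀ (ψ : Chart n M) (i j : Fin n),
    LocallyLipschitzOn ψ.1.target (fun y => comp toField ψ.1 y i j)

/-- The open set `ψ(U)`. -/
def targetOpens (ψ : Chart n M) : Opens (Model n) := ⟨ψ.1.target, ψ.1.open_target⟩

variable (n M) in
/-- Distributional `(0,2)`-tensor fields on `M`, given by their components in the charts:
`T ψ i j ∈ 𝓓'(ψ(U))` is the `ij`-component of the push-forward `ψ_* T`. -/
abbrev DistTensorField := ∀ ψ : Chart n M, Fin n → Fin n → 𝓓'(targetOpens ψ, ℝ)

/-- A locally integrable tensor field as a distributional one. -/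
def toDist (T : TensorField n M) : DistTensorField n M := fun ψ i j =>
  regular (targetOpens ψ) (fun y => comp T ψ.1 y i j)

/-- The distributional Ricci tensor of a locally Lipschitz metric. -/
def distRicci (g : TensorField n M) : DistTensorField n M := fun ψ =>
  distRicciComp (targetOpens ψ) (comp g ψ.1)

variable (n M) in
/-- The data entering the manifold convolution: a countable locally finite cover by relatively
compact charts, a subordinate smooth partition of unity `ξ`, cut-off functions `χ α ∈ 𝓓(U_α)`
equal to `1` near `supp (ξ α)`, and a mollifier `ρ ∈ 𝓓(B_1(0))`. -/
structure MollifierData where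
  ψ : ℕ → Chart n M
  locallyFinite : LocallyFinite fun α => (ψ α).1.source
  relCompact : ∀ α, IsCompact (closure (ψ α).1.source)
  cover : ⋃ α, (ψ α).1.source = univ
  ξ : SmoothPartitionOfUnity ℕ 𝓘(ℝ, Model n) M
  ξ_subordinate : ∀ α, tsupport (ξ α) ⊆ (ψ α).1.source
  χ : ℕ → M → ℝ
  χ_smooth : ∀ α, ContMDiff 𝓘(ℝ, Model n) 𝓘(ℝ, ℝ) ∞ (χ α)
  χ_supp : ∀ α, tsupport (χ α) ⊆ (ψ α).1.source
  χ_one : ∀ α, ∀ x ∈ tsupport (ξ α), ∀ᶠ y in 𝓝 x, χ α y = 1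
  ρ : Model n → ℝ
  ρ_smooth : ContDiff ℝ ∞ ρ
  ρ_compact : HasCompactSupport ρ
  ρ_supp : tsupport ρ ⊆ Metric.ball 0 1
  ρ_nonneg : ∀ y, 0 ≤ ρ y
  ρ_integral : ∫ y, ρ y = 1

namespace MollifierData

/-- The function `ξ_α ∘ ψ_α⁻¹`, extended by zero to `ℝⁿ`. -/
def locξ (D : MollifierData n M) (α : ℕ) : Model n → ℝ :=
  (D.ψ α).1.target.indicator (fun z => D.ξ α ((D.ψ α).1.symm z))

/-- `ρ_ε(y) = ε⁻ⁿ ρ(y/ε)`. -/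
def ρε (D : MollifierData n M) (ε : ℝ) (y : Model n) : ℝ := (ε ^ n)⁻¹ * D.ρ (ε⁻¹ • y)

lemma isCompact_image (D : MollifierData n M) (α : ℕ) :
    IsCompact ((D.ψ α).1 '' tsupport (D.ξ α)) :=
  ((D.relCompact α).of_isClosed_subset (isClosed_tsupport _)
    ((D.ξ_subordinate α).trans subset_closure)).image_of_continuousOn
    ((D.ψ α).1.continuousOn.mono (D.ξ_subordinate α))

lemma image_subset (D : MollifierData n M) (α : ℕ) :
    (D.ψ α).1 '' tsupport (D.ξ α) ⊆ (D.ψ α).1.target := by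
  rintro _ ⟨x, hx, rfl⟩
  exact (D.ψ α).1.map_source (D.ξ_subordinate α hx)

lemma locξ_eq_zero (D : MollifierData n M) (α : ℕ) (z : Model n)
    (hz : z ∉ (D.ψ α).1 '' tsupport (D.ξ α)) : D.locξ α z = 0 := by
  by_cases h : z ∈ (D.ψ α).1.target
  · rw [locξ, indicator_of_mem h]
    by_contra h0
    exact hz ⟨_, subset_tsupport _ h0, (D.ψ α).1.right_inv h⟩
  · rw [locξ, indicator_of_notMem h]

lemma tsupport_locξ_subset (D : MollifierData n M) (α : ℕ) :
    tsupport (D.locξ α) ⊆ (D.ψ α).1 '' tsupport (D.ξ α) :=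
  closure_minimal (fun z hz => by by_contra h; exact hz (D.locξ_eq_zero α z h))
    (D.isCompact_image α).isClosed

lemma contDiff_locξ (D : MollifierData n M) (α : ℕ) : ContDiff ℝ ∞ (D.locξ α) := by
  rw [contDiff_iff_contDiffAt]
  intro z
  by_cases hz : z ∈ (D.ψ α).1.target
  · have h1 : ContMDiffOn 𝓘(ℝ, Model n) 𝓘(ℝ, ℝ) ∞ (fun z => D.ξ α ((D.ψ α).1.symm z))
        (D.ψ α).1.target :=
      (D.ξ α).contMDiff.comp_contMDiffOn
        (contMDiffOn_symm_of_mem_maximalAtlas (D.ψ α).2)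
    have h2 : ContDiffAt ℝ ∞ (fun z => D.ξ α ((D.ψ α).1.symm z)) z :=
      (contMDiffOn_iff_contDiffOn.1 h1).contDiffAt ((D.ψ α).1.open_target.mem_nhds hz)
    refine h2.congr_of_eventuallyEq ?_
    filter_upwards [(D.ψ α).1.open_target.mem_nhds hz] with w hw
    rw [locξ, indicator_of_mem hw]
  · have hz' : z ∉ (D.ψ α).1 '' tsupport (D.ξ α) := fun h => hz (D.image_subset α h)
    refine (contDiffAt_const (c := (0 : ℝ))).congr_of_eventuallyEq ?_
    filter_upwards [(D.isCompact_image α).isClosed.isOpen_compl.mem_nhds hz'] with w hw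
    exact D.locξ_eq_zero α w hw

/-- The test function `z ↦ ξ_α(ψ_α⁻¹(z)) ρ_ε(y - z)` on `ψ_α(U_α)`. -/
def kernel (D : MollifierData n M) (α : ℕ) (ε : ℝ) (y : Model n) :
    𝓓(targetOpens (D.ψ α), ℝ) where
  toFun z := D.locξ α z * D.ρε ε (y - z)
  contDiff' := by
    have h : ContDiff ℝ ∞ (fun z : Model n => (ε ^ n)⁻¹ * D.ρ (ε⁻¹ • (y - z))) :=
      contDiff_const.mul (D.ρ_smooth.comp ((contDiff_const.sub contDiff_id).const_smul ε⁻¹))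
    exact (D.contDiff_locξ α).mul h
  hasCompactSupport' :=
    HasCompactSupport.mul_right ((D.isCompact_image α).of_isClosed_subset (isClosed_tsupport _)
      (D.tsupport_locξ_subset α))
  tsupport_subset' :=
    (tsupport_mul_subset_left).trans ((D.tsupport_locξ_subset α).trans (D.image_subset α))

/-- The components of `((ψ_α)_* (ξ_α T)) * ρ_ε`, where the convolution of a compactly supported
distribution `u` with `ρ_ε` is `y ↦ ⟨u, ρ_ε(y - ·)⟩`. -/
def localConv (D : MollifierData n M) (ε : ℝ) (T : DistTensorField n M) (α : ℕ) (y : Model n) :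
    Matrix (Fin n) (Fin n) ℝ := fun i j => T (D.ψ α) i j (D.kernel α ε y)

/-- The manifold convolution `T ⋆_M ρ_ε = ∑_α χ_α ψ_α^* [((ψ_α)_* (ξ_α T)) * ρ_ε]`. -/
def conv (D : MollifierData n M) (ε : ℝ) (T : DistTensorField n M) : TensorField n M := fun x =>
  ∑ᶠ α, D.χ α x • pull (D.ψ α).1 (D.localConv ε T α) x

end MollifierData

variable (n M) in
/-- Smooth Riemannian metrics on `M`. -/
abbrev RiemMetric [IsManifold 𝓘(ℝ, Model n) ∞ M] :=
  Bundle.ContMDiffRiemannianMetric 𝓘(ℝ, Model n) ∞ (Model n)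
    (fun x : M => TangentSpace 𝓘(ℝ, Model n) x)

/-- The Riemannian volume measure of `h`, defined with the charts and the partition of unity
of `D` (the result does not depend on these choices): `∑_α (ψ_α⁻¹)_* (ξ_α √(det h_{ij}) dy)`. -/
def riemVolume [IsManifold 𝓘(ℝ, Model n) ∞ M] [MeasurableSpace M]
    (h : RiemMetric n M) (D : MollifierData n M) : Measure M :=
  Measure.sum fun α =>
    ((volume.restrict (D.ψ α).1.target).withDensity fun y =>
      ENNReal.ofReal (D.locξ α y * √(comp h.inner (D.ψ α).1 y).det)).map (D.ψ α).1.symm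

/-- The norm `(h^{ik} h^{jl} B_{ij} B_{kl})^{1/2}` induced by `h` on `(0,2)`-tensors at `x`.
The components are taken with respect to the basis of `T_x M` given by the standard basis of the
model space (the value does not depend on the basis). -/
def tensorNorm [IsManifold 𝓘(ℝ, Model n) ∞ M] (h : RiemMetric n M) {x : M}
    (B : FormAt n x) : ℝ :=
  let b : Fin n → TangentSpace 𝓘(ℝ, Model n) x := fun i => (e i : Model n)
  let H : Matrix (Fin n) (Fin n) ℝ := fun i j => h.inner x (b i) (b j)
  √(∑ i, ∑ j, ∑ k, ∑ l, H⁻¹ i k * H⁻¹ j l * B (b i) (b j) * B (b k) (b l))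

/-- The function `|Ric[g_ε] - Ric[g] ⋆_M ρ_ε|_h` on `M`, where `g_ε = g ⋆_M ρ_ε`. -/
def ricciDefect [IsManifold 𝓘(ℝ, Model n) ∞ M] (h : RiemMetric n M) (D : MollifierData n M)
    (g : TensorField n M) (ε : ℝ) (x : M) : ℝ :=
  tensorNorm h (ricci (D.conv ε (toDist g)) x - D.conv ε (distRicci g) x)

end Global

end LipRicci

end

noncomputable section

namespace LipRicci

/-! ### Locally Lipschitz functions and null sets -/

section Classes

variable {n : ℕ}

/-! The Ricci tensor is quasi-linear: it equals `g⁻¹ ∂²g` (`princ`) plus an expression in `g` and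
`∂g` only (`lower`). For a Lipschitz metric, mollification gives `g_ε - g = O(ε)`, bounded almost
everywhere convergence `∂g_ε → ∂g`, and `ε ∂²g_ε → 0` boundedly almost everywhere. The last fact
holds because `ε ∂(u * ρ_ε)` is the mollification of `u = ∂g` with the kernel `∂ρ`, which has mass
zero. Replacing `g_ε⁻¹` by `g⁻¹` in the second order part therefore costs `O(ε) · o(1/ε)`, and
`Ric[g_ε] - princ(g⁻¹, ∂²g_ε)` converges to `lower(g)` (`conv_ricciComp`).

On the other side, `ξ Ric[g]` is mollified after moving its derivatives onto `ξ` and `ρ_ε`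
(`molRicci`). A Christoffel symbol multiplied by `ξ` is a sum of products `a u`, where `a = ξ
g^{ml}` is Lipschitz and `u` is a bounded combination of first derivatives of `g`. The Friedrichs
commutator `∂((a u) * ρ_ε) - a ∂(u * ρ_ε)` tends to `(∂a) u` boundedly almost everywhere
(`Mollifier.conv_commutator`). Since `u * ρ_ε` is the same combination of derivatives of the
mollified metric, the mollification of `ξ Ric[g]` is `ξ princ(g⁻¹, ∂²(g * ρ_ε))` plus a term
converging to `ξ lower(g)`. Both sides have the same second order part and the same limit of the
rest, which is the local theorem `Mollifier.negl_molRicci_sub`.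

To globalise, fix a chart. Near a point and for small `ε` the metric `g_ε` is a finite sum of
pull-backs of `(ξ_α g) * ρ_ε = ξ_α (g * ρ_ε) + C_α`, where the commutators `C_α` are negligible
together with two derivatives (`Mollifier.neglTwo_commutator`). All the pulled-back families
approximate the same `g` and the weights sum to one, so the terms of `∂²g_ε` containing derivatives
of the weights cancel in the limit. Hence `Ric[g_ε]` agrees with the weighted sum of the Ricci
tensors of the pieces (`negl_ricciComp_glue`). Tensoriality of the classical Ricci tensor
(`ricciComp_pullM`) turns the Ricci tensor of a pulled-back piece into the pull-back of its Ricci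
tensor, where the local theorem applies (`MollifierData.Good.negl_ricci_sub`).

Thus the defect is locally uniformly bounded and tends to zero almost everywhere. On a compact set,
which has finite volume, boundedness is the `L^∞` claim, and dominated convergence yields the `L^p`
claim for finite `p`. Limits are taken along the joint filter `lz y`, in the parameter and the
point: this encodes local uniformity, so compactness applies, and it allows eventual identities to
be differentiated in space. -/

/-- `f` is Lipschitz on a neighbourhood of `y`. -/
def LipAt (f : Model n → ℝ) (y : Model n) : Prop := ∃ K, ∃ t ∈ 𝓝 y, LipschitzOnWith K f t

lemma lipAt_of_locallyLipschitzOn {f : Model n → ℝ} {U : Set (Model n)} (hU : IsOpen U)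
    (h : LocallyLipschitzOn U f) {y : Model n} (hy : y ∈ U) : LipAt f y := by
  obtain ⟨K, t, ht, hK⟩ := h hy
  exact ⟨K, t, by rwa [hU.nhdsWithin_eq hy] at ht, hK⟩

lemma LipAt.congr {f g : Model n → ℝ} {y : Model n} (hf : LipAt f y) (h : f =ᶠ[𝓝 y] g) :
    LipAt g y := by
  obtain ⟨K, t, ht, hK⟩ := hf
  refine ⟨K, _, inter_mem ht h, fun a ha b hb => ?_⟩
  rw [← show f a = g a from ha.2, ← show f b = g b from hb.2]
  exact hK ha.1 hb.1

lemma LipAt.continuousAt {f : Model n → ℝ} {y : Model n} (hf : LipAt f y) : ContinuousAt f y := by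
  obtain ⟨K, t, ht, hK⟩ := hf
  exact hK.continuousOn.continuousAt ht

lemma LipAt.of_contDiffAt {f : Model n → ℝ} {y : Model n} (hf : ContDiffAt ℝ ∞ f y) :
    LipAt f y := by
  obtain ⟨K, t, ht, hK⟩ := (hf.of_le (m := 1) (by simp)).exists_lipschitzOnWith
  exact ⟨K, t, ht, hK⟩

lemma LipAt.comp_map {f : Model n → ℝ} {τ : Model n → Model n} {y : Model n}
    (hf : LipAt f (τ y)) (hτ : ContDiffAt ℝ ∞ τ y) : LipAt (fun z => f (τ z)) y := by
  obtain ⟨K, t, ht, hK⟩ := hf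
  obtain ⟨K', t', ht', hK'⟩ := (hτ.of_le (m := 1) (by simp)).exists_lipschitzOnWith
  refine ⟨K * K', _, inter_mem ht' (hτ.continuousAt ht), ?_⟩
  exact hK.comp (hK'.mono inter_subset_left) (fun z hz => hz.2)

/-- A `C¹` function of finitely many variables is Lipschitz near the point of values. Sums, products
and inverses of Lipschitz germs are all obtained from this single composition. -/
lemma LipAt.postcomp {ι : Type*} [Fintype ι] {f : ι → Model n → ℝ} {F : (ι → ℝ) → ℝ} {y : Model n}
    (hF : ContDiffAt ℝ 1 F (fun i => f i y)) (hf : ∀ i, LipAt (f i) y) :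
    LipAt (fun z => F (fun i => f i z)) y := by
  obtain ⟨K, t, ht, hK⟩ := hF.exists_lipschitzOnWith
  choose K' t' ht' hK' using hf
  have hc : ContinuousAt (fun z i => f i z) y :=
    continuousAt_pi.2 fun i => (hK' i).continuousOn.continuousAt (ht' i)
  have hP : LipschitzOnWith (Finset.univ.sup K') (fun z i => f i z) (⋂ i, t' i) := by
    intro a ha b hb
    refine (edist_pi_le_iff).2 fun i => ?_
    refine (hK' i (mem_iInter.1 ha i) (mem_iInter.1 hb i)).trans ?_
    gcongr
    exact Finset.le_sup (f := K') (Finset.mem_univ i)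
  refine ⟨K * Finset.univ.sup K', _, inter_mem (iInter_mem.2 ht') (hc ht), ?_⟩
  exact hK.comp (hP.mono inter_subset_left) (fun z hz => hz.2)

lemma LipAt.add {f g : Model n → ℝ} {y : Model n} (hf : LipAt f y) (hg : LipAt g y) :
    LipAt (fun z => f z + g z) y := by
  have := LipAt.postcomp (f := ![f, g]) (F := fun v => v 0 + v 1) (y := y) (by fun_prop)
    (by intro i; fin_cases i <;> assumption)
  simpa using this

lemma LipAt.mul {f g : Model n → ℝ} {y : Model n} (hf : LipAt f y) (hg : LipAt g y) :
    LipAt (fun z => f z * g z) y := by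
  have := LipAt.postcomp (f := ![f, g]) (F := fun v => v 0 * v 1) (y := y) (by fun_prop)
    (by intro i; fin_cases i <;> assumption)
  simpa using this

lemma LipAt.inv {f : Model n → ℝ} {y : Model n} (hf : LipAt f y) (h : f y ≠ 0) :
    LipAt (fun z => (f z)⁻¹) y := by
  have := LipAt.postcomp (f := ![f]) (F := fun v => (v 0)⁻¹) (y := y)
    (ContDiffAt.inv (by fun_prop) (by simpa using h))
    (by intro i; fin_cases i; assumption)
  simpa using this

lemma LipAt.const (c : ℝ) (y : Model n) : LipAt (fun _ => c) y :=
  ⟨0, univ, univ_mem, (LipschitzWith.const c).lipschitzOnWith⟩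

lemma LipAt.sum {ι : Type*} {s : Finset ι} {f : ι → Model n → ℝ} {y : Model n}
    (hf : ∀ i ∈ s, LipAt (f i) y) : LipAt (fun z => ∑ i ∈ s, f i z) y := by
  classical
  induction s using Finset.induction_on with
  | empty => simpa using LipAt.const 0 y
  | insert a s ha ih =>
    simp only [Finset.sum_insert ha]
    exact (hf a (by simp)).add (ih fun i hi => hf i (by simp [hi]))

lemma LipAt.prod {ι : Type*} {s : Finset ι} {f : ι → Model n → ℝ} {y : Model n}
    (hf : ∀ i ∈ s, LipAt (f i) y) : LipAt (fun z => ∏ i ∈ s, f i z) y := by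
  classical
  induction s using Finset.induction_on with
  | empty => simpa using LipAt.const 1 y
  | insert a s ha ih =>
    simp only [Finset.prod_insert ha]
    exact (hf a (by simp)).mul (ih fun i hi => hf i (by simp [hi]))

lemma norm_e (k : Fin n) : ‖(e k : Model n)‖ = 1 := by simp [e]

lemma abs_pd_le (k : Fin n) (f : Model n → ℝ) (y : Model n) : |pd k f y| ≤ ‖fderiv ℝ f y‖ := by
  have := (fderiv ℝ f y).le_opNorm (e k)
  simpa [norm_e, pd] using this

/-- Almost everywhere statements on a set can be checked locally. -/
lemma ae_of_locally {U : Set (Model n)} {P : Model n → Prop}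
    (h : ∀ y ∈ U, ∃ V ∈ 𝓝 y, ∀ᵐ z, z ∈ V → P z) : ∀ᵐ z, z ∈ U → P z := by
  have : (volume : Measure (Model n)) {z | z ∈ U ∧ ¬ P z} = 0 := by
    refine measure_null_of_locally_null _ fun y hy => ?_
    obtain ⟨V, hV, h⟩ := h y hy.1
    refine ⟨V ∩ {z | ¬ P z}, ?_, ?_⟩
    · filter_upwards [self_mem_nhdsWithin, mem_nhdsWithin_of_mem_nhds hV] with z hz hz'
      exact ⟨hz', hz.2⟩
    · rw [ae_iff] at h
      refine measure_mono_null (fun z hz => ?_) h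
      simpa using hz
  rw [ae_iff]
  simpa using this

/-- Rademacher's theorem on each Lipschitz neighbourhood, patched together by `ae_of_locally`. -/
lemma ae_differentiableAt_of_lipAt {U : Set (Model n)} {f : Model n → ℝ}
    (hf : ∀ y ∈ U, LipAt f y) : ∀ᵐ z, z ∈ U → DifferentiableAt ℝ f z := by
  refine ae_of_locally fun y hy => ?_
  obtain ⟨K, t, ht, hK⟩ := hf y hy
  refine ⟨interior t, interior_mem_nhds.2 ht, ?_⟩
  filter_upwards [hK.ae_differentiableWithinAt_of_mem (μ := volume)] with z hz hzt
  exact (hz (interior_subset hzt)).differentiableAt (mem_interior_iff_mem_nhds.1 hzt)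

/-! ### Families depending on a small parameter: bounds, rates and almost everywhere limits -/

/-- The filter `ε → 0⁺`, `z → y`. -/
abbrev lz (y : Model n) : Filter (ℝ × Model n) := 𝓝[>] (0 : ℝ) ×ˢ 𝓝 y

lemma eventually_lz_of_nhds {y : Model n} {P : Model n → Prop} (h : ∀ᶠ z in 𝓝 y, P z) :
    ∀ᶠ p in lz y, P p.2 := tendsto_snd.eventually h

lemma eventually_lz_of_pos {y : Model n} {P : ℝ → Prop} (h : ∀ᶠ ε in 𝓝[>] (0 : ℝ), P ε) :
    ∀ᶠ p in lz y, P p.1 := tendsto_fst.eventually h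

lemma eventually_pos_lz (y : Model n) : ∀ᶠ p in lz y, (0 : ℝ) < p.1 :=
  eventually_lz_of_pos (P := fun ε => 0 < ε) self_mem_nhdsWithin

lemma eventually_of_lz {y : Model n} {P : ℝ × Model n → Prop} (h : ∀ᶠ p in lz y, P p) :
    ∀ᶠ ε in 𝓝[>] (0 : ℝ), P (ε, y) := by
  have : Tendsto (fun ε : ℝ => (ε, y)) (𝓝[>] (0 : ℝ)) (lz y) :=
    tendsto_id.prodMk tendsto_const_nhds
  exact this.eventually h

/-- An eventual property near `(0⁺, y)` holds eventually in a neighbourhood in the second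
variable. -/
lemma eventually_lz_nhds {y : Model n} {P : ℝ × Model n → Prop} (h : ∀ᶠ p in lz y, P p) :
    ∀ᶠ p in lz y, ∀ᶠ z in 𝓝 p.2, P (p.1, z) := by
  obtain ⟨pa, ha, pb, hb, H⟩ := eventually_prod_iff.1 h
  refine eventually_prod_iff.2 ⟨pa, ha, _, eventually_eventually_nhds.2 hb, fun {x} hx {z} hz => ?_⟩
  exact hz.mono fun w hw => H hx hw

/-- Two families agree locally for small parameters. -/
def EvEq {α : Type*} (U : Set (Model n)) (f g : ℝ → Model n → α) : Prop :=
  ∀ y ∈ U, ∀ᶠ p in lz y, f p.1 p.2 = g p.1 p.2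

/-- For a fixed small parameter the two functions agree on a whole neighbourhood of the point, which
is what allows the equality to be differentiated. -/
lemma EvEq.nhds {α : Type*} {U : Set (Model n)} {f g : ℝ → Model n → α} (h : EvEq U f g)
    {y : Model n} (hy : y ∈ U) : ∀ᶠ p in lz y, f p.1 =ᶠ[𝓝 p.2] g p.1 :=
  eventually_lz_nhds (h y hy)

lemma pd_congr {k : Fin n} {f g : Model n → ℝ} {y : Model n} (h : f =ᶠ[𝓝 y] g) :
    pd k f y = pd k g y := by rw [pd, pd, h.fderiv_eq]

lemma EvEq.pd {U : Set (Model n)} {f g : ℝ → Model n → ℝ} (h : EvEq U f g) (k : Fin n) :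
    EvEq U (fun ε => pd k (f ε)) (fun ε => pd k (g ε)) :=
  fun _ hy => (h.nhds hy).mono fun _ hp => pd_congr hp

/-- Locally uniform boundedness of a family. -/
def Bdd (U : Set (Model n)) (f : ℝ → Model n → ℝ) : Prop :=
  ∀ y ∈ U, (fun p : ℝ × Model n => f p.1 p.2) =O[lz y] (fun _ => (1 : ℝ))

/-- A family that is `O(ε)` locally uniformly. -/
def BigOEps (U : Set (Model n)) (f : ℝ → Model n → ℝ) : Prop :=
  ∀ y ∈ U, (fun p : ℝ × Model n => f p.1 p.2) =O[lz y] (fun p => p.1)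

/-- Locally bounded almost everywhere convergence of a family. -/
structure Conv (U : Set (Model n)) (f : ℝ → Model n → ℝ) (f₀ : Model n → ℝ) : Prop where
  bdd : Bdd U f
  lim : ∀ᵐ y, y ∈ U → Tendsto (fun ε => f ε y) (𝓝[>] 0) (𝓝 (f₀ y))

/-- Locally bounded families converging to zero almost everywhere. -/
abbrev Negl (U : Set (Model n)) (f : ℝ → Model n → ℝ) : Prop := Conv U f (fun _ => 0)

variable {U V : Set (Model n)} {f g : ℝ → Model n → ℝ} {f₀ g₀ : Model n → ℝ}

lemma Bdd.mono (h : Bdd U f) (hV : V ⊆ U) : Bdd V f := fun y hy => h y (hV hy)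

lemma Bdd.add (hf : Bdd U f) (hg : Bdd U g) : Bdd U (fun ε y => f ε y + g ε y) :=
  fun y hy => (hf y hy).add (hg y hy)

lemma Bdd.mul (hf : Bdd U f) (hg : Bdd U g) : Bdd U (fun ε y => f ε y * g ε y) := by
  intro y hy
  simpa using (hf y hy).mul (hg y hy)

lemma Bdd.congr (hf : Bdd U f) (h : EvEq U f g) : Bdd U g :=
  fun y hy => (hf y hy).congr' (h y hy) EventuallyEq.rfl

lemma Bdd.of_continuousAt (h : ∀ y ∈ U, ContinuousAt f₀ y) : Bdd U (fun _ => f₀) := by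
  intro y hy
  exact ((h y hy).isBigO_one ℝ).comp_tendsto tendsto_snd

lemma isBigO_lz_fst_one (y : Model n) :
    (fun p : ℝ × Model n => p.1) =O[lz y] (fun _ => (1 : ℝ)) := by
  have : (fun ε : ℝ => ε) =O[𝓝[>] (0 : ℝ)] (fun _ => (1 : ℝ)) :=
    (continuousAt_id.isBigO_one ℝ).mono nhdsWithin_le_nhds
  exact this.comp_tendsto tendsto_fst

lemma BigOEps.bdd (h : BigOEps U f) : Bdd U f :=
  fun y hy => (h y hy).trans (isBigO_lz_fst_one y)

lemma BigOEps.mono (h : BigOEps U f) (hV : V ⊆ U) : BigOEps V f := fun y hy => h y (hV hy)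

lemma BigOEps.congr (hf : BigOEps U f) (h : EvEq U f g) : BigOEps U g :=
  fun y hy => (hf y hy).congr' (h y hy) EventuallyEq.rfl

lemma BigOEps.add (hf : BigOEps U f) (hg : BigOEps U g) : BigOEps U (fun ε y => f ε y + g ε y) :=
  fun y hy => (hf y hy).add (hg y hy)

lemma BigOEps.mul_bdd (hf : BigOEps U f) (hg : Bdd U g) :
    BigOEps U (fun ε y => f ε y * g ε y) := by
  intro y hy
  simpa using (hf y hy).mul (hg y hy)

lemma BigOEps.tendsto (h : BigOEps U f) {y : Model n} (hy : y ∈ U) :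
    Tendsto (fun p : ℝ × Model n => f p.1 p.2) (lz y) (𝓝 0) := by
  refine (h y hy).trans_tendsto ?_
  exact (tendsto_nhdsWithin_of_tendsto_nhds tendsto_id).comp tendsto_fst

lemma BigOEps.tendsto_right (h : BigOEps U f) {y : Model n} (hy : y ∈ U) :
    Tendsto (fun ε => f ε y) (𝓝[>] 0) (𝓝 0) :=
  (h.tendsto hy).comp (tendsto_id.prodMk tendsto_const_nhds)

lemma BigOEps.negl (h : BigOEps U f) : Negl U f :=
  ⟨h.bdd, Eventually.of_forall fun _ hy => h.tendsto_right hy⟩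

lemma Conv.mono (h : Conv U f f₀) (hV : V ⊆ U) : Conv V f f₀ :=
  ⟨h.bdd.mono hV, h.lim.mono fun _ hy hyV => hy (hV hyV)⟩

lemma Conv.congr (hf : Conv U f f₀) (h : EvEq U f g) : Conv U g f₀ := by
  refine ⟨hf.bdd.congr h, ?_⟩
  filter_upwards [hf.lim] with y hy hyU
  exact (hy hyU).congr' (eventually_of_lz (h y hyU))

lemma Conv.congr_lim (hf : Conv U f f₀) (h : ∀ᵐ y, y ∈ U → f₀ y = g₀ y) : Conv U f g₀ := by
  refine ⟨hf.bdd, ?_⟩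
  filter_upwards [hf.lim, h] with y hy h hyU
  rw [← h hyU]
  exact hy hyU

lemma Conv.add (hf : Conv U f f₀) (hg : Conv U g g₀) :
    Conv U (fun ε y => f ε y + g ε y) (fun y => f₀ y + g₀ y) := by
  refine ⟨hf.bdd.add hg.bdd, ?_⟩
  filter_upwards [hf.lim, hg.lim] with y h1 h2 hyU using (h1 hyU).add (h2 hyU)

lemma Conv.mul (hf : Conv U f f₀) (hg : Conv U g g₀) :
    Conv U (fun ε y => f ε y * g ε y) (fun y => f₀ y * g₀ y) := by
  refine ⟨hf.bdd.mul hg.bdd, ?_⟩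
  filter_upwards [hf.lim, hg.lim] with y h1 h2 hyU using (h1 hyU).mul (h2 hyU)

lemma Conv.of_continuousAt (h : ∀ y ∈ U, ContinuousAt f₀ y) : Conv U (fun _ => f₀) f₀ :=
  ⟨Bdd.of_continuousAt h, Eventually.of_forall fun _ _ => tendsto_const_nhds⟩

lemma Conv.const (c : ℝ) : Conv U (fun _ _ => c) (fun _ => c) :=
  Conv.of_continuousAt fun _ _ => continuousAt_const

lemma Conv.const_mul (c : ℝ) (hf : Conv U f f₀) :
    Conv U (fun ε y => c * f ε y) (fun y => c * f₀ y) := (Conv.const c).mul hf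

lemma Conv.neg (hf : Conv U f f₀) : Conv U (fun ε y => - f ε y) (fun y => - f₀ y) := by
  simpa using hf.const_mul (-1)

lemma Conv.sub (hf : Conv U f f₀) (hg : Conv U g g₀) :
    Conv U (fun ε y => f ε y - g ε y) (fun y => f₀ y - g₀ y) := by
  simpa [sub_eq_add_neg] using hf.add hg.neg

lemma Conv.sum {ι : Type*} {s : Finset ι} {f : ι → ℝ → Model n → ℝ} {f₀ : ι → Model n → ℝ}
    (hf : ∀ i ∈ s, Conv U (f i) (f₀ i)) :
    Conv U (fun ε y => ∑ i ∈ s, f i ε y) (fun y => ∑ i ∈ s, f₀ i y) := by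
  classical
  induction s using Finset.induction_on with
  | empty => simpa using Conv.const 0
  | insert a s ha ih =>
    simp only [Finset.sum_insert ha]
    exact (hf a (by simp)).add (ih fun i hi => hf i (by simp [hi]))

lemma Negl.sum {ι : Type*} {s : Finset ι} {f : ι → ℝ → Model n → ℝ}
    (hf : ∀ i ∈ s, Negl U (f i)) : Negl U (fun ε y => ∑ i ∈ s, f i ε y) := by
  simpa using Conv.sum hf

lemma Negl.add (hf : Negl U f) (hg : Negl U g) : Negl U (fun ε y => f ε y + g ε y) := by
  simpa using Conv.add hf hg

lemma Negl.sub (hf : Negl U f) (hg : Negl U g) : Negl U (fun ε y => f ε y - g ε y) := by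
  simpa using Conv.sub hf hg

/-- Negligible families absorb multiplication by bounded ones. -/
lemma Negl.bdd_mul (hf : Bdd U f) (hg : Negl U g) : Negl U (fun ε y => f ε y * g ε y) := by
  refine ⟨hf.mul hg.bdd, ?_⟩
  filter_upwards [hg.lim] with y h2 hyU
  have hb : (fun ε => f ε y) =O[𝓝[>] (0 : ℝ)] (fun _ => (1 : ℝ)) :=
    (hf y hyU).comp_tendsto (tendsto_id.prodMk tendsto_const_nhds)
  have := (hb.mul_isLittleO ((Asymptotics.isLittleO_one_iff ℝ).2 (h2 hyU)))
  simpa using this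

lemma Negl.const_mul (c : ℝ) (hf : Negl U f) : Negl U (fun ε y => c * f ε y) := by
  simpa using Conv.const_mul c hf

/-- An `O(ε)` family times an `o(1/ε)` family is negligible. -/
lemma Negl.bigOEps_mul (hf : BigOEps U f) (hg : Negl U (fun ε y => ε * g ε y)) :
    Negl U (fun ε y => f ε y * g ε y) := by
  -- The product is regrouped as `(f / ε) · (ε g)`, a bounded family times a negligible one.
  have h1 : Bdd U (fun ε y => f ε y * ε⁻¹) := by
    intro y hy
    have := (hf y hy).mul (Asymptotics.isBigO_refl (fun p : ℝ × Model n => p.1⁻¹) (lz y))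
    refine this.trans ?_
    refine Asymptotics.IsBigO.of_bound 1 ?_
    filter_upwards [eventually_pos_lz y] with p hp
    simp [mul_inv_cancel₀ hp.ne']
  refine (Negl.bdd_mul h1 hg).congr fun y _ => ?_
  filter_upwards [eventually_pos_lz y] with p hp
  field_simp

lemma Conv.of_locally (h : ∀ y ∈ U, ∃ V ∈ 𝓝 y, Conv V f f₀) : Conv U f f₀ := by
  refine ⟨fun y hy => ?_, ae_of_locally fun y hy => ?_⟩
  · obtain ⟨V, hV, h⟩ := h y hy
    exact h.bdd y (mem_of_mem_nhds hV)
  · obtain ⟨V, hV, h⟩ := h y hy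
    exact ⟨V, hV, h.lim⟩

/-- `τ` is a smooth change of coordinates from `U` into `V` with smooth left inverse `σ`. -/
structure CoordChange (τ σ : Model n → Model n) (U V : Set (Model n)) : Prop where
  isOpen_left : IsOpen U
  isOpen_right : IsOpen V
  smooth : ContDiffOn ℝ ∞ τ U
  smooth_inv : ContDiffOn ℝ ∞ σ V
  mapsTo : MapsTo τ U V
  left_inv : ∀ y ∈ U, σ (τ y) = y

namespace CoordChange

variable {τ σ : Model n → Model n} {U V : Set (Model n)}

lemma contDiffAt (h : CoordChange τ σ U V) {y : Model n} (hy : y ∈ U) : ContDiffAt ℝ ∞ τ y :=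
  h.smooth.contDiffAt (h.isOpen_left.mem_nhds hy)

lemma contDiffAt_inv (h : CoordChange τ σ U V) {y : Model n} (hy : y ∈ V) : ContDiffAt ℝ ∞ σ y :=
  h.smooth_inv.contDiffAt (h.isOpen_right.mem_nhds hy)

lemma mono (h : CoordChange τ σ U V) {U' V' : Set (Model n)} (hU' : IsOpen U') (hV' : IsOpen V')
    (hU : U' ⊆ U) (hV : V' ⊆ V) (hm : MapsTo τ U' V') : CoordChange τ σ U' V' :=
  ⟨hU', hV', h.smooth.mono hU, h.smooth_inv.mono hV, hm, fun y hy => h.left_inv y (hU hy)⟩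

/-- The preimage of a null set under `τ` lies in the image of a null set under the left inverse `σ`,
and a differentiable map between spaces of equal dimension sends null sets to null sets. -/
lemma ae_comp (h : CoordChange τ σ U V) {P : Model n → Prop} (hP : ∀ᵐ z, z ∈ V → P z) :
    ∀ᵐ y, y ∈ U → P (τ y) := by
  rw [ae_iff] at hP ⊢
  refine measure_mono_null (t := σ '' {z | ¬ (z ∈ V → P z)}) ?_ ?_
  · rintro w hw
    replace hw : ¬ (w ∈ U → P (τ w)) := hw
    rw [Classical.not_imp] at hw
    refine ⟨τ w, ?_, h.left_inv w hw.1⟩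
    change ¬ (τ w ∈ V → P (τ w))
    rw [Classical.not_imp]
    exact ⟨h.mapsTo hw.1, hw.2⟩
  · refine addHaar_image_eq_zero_of_differentiableOn_of_addHaar_eq_zero volume ?_ hP
    refine (h.smooth_inv.differentiableOn (by simp)).mono fun z hz => ?_
    by_contra hz'
    exact hz fun h => absurd h hz'

end CoordChange

lemma tendsto_lz_map {τ : Model n → Model n} {y : Model n} (h : ContinuousAt τ y) :
    Tendsto (fun p : ℝ × Model n => (p.1, τ p.2)) (lz y) (lz (τ y)) :=
  tendsto_fst.prodMk (h.tendsto.comp tendsto_snd)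

lemma Conv.comp_map {τ σ : Model n → Model n} (hf : Conv V f f₀) (h : CoordChange τ σ U V) :
    Conv U (fun ε y => f ε (τ y)) (fun y => f₀ (τ y)) := by
  refine ⟨fun y hy => ?_, h.ae_comp hf.lim⟩
  exact (hf.bdd (τ y) (h.mapsTo hy)).comp_tendsto
    (tendsto_lz_map (h.contDiffAt hy).continuousAt)

lemma BigOEps.comp_map {τ σ : Model n → Model n} (hf : BigOEps V f) (h : CoordChange τ σ U V) :
    BigOEps U (fun ε y => f ε (τ y)) := fun y hy =>
  (hf (τ y) (h.mapsTo hy)).comp_tendsto (tendsto_lz_map (h.contDiffAt hy).continuousAt)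

/-! ### Rules for partial derivatives -/

section PartialDerivatives

variable {k l : Fin n} {f g : Model n → ℝ} {y : Model n}

lemma pd_const (c : ℝ) : pd k (fun _ => c) y = 0 := by simp [pd]

lemma pd_add (hf : DifferentiableAt ℝ f y) (hg : DifferentiableAt ℝ g y) :
    pd k (fun z => f z + g z) y = pd k f y + pd k g y := by
  simp only [pd]; rw [fderiv_fun_add hf hg]; rfl

lemma pd_sub (hf : DifferentiableAt ℝ f y) (hg : DifferentiableAt ℝ g y) :
    pd k (fun z => f z - g z) y = pd k f y - pd k g y := by
  simp only [pd]; rw [fderiv_fun_sub hf hg]; rfl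

lemma pd_sum {ι : Type*} {s : Finset ι} {f : ι → Model n → ℝ}
    (hf : ∀ i ∈ s, DifferentiableAt ℝ (f i) y) :
    pd k (fun z => ∑ i ∈ s, f i z) y = ∑ i ∈ s, pd k (f i) y := by
  simp only [pd]; rw [fderiv_fun_sum hf]; simp

lemma pd_mul (hf : DifferentiableAt ℝ f y) (hg : DifferentiableAt ℝ g y) :
    pd k (fun z => f z * g z) y = pd k f y * g y + f y * pd k g y := by
  simp only [pd]; rw [fderiv_fun_mul hf hg]; simp; ring

lemma pd_const_mul (c : ℝ) : pd k (fun z => c * f z) y = c * pd k f y := by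
  simp only [pd]
  rw [show (fun z => c * f z) = c • f from rfl, fderiv_const_smul_field]; rfl

lemma pd_inv (hf : DifferentiableAt ℝ f y) (h : f y ≠ 0) :
    pd k (fun z => (f z)⁻¹) y = - (pd k f y * ((f y)⁻¹ * (f y)⁻¹)) := by
  simp only [pd]
  have := ((hasDerivAt_inv h).comp_hasFDerivAt y hf.hasFDerivAt).fderiv
  have e1 : ((fun z : ℝ => z⁻¹) ∘ f) = fun z => (f z)⁻¹ := rfl
  rw [e1] at this
  rw [this]
  simp; field_simp

lemma sum_smul_e (v : Model n) : ∑ a, v a • (e a : Model n) = v := by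
  ext i
  simp [e, Finset.sum_apply, Pi.single_apply]

lemma fderiv_apply_eq_sum_pd (v : Model n) : fderiv ℝ f y v = ∑ a, v a * pd a f y := by
  conv_lhs => rw [← sum_smul_e v]
  simp [pd]

lemma pd_coord {τ : Model n → Model n} (hτ : DifferentiableAt ℝ τ y) (a : Fin n) :
    pd k (fun z => τ z a) y = fderiv ℝ τ y (e k) a := by
  simp only [pd]
  have := ((EuclideanSpace.proj a : Model n →L[ℝ] ℝ).hasFDerivAt.comp y hτ.hasFDerivAt).fderiv
  have e1 : ((EuclideanSpace.proj a : Model n →L[ℝ] ℝ) ∘ τ) = fun z => τ z a := rfl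
  rw [e1] at this
  rw [this]; rfl

lemma pd_comp {τ : Model n → Model n} (hf : DifferentiableAt ℝ f (τ y))
    (hτ : DifferentiableAt ℝ τ y) :
    pd k (fun z => f (τ z)) y = ∑ a, pd a f (τ y) * pd k (fun z => τ z a) y := by
  have h1 : fderiv ℝ (fun z => f (τ z)) y = (fderiv ℝ f (τ y)).comp (fderiv ℝ τ y) :=
    fderiv_comp y hf hτ
  rw [pd, h1]
  simp only [ContinuousLinearMap.comp_apply]
  rw [fderiv_apply_eq_sum_pd]
  refine Finset.sum_congr rfl fun a _ => ?_
  rw [pd_coord hτ, mul_comm]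

lemma contDiffAt_pd (hf : ContDiffAt ℝ ∞ f y) (k : Fin n) : ContDiffAt ℝ ∞ (pd k f) y :=
  (hf.fderiv_right (m := ∞) (by simp)).clm_apply contDiffAt_const

lemma contDiffAt_coord {τ : Model n → Model n} (hτ : ContDiffAt ℝ ∞ τ y) (a : Fin n) :
    ContDiffAt ℝ ∞ (fun z => τ z a) y :=
  (EuclideanSpace.proj a : Model n →L[ℝ] ℝ).contDiff.contDiffAt.comp y hτ

lemma _root_.ContDiffAt.dif (hf : ContDiffAt ℝ ∞ f y) : DifferentiableAt ℝ f y :=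
  hf.differentiableAt (by simp)

lemma pd_comm (hf : ContDiffAt ℝ ∞ f y) (k l : Fin n) : pd k (pd l f) y = pd l (pd k f) y := by
  have h2 : IsSymmSndFDerivAt ℝ f y := hf.isSymmSndFDerivAt (by
    rw [minSmoothness_of_isRCLikeNormedField]; exact WithTop.coe_le_coe.2 le_top)
  have hd : DifferentiableAt ℝ (fderiv ℝ f) y :=
    (hf.fderiv_right (m := ∞) (by simp)).differentiableAt (by simp)
  have key : ∀ v w : Model n, fderiv ℝ (fun z => fderiv ℝ f z v) y w = fderiv ℝ (fderiv ℝ f) y w v := by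
    intro v w
    rw [fderiv_clm_apply hd (differentiableAt_const v)]
    simp
  change fderiv ℝ (fun z => fderiv ℝ f z (e l)) y (e k) =
    fderiv ℝ (fun z => fderiv ℝ f z (e k)) y (e l)
  rw [key, key]
  exact h2 _ _

end PartialDerivatives

/-! ### Stability of the approximation classes under algebra and changes of coordinates -/

/-- A family of functions, locally eventually smooth, converging to a locally Lipschitz function
at rate `O(ε)`, with derivatives converging boundedly almost everywhere. -/
structure Approx (U : Set (Model n)) (f : ℝ → Model n → ℝ) (f₀ : Model n → ℝ) : Prop where
  smooth : ∀ y ∈ U, ∀ᶠ p in lz y, ContDiffAt ℝ ∞ (f p.1) p.2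
  lip : ∀ y ∈ U, LipAt f₀ y
  close : BigOEps U (fun ε y => f ε y - f₀ y)
  deriv : ∀ k, Conv U (fun ε => pd k (f ε)) (pd k f₀)

namespace Approx

lemma bdd_lim (hf : Approx U f f₀) : Bdd U (fun _ => f₀) :=
  Bdd.of_continuousAt fun y hy => (hf.lip y hy).continuousAt

lemma bdd (hf : Approx U f f₀) : Bdd U f := by
  simpa using hf.close.bdd.add hf.bdd_lim

lemma tendsto (hf : Approx U f f₀) {y : Model n} (hy : y ∈ U) :
    Tendsto (fun p : ℝ × Model n => f p.1 p.2) (lz y) (𝓝 (f₀ y)) := by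
  have := (hf.close.tendsto hy).add ((hf.lip y hy).continuousAt.tendsto.comp
    (tendsto_snd (f := 𝓝[>] (0 : ℝ))))
  simpa using this

lemma conv (hf : Approx U f f₀) : Conv U f f₀ :=
  ⟨hf.bdd, Eventually.of_forall fun _ hy =>
    (hf.tendsto hy).comp (tendsto_id.prodMk tendsto_const_nhds)⟩

lemma congr (hf : Approx U f f₀) (h : EvEq U f g) : Approx U g f₀ where
  smooth y hy := by
    filter_upwards [hf.smooth y hy, h.nhds hy] with p h1 h2
    exact h1.congr_of_eventuallyEq h2.symm
  lip := hf.lip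
  close := hf.close.congr fun y hy => (h y hy).mono fun p hp => by simp only [hp]
  deriv k := (hf.deriv k).congr (h.pd k)

lemma congr_lim (hU : IsOpen U) (hf : Approx U f f₀) (h : EqOn f₀ g₀ U) : Approx U f g₀ where
  smooth := hf.smooth
  lip y hy := (hf.lip y hy).congr (h.eventuallyEq_of_mem (hU.mem_nhds hy))
  close := hf.close.congr fun y hy => by
    filter_upwards [eventually_lz_of_nhds (hU.mem_nhds hy)] with p hp
    rw [h hp]
  deriv k := (hf.deriv k).congr_lim <| Eventually.of_forall fun y hy =>
    pd_congr (h.eventuallyEq_of_mem (hU.mem_nhds hy))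

lemma of_smooth (hU : IsOpen U) (h : ∀ y ∈ U, ContDiffAt ℝ ∞ f₀ y) :
    Approx U (fun _ => f₀) f₀ where
  smooth y hy := eventually_lz_of_nhds ((hU.eventually_mem hy).mono h)
  lip y hy := LipAt.of_contDiffAt (h y hy)
  close y _ := by simpa using Asymptotics.isBigO_zero _ _
  deriv k := Conv.of_continuousAt fun y hy => (contDiffAt_pd (h y hy) k).continuousAt

lemma const (hU : IsOpen U) (c : ℝ) : Approx U (fun _ _ => c) (fun _ => c) :=
  of_smooth hU fun _ _ => contDiffAt_const

lemma add (hf : Approx U f f₀) (hg : Approx U g g₀) :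
    Approx U (fun ε y => f ε y + g ε y) (fun y => f₀ y + g₀ y) where
  smooth y hy := by
    filter_upwards [hf.smooth y hy, hg.smooth y hy] with p h1 h2 using h1.add h2
  lip y hy := (hf.lip y hy).add (hg.lip y hy)
  close := (hf.close.add hg.close).congr fun y _ => Eventually.of_forall fun p => by ring
  deriv k := by
    -- The approximants are smooth for small parameters, so the sum rule holds for them at every
    -- nearby point. For the Lipschitz limits it is only available almost everywhere, by Rademacher.
    refine (((hf.deriv k).add (hg.deriv k)).congr (g := fun ε => pd k fun y => f ε y + g ε y)
      fun y hy => ?_).congr_lim ?_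
    · filter_upwards [hf.smooth y hy, hg.smooth y hy] with p h1 h2
      rw [pd_add h1.dif h2.dif]
    · filter_upwards [ae_differentiableAt_of_lipAt hf.lip, ae_differentiableAt_of_lipAt hg.lip]
        with y h1 h2 hy
      rw [pd_add (h1 hy) (h2 hy)]

lemma mul (hf : Approx U f f₀) (hg : Approx U g g₀) :
    Approx U (fun ε y => f ε y * g ε y) (fun y => f₀ y * g₀ y) where
  smooth y hy := by
    filter_upwards [hf.smooth y hy, hg.smooth y hy] with p h1 h2 using h1.mul h2
  lip y hy := (hf.lip y hy).mul (hg.lip y hy)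
  close := ((hf.close.mul_bdd hg.bdd).add (hg.close.mul_bdd hf.bdd_lim)).congr
    fun y _ => Eventually.of_forall fun p => by ring
  deriv k := by
    refine ((((hf.deriv k).mul hg.conv).add (hf.conv.mul (hg.deriv k))).congr
      (g := fun ε => pd k fun y => f ε y * g ε y) fun y hy => ?_).congr_lim ?_
    · filter_upwards [hf.smooth y hy, hg.smooth y hy] with p h1 h2
      rw [pd_mul h1.dif h2.dif]
    · filter_upwards [ae_differentiableAt_of_lipAt hf.lip, ae_differentiableAt_of_lipAt hg.lip]
        with y h1 h2 hy
      rw [pd_mul (h1 hy) (h2 hy)]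

lemma sum (hU : IsOpen U) {ι : Type*} {s : Finset ι} {f : ι → ℝ → Model n → ℝ}
    {f₀ : ι → Model n → ℝ} (hf : ∀ i ∈ s, Approx U (f i) (f₀ i)) :
    Approx U (fun ε y => ∑ i ∈ s, f i ε y) (fun y => ∑ i ∈ s, f₀ i y) := by
  classical
  induction s using Finset.induction_on with
  | empty => simpa using Approx.const hU 0
  | insert a s ha ih =>
    simp only [Finset.sum_insert ha]
    exact (hf a (by simp)).add (ih fun i hi => hf i (by simp [hi]))

lemma prod (hU : IsOpen U) {ι : Type*} {s : Finset ι} {f : ι → ℝ → Model n → ℝ}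
    {f₀ : ι → Model n → ℝ} (hf : ∀ i ∈ s, Approx U (f i) (f₀ i)) :
    Approx U (fun ε y => ∏ i ∈ s, f i ε y) (fun y => ∏ i ∈ s, f₀ i y) := by
  classical
  induction s using Finset.induction_on with
  | empty => simpa using Approx.const hU 1
  | insert a s ha ih =>
    simp only [Finset.prod_insert ha]
    exact (hf a (by simp)).mul (ih fun i hi => hf i (by simp [hi]))

lemma eventually_ne_zero (hf : Approx U f f₀) {y : Model n} (hy : y ∈ U) (h : f₀ y ≠ 0) :
    ∀ᶠ p in lz y, f p.1 p.2 ≠ 0 := (hf.tendsto hy).eventually_ne h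

lemma inv (hf : Approx U f f₀) (h0 : ∀ y ∈ U, f₀ y ≠ 0) :
    Approx U (fun ε y => (f ε y)⁻¹) (fun y => (f₀ y)⁻¹) := by
  have hb : Bdd U (fun ε y => (f ε y)⁻¹) := fun y hy =>
    ((hf.tendsto hy).inv₀ (h0 y hy)).isBigO_one ℝ
  have hb0 : Bdd U (fun _ y => (f₀ y)⁻¹) :=
    Bdd.of_continuousAt fun y hy => ((hf.lip y hy).inv (h0 y hy)).continuousAt
  have hc : Conv U (fun ε y => (f ε y)⁻¹) (fun y => (f₀ y)⁻¹) := by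
    refine ⟨hb, Eventually.of_forall fun y hy => ?_⟩
    exact ((hf.tendsto hy).comp (tendsto_id.prodMk tendsto_const_nhds)).inv₀ (h0 y hy)
  refine ⟨fun y hy => ?_, fun y hy => (hf.lip y hy).inv (h0 y hy), ?_, fun k => ?_⟩
  · filter_upwards [hf.smooth y hy, hf.eventually_ne_zero hy (h0 y hy)] with p h1 h2
      using h1.inv h2
  -- The rate comes from `1/f - 1/f₀ = -(f - f₀) · (1/f) · (1/f₀)`, whose last two factors are
  -- bounded.
  · refine ((hf.close.mul_bdd (hb.mul hb0)).mul_bdd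
      (Conv.const (U := U) (-1 : ℝ)).bdd).congr fun y hy => ?_
    filter_upwards [hf.eventually_ne_zero hy (h0 y hy), eventually_lz_of_nhds
      ((hf.lip y hy).continuousAt.eventually_ne (h0 y hy))] with p h1 h2
    field_simp
    ring
  · refine (((hf.deriv k).mul (hc.mul hc)).neg.congr (g := fun ε => pd k fun y => (f ε y)⁻¹)
      fun y hy => ?_).congr_lim ?_
    · filter_upwards [hf.smooth y hy, hf.eventually_ne_zero hy (h0 y hy)] with p h1 h2
      rw [pd_inv h1.dif h2]
    · filter_upwards [ae_differentiableAt_of_lipAt hf.lip] with y h1 hy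
      rw [pd_inv (h1 hy) (h0 y hy)]

lemma comp_map {τ σ : Model n → Model n} (hf : Approx V f f₀) (h : CoordChange τ σ U V) :
    Approx U (fun ε y => f ε (τ y)) (fun y => f₀ (τ y)) := by
  have hev : ∀ y ∈ U, ∀ᶠ z in 𝓝 y, ContDiffAt ℝ ∞ τ z := fun y hy =>
    (h.isOpen_left.eventually_mem hy).mono fun z hz => h.contDiffAt hz
  refine ⟨fun y hy => ?_, fun y hy => (hf.lip _ (h.mapsTo hy)).comp_map (h.contDiffAt hy),
    hf.close.comp_map h, fun k => ?_⟩
  · filter_upwards [(tendsto_lz_map (h.contDiffAt hy).continuousAt).eventually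
      (hf.smooth _ (h.mapsTo hy)), eventually_lz_of_nhds (hev y hy)] with p h1 h2
    exact h1.comp p.2 h2
  · have hs : ∀ a, Conv U (fun _ => pd k fun z => τ z a) (pd k fun z => τ z a) := fun a =>
      Conv.of_continuousAt fun y hy =>
        (contDiffAt_pd (contDiffAt_coord (h.contDiffAt hy) a) k).continuousAt
    refine ((Conv.sum (s := Finset.univ) fun a _ =>
      ((hf.deriv a).comp_map h).mul (hs a)).congr (g := fun ε => pd k fun y => f ε (τ y))
      fun y hy => ?_).congr_lim ?_
    · filter_upwards [(tendsto_lz_map (h.contDiffAt hy).continuousAt).eventually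
        (hf.smooth _ (h.mapsTo hy)), eventually_lz_of_nhds (hev y hy)] with p h1 h2
      rw [pd_comp h1.dif (h2.differentiableAt (by simp))]
    · filter_upwards [h.ae_comp (ae_differentiableAt_of_lipAt hf.lip)] with y h1 hy
      rw [pd_comp (h1 hy) ((h.contDiffAt hy).differentiableAt (by simp))]

end Approx

/-- Families that are negligible together with their derivatives of order at most two. -/
structure NeglTwo (U : Set (Model n)) (f : ℝ → Model n → ℝ) : Prop where
  smooth : ∀ y ∈ U, ∀ᶠ p in lz y, ContDiffAt ℝ ∞ (f p.1) p.2
  zero : Negl U f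
  one : ∀ k, Negl U (fun ε => pd k (f ε))
  two : ∀ k l, Negl U (fun ε => pd k (pd l (f ε)))

namespace NeglTwo

lemma mono (hf : NeglTwo U f) (h : V ⊆ U) : NeglTwo V f :=
  ⟨fun y hy => hf.smooth y (h hy), hf.zero.mono h, fun k => (hf.one k).mono h,
    fun k l => (hf.two k l).mono h⟩

lemma congr (hf : NeglTwo U f) (h : EvEq U f g) : NeglTwo U g where
  smooth y hy := by
    filter_upwards [hf.smooth y hy, h.nhds hy] with p h1 h2
    exact h1.congr_of_eventuallyEq h2.symm
  zero := hf.zero.congr h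
  one k := (hf.one k).congr (h.pd k)
  two k l := (hf.two k l).congr ((h.pd l).pd k)

lemma add (hf : NeglTwo U f) (hg : NeglTwo U g) : NeglTwo U (fun ε y => f ε y + g ε y) := by
  have h1 : ∀ l, EvEq U (fun ε y => pd l (f ε) y + pd l (g ε) y)
      (fun ε => pd l fun y => f ε y + g ε y) := fun l y hy => by
    filter_upwards [hf.smooth y hy, hg.smooth y hy] with p h1 h2
    rw [pd_add h1.dif h2.dif]
  refine ⟨fun y hy => ?_, hf.zero.add hg.zero, fun k => ?_, fun k l => ?_⟩
  · filter_upwards [hf.smooth y hy, hg.smooth y hy] with p h1 h2 using h1.add h2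
  · exact ((hf.one k).add (hg.one k)).congr (h1 k)
  · refine (((hf.two k l).add (hg.two k l)).congr fun y hy => ?_).congr ((h1 l).pd k)
    filter_upwards [hf.smooth y hy, hg.smooth y hy] with p h1 h2
    rw [pd_add (contDiffAt_pd h1 l).dif (contDiffAt_pd h2 l).dif]

lemma zero_family : NeglTwo U (fun _ _ => 0) where
  smooth y _ := Eventually.of_forall fun p => contDiffAt_const
  zero := Conv.const 0
  one k := by simpa [funext fun y : Model n => pd_const (k := k) (y := y) 0] using Conv.const 0
  two k l := by
    have : ∀ l, pd l (fun _ : Model n => (0 : ℝ)) = fun _ => 0 := fun l => funext fun y => pd_const 0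
    simpa [this] using Conv.const 0

lemma sum {ι : Type*} {s : Finset ι} {f : ι → ℝ → Model n → ℝ}
    (hf : ∀ i ∈ s, NeglTwo U (f i)) : NeglTwo U (fun ε y => ∑ i ∈ s, f i ε y) := by
  classical
  induction s using Finset.induction_on with
  | empty => simpa using NeglTwo.zero_family
  | insert a s ha ih =>
    simp only [Finset.sum_insert ha]
    exact (hf a (by simp)).add (ih fun i hi => hf i (by simp [hi]))

lemma smooth_mul (hU : IsOpen U) {φ : Model n → ℝ} (hφ : ∀ y ∈ U, ContDiffAt ℝ ∞ φ y)
    (hf : NeglTwo U f) : NeglTwo U (fun ε y => φ y * f ε y) := by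
  have hev : ∀ y ∈ U, ∀ᶠ p in lz y, ContDiffAt ℝ ∞ φ p.2 := fun y hy =>
    eventually_lz_of_nhds ((hU.eventually_mem hy).mono hφ)
  have b0 : Bdd U (fun _ => φ) := Bdd.of_continuousAt fun y hy => (hφ y hy).continuousAt
  have b1 : ∀ k, Bdd U (fun _ => pd k φ) := fun k =>
    Bdd.of_continuousAt fun y hy => (contDiffAt_pd (hφ y hy) k).continuousAt
  have b2 : ∀ k l, Bdd U (fun _ => pd k (pd l φ)) := fun k l =>
    Bdd.of_continuousAt fun y hy => (contDiffAt_pd (contDiffAt_pd (hφ y hy) l) k).continuousAt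
  have e1 : ∀ l, EvEq U (fun ε y => pd l φ y * f ε y + φ y * pd l (f ε) y)
      (fun ε => pd l fun y => φ y * f ε y) := fun l y hy => by
    filter_upwards [hev y hy, hf.smooth y hy] with p h1 h2
    rw [pd_mul h1.dif h2.dif]
  refine ⟨fun y hy => ?_, Negl.bdd_mul b0 hf.zero, fun k => ?_, fun k l => ?_⟩
  · filter_upwards [hev y hy, hf.smooth y hy] with p h1 h2 using h1.mul h2
  · exact ((Negl.bdd_mul (b1 k) hf.zero).add (Negl.bdd_mul b0 (hf.one k))).congr (e1 k)
  · refine ((((Negl.bdd_mul (b2 k l) hf.zero).add (Negl.bdd_mul (b1 l) (hf.one k))).add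
      ((Negl.bdd_mul (b1 k) (hf.one l)).add (Negl.bdd_mul b0 (hf.two k l)))).congr
      fun y hy => ?_).congr ((e1 l).pd k)
    filter_upwards [hev y hy, hf.smooth y hy] with p h1 h2
    have d1 := (contDiffAt_pd h1 l)
    have d2 := (contDiffAt_pd h2 l)
    rw [pd_add (d1.mul h2).dif (h1.mul d2).dif, pd_mul d1.dif h2.dif, pd_mul h1.dif d2.dif]

/-- The chain rule writes the first and second derivatives of the composition as combinations of the
derivatives of `f` at `τ y`, of order one and two, with coefficients that are continuous and
independent of `ε`. -/
lemma comp_map {τ σ : Model n → Model n} (hf : NeglTwo V f) (h : CoordChange τ σ U V) :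
    NeglTwo U (fun ε y => f ε (τ y)) := by
  have hτ : ∀ y ∈ U, ∀ᶠ p in lz y, ContDiffAt ℝ ∞ τ p.2 := fun y hy =>
    eventually_lz_of_nhds ((h.isOpen_left.eventually_mem hy).mono
      fun z hz => h.contDiffAt hz)
  have hs : ∀ y ∈ U, ∀ᶠ p in lz y, ContDiffAt ℝ ∞ (f p.1) (τ p.2) := fun y hy =>
    (tendsto_lz_map (h.contDiffAt hy).continuousAt).eventually (hf.smooth _ (h.mapsTo hy))
  have b1 : ∀ k a, Bdd U (fun _ => pd k fun z => τ z a) := fun k a =>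
    Bdd.of_continuousAt fun y hy =>
      (contDiffAt_pd (contDiffAt_coord (h.contDiffAt hy) a) k).continuousAt
  have b2 : ∀ k l a, Bdd U (fun _ => pd k (pd l fun z => τ z a)) := fun k l a =>
    Bdd.of_continuousAt fun y hy =>
      (contDiffAt_pd (contDiffAt_pd (contDiffAt_coord (h.contDiffAt hy) a) l) k).continuousAt
  have e1 : ∀ l, EvEq U (fun ε y => ∑ a, pd l (fun z => τ z a) y * pd a (f ε) (τ y))
      (fun ε => pd l fun y => f ε (τ y)) := fun l y hy => by
    filter_upwards [hτ y hy, hs y hy] with p h1 h2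
    rw [pd_comp h2.dif (h1.differentiableAt (by simp))]
    exact Finset.sum_congr rfl fun a _ => mul_comm _ _
  refine ⟨fun y hy => ?_, by simpa using hf.zero.comp_map h, fun k => ?_, fun k l => ?_⟩
  · filter_upwards [hτ y hy, hs y hy] with p h1 h2 using h2.comp p.2 h1
  · exact (Negl.sum fun a _ => Negl.bdd_mul (b1 k a) ((hf.one a).comp_map h)).congr (e1 k)
  · have e2 : EvEq U (fun ε y => ∑ a, (pd k (pd l fun z => τ z a) y * pd a (f ε) (τ y) +
        pd l (fun z => τ z a) y * ∑ b, pd k (fun z => τ z b) y * pd b (pd a (f ε)) (τ y)))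
        (fun ε => pd k fun y => ∑ a, pd l (fun z => τ z a) y * pd a (f ε) (τ y)) := by
      intro y hy
      filter_upwards [hτ y hy, hs y hy] with p h1 h2
      have c1 : ∀ a, ContDiffAt ℝ ∞ (pd l fun z => τ z a) p.2 := fun a =>
        contDiffAt_pd (contDiffAt_coord h1 a) l
      have c2 : ∀ a, ContDiffAt ℝ ∞ (pd a (f p.1)) (τ p.2) := fun a => contDiffAt_pd h2 a
      have c3 : ∀ a, ContDiffAt ℝ ∞ (fun z => pd a (f p.1) (τ z)) p.2 :=
        fun a => (c2 a).comp p.2 h1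
      rw [pd_sum fun a _ => ((c1 a).mul (c3 a)).dif]
      refine Finset.sum_congr rfl fun a _ => ?_
      rw [pd_mul (c1 a).dif (c3 a).dif, pd_comp (c2 a).dif (h1.differentiableAt (by simp))]
      congr 2
      exact Finset.sum_congr rfl fun b _ => mul_comm _ _
    refine ((Negl.sum fun a _ => ?_).congr e2).congr ((e1 l).pd k)
    refine (Negl.bdd_mul (b2 k l a) ((hf.one a).comp_map h)).add
      (Negl.bdd_mul (b1 l a) (Negl.sum fun b _ =>
        Negl.bdd_mul (b1 k b) ((hf.two b a).comp_map h)))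

end NeglTwo

end Classes

/-! ### Mollification of bounded and Lipschitz functions; the Friedrichs commutator -/

section Mollification

variable {n : ℕ}

/-- The integral `∫ u(z) ε⁻ⁿ κ((y - z)/ε) dz`. -/
def mol (κ : Model n → ℝ) (ε : ℝ) (u : Model n → ℝ) (y : Model n) : ℝ :=
  ∫ z, u z * ((ε ^ n)⁻¹ * κ (ε⁻¹ • (y - z)))

/-- The substitution `z ↦ y - ε z` moves the parameter from the kernel to the function, so that
estimates are made against a fixed kernel supported in the unit ball. -/
lemma mol_eq (κ : Model n → ℝ) {ε : ℝ} (hε : 0 < ε) (u : Model n → ℝ) (y : Model n) :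
    mol κ ε u y = ∫ z, u (y - ε • z) * κ z := by
  have h1 := Measure.integral_comp_smul (volume : Measure (Model n))
    (fun w => u (y - w) * κ (ε⁻¹ • w)) ε
  have h2 : ∀ z : Model n, ε⁻¹ • ε • z = z := fun z => inv_smul_smul₀ hε.ne' z
  simp only [h2] at h1
  rw [h1, mol, ← integral_sub_left_eq_self (fun z => u z * ((ε ^ n)⁻¹ * κ (ε⁻¹ • (y - z))))
    volume y]
  simp only [sub_sub_cancel, finrank_euclideanSpace, Fintype.card_fin, smul_eq_mul]
  rw [abs_of_pos (by positivity), ← integral_const_mul]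
  congr 1
  ext z
  ring

/-- Bounded measurable functions. -/
structure BddMeas (u : Model n → ℝ) : Prop where
  measurable : Measurable u
  bound : ∃ C, ∀ y, |u y| ≤ C

/-- Bounded measurable kernels supported in the closed unit ball. -/
structure Ker (κ : Model n → ℝ) : Prop extends BddMeas κ where
  supp : ∀ z, 1 < ‖z‖ → κ z = 0

variable {u f a κ ρ : Model n → ℝ}

lemma BddMeas.locallyIntegrable (hu : BddMeas u) : LocallyIntegrable u := by
  obtain ⟨C, hC⟩ := hu.bound
  refine LocallyIntegrable.mono (f := fun _ => C) (g := u) (locallyIntegrable_const C)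
    hu.measurable.aestronglyMeasurable (Eventually.of_forall fun y => ?_)
  rw [Real.norm_eq_abs, Real.norm_eq_abs]
  exact (hC y).trans (le_abs_self C)

lemma BddMeas.add {u v : Model n → ℝ} (hu : BddMeas u) (hv : BddMeas v) :
    BddMeas (fun y => u y + v y) := by
  obtain ⟨C, hC⟩ := hu.bound
  obtain ⟨C', hC'⟩ := hv.bound
  exact ⟨hu.measurable.add hv.measurable, C + C', fun y =>
    (abs_add_le _ _).trans (add_le_add (hC y) (hC' y))⟩

lemma BddMeas.mul {u v : Model n → ℝ} (hu : BddMeas u) (hv : BddMeas v) :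
    BddMeas (fun y => u y * v y) := by
  obtain ⟨C, hC⟩ := hu.bound
  obtain ⟨C', hC'⟩ := hv.bound
  refine ⟨hu.measurable.mul hv.measurable, C * C', fun y => ?_⟩
  rw [abs_mul]
  exact mul_le_mul (hC y) (hC' y) (abs_nonneg _) ((abs_nonneg _).trans (hC y))

lemma BddMeas.const (c : ℝ) : BddMeas (fun _ : Model n => c) :=
  ⟨measurable_const, |c|, fun _ => le_rfl⟩

lemma BddMeas.sum {ι : Type*} {s : Finset ι} {u : ι → Model n → ℝ}
    (h : ∀ i ∈ s, BddMeas (u i)) : BddMeas (fun y => ∑ i ∈ s, u i y) := by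
  classical
  induction s using Finset.induction_on with
  | empty => simpa using BddMeas.const 0
  | insert a s ha ih =>
    simp only [Finset.sum_insert ha]
    exact (h a (by simp)).add (ih fun i hi => h i (by simp [hi]))

lemma BddMeas.of_continuous (hc : Continuous u) (hs : HasCompactSupport u) : BddMeas u := by
  obtain ⟨C, hC⟩ := hs.exists_bound_of_continuous hc
  exact ⟨hc.measurable, C, hC⟩

lemma BddMeas.pd_of_lipschitz {K : NNReal} (hf : LipschitzWith K f) (k : Fin n) :
    BddMeas (pd k f) :=
  ⟨measurable_fderiv_apply_const ℝ f (e k), K, fun y =>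
    (abs_pd_le k f y).trans (norm_fderiv_le_of_lipschitz ℝ hf)⟩

lemma Ker.integrable (hκ : Ker κ) : Integrable κ := by
  have h : Function.support κ ⊆ Metric.closedBall 0 1 := fun z hz => by
    by_contra h
    exact hz (hκ.supp z (by simpa using h))
  rw [← integrableOn_iff_integrable_of_support_subset h]
  exact hκ.locallyIntegrable.integrableOn_isCompact (isCompact_closedBall 0 1)

lemma integrable_bddMeas_comp_mul (hu : BddMeas u) (hκ : Integrable κ) (ε : ℝ) (y : Model n) :
    Integrable (fun z => u (y - ε • z) * κ z) := by
  obtain ⟨C, hC⟩ := hu.bound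
  refine hκ.bdd_mul (c := C) ?_ (Eventually.of_forall fun z => hC _)
  have : Measurable fun z : Model n => y - ε • z := by fun_prop
  exact (hu.measurable.comp this).aestronglyMeasurable

lemma abs_mol_le {C : ℝ} (hC : ∀ y, |u y| ≤ C) (hκ : Ker κ) {ε : ℝ} (hε : 0 < ε) (y : Model n) :
    |mol κ ε u y| ≤ C * ∫ z, |κ z| := by
  rw [mol_eq κ hε, ← integral_const_mul]
  refine (abs_integral_le_integral_abs).trans ?_
  refine integral_mono_of_nonneg (Eventually.of_forall fun z => abs_nonneg _)
    (hκ.integrable.abs.const_mul C) (Eventually.of_forall fun z => ?_)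
  simp only [abs_mul]
  exact mul_le_mul_of_nonneg_right (hC _) (abs_nonneg _)

lemma Bdd.of_bound {U : Set (Model n)} {f : ℝ → Model n → ℝ} {C : ℝ}
    (h : ∀ ε > 0, ∀ y, |f ε y| ≤ C) : Bdd U f := fun y _ => by
  refine Asymptotics.IsBigO.of_bound C ?_
  filter_upwards [eventually_pos_lz y] with p hp
  simpa using h p.1 hp p.2

lemma BddMeas.bdd_mol (hu : BddMeas u) (hκ : Ker κ) (U : Set (Model n)) :
    Bdd U (fun ε => mol κ ε u) := by
  obtain ⟨C, hC⟩ := hu.bound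
  exact Bdd.of_bound fun ε hε y => abs_mol_le hC hκ hε y

/-- The Lebesgue differentiation theorem in rescaled form. -/
lemma BddMeas.ae_tendsto_integral_abs_sub (hu : BddMeas u) :
    ∀ᵐ y, Tendsto (fun ε : ℝ => ∫ z in Metric.closedBall (0 : Model n) 1, |u (y - ε • z) - u y|)
      (𝓝[>] 0) (𝓝 0) := by
  filter_upwards [IsUnifLocDoublingMeasure.ae_tendsto_average_norm_sub (volume : Measure (Model n))
    hu.locallyIntegrable 1] with y hy
  have h1 := hy (l := 𝓝[>] (0 : ℝ)) (fun _ => y) (fun ε => ε) tendsto_id (by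
    filter_upwards [self_mem_nhdsWithin] with ε hε
    simpa using le_of_lt hε)
  -- Rescaling turns the average over the ball of radius `ε` into the integral over the unit ball
  -- divided by the volume of the unit ball; this factor removes the division.
  have h2 := h1.const_mul ((volume (Metric.closedBall (0 : Model n) 1)).toReal)
  rw [mul_zero] at h2
  refine h2.congr' ?_
  filter_upwards [self_mem_nhdsWithin] with ε hε
  have hε' : (0 : ℝ) < ε := hε
  -- The change of variables is `mol_eq` for the indicator function of the unit ball as kernel.
  have h3 := mol_eq ((Metric.closedBall (0 : Model n) 1).indicator fun _ => (1 : ℝ)) hε'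
    (fun z => |u z - u y|) y
  have h4 : ∀ v : Model n → ℝ, ∫ z in Metric.closedBall (0 : Model n) 1, v z =
      ∫ z, v z * (Metric.closedBall (0 : Model n) 1).indicator (fun _ => (1 : ℝ)) z := by
    intro v
    rw [← integral_indicator measurableSet_closedBall]
    congr 1
    ext z
    by_cases hz : z ∈ Metric.closedBall (0 : Model n) 1 <;> simp [indicator, hz]
  rw [h4 (fun z => |u (y - ε • z) - u y|), ← h3, mol, setAverage_eq, smul_eq_mul]
  have h5 : ∀ z : Model n, ε⁻¹ • (y - z) ∈ Metric.closedBall (0 : Model n) 1 ↔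
      z ∈ Metric.closedBall y ε := by
    intro z
    rw [mem_closedBall_zero_iff, norm_smul, norm_inv, Real.norm_of_nonneg hε'.le,
      inv_mul_le_iff₀ hε', mul_one, Metric.mem_closedBall, dist_comm, dist_eq_norm]
  have h6 : ∀ z, |u z - u y| * ((ε ^ n)⁻¹ *
      (Metric.closedBall (0 : Model n) 1).indicator (fun _ => (1 : ℝ)) (ε⁻¹ • (y - z))) =
      (ε ^ n)⁻¹ * (Metric.closedBall y ε).indicator (fun z => |u z - u y|) z := by
    intro z
    by_cases hz : z ∈ Metric.closedBall y ε
    · rw [indicator_of_mem hz, indicator_of_mem ((h5 z).2 hz)]; ring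
    · rw [indicator_of_notMem hz, indicator_of_notMem fun h => hz ((h5 z).1 h)]; ring
  simp only [h6]
  rw [integral_const_mul, integral_indicator measurableSet_closedBall, Measure.real,
    Measure.addHaar_closedBall _ _ hε'.le, ENNReal.toReal_mul,
    ENNReal.toReal_ofReal (by positivity), finrank_euclideanSpace, Fintype.card_fin]
  have hv : (volume (Metric.ball (0 : Model n) 1)).toReal ≠ 0 :=
    (ENNReal.toReal_pos (Metric.measure_ball_pos volume _ one_pos).ne'
      measure_ball_lt_top.ne).ne'
  have hv' : (volume (Metric.closedBall (0 : Model n) 1)).toReal =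
      (volume (Metric.ball (0 : Model n) 1)).toReal := by
    rw [Measure.addHaar_closedBall _ _ zero_le_one]; simp
  rw [hv']
  simp only [Real.norm_eq_abs]
  field_simp

/-- At almost every point, integrals of `u(y - εz)` against a bounded convergent family of kernels
converge to `u(y)` times the integral of the limiting kernel. -/
lemma tendsto_integral_kernel {y : Model n}
    (hy : Tendsto (fun ε : ℝ => ∫ z in Metric.closedBall (0 : Model n) 1, |u (y - ε • z) - u y|)
      (𝓝[>] 0) (𝓝 0)) (hu : BddMeas u) {k : ℝ → Model n → ℝ} {k₀ : Model n → ℝ} {C : ℝ}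
    (hk : ∀ ε > 0, Ker (k ε)) (hC : ∀ ε > 0, ∀ z, |k ε z| ≤ C)
    (hlim : ∀ z, Tendsto (fun ε => k ε z) (𝓝[>] 0) (𝓝 (k₀ z))) :
    Tendsto (fun ε => ∫ z, u (y - ε • z) * k ε z) (𝓝[>] 0) (𝓝 (u y * ∫ z, k₀ z)) := by
  -- The integrand is split through `u(y - εz) = (u(y - εz) - u(y)) + u(y)`. The first part is at
  -- most `C` times the Lebesgue point integral; the second is dominated convergence for the kernels
  -- alone.
  have h1 : Tendsto (fun ε => ∫ z, (u (y - ε • z) - u y) * k ε z) (𝓝[>] 0) (𝓝 0) := by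
    have h0 := hy.mul_const C
    rw [zero_mul] at h0
    refine squeeze_zero_norm' ?_ h0
    filter_upwards [self_mem_nhdsWithin] with ε hε
    have hm : Measurable fun z : Model n => y - ε • z := by fun_prop
    obtain ⟨B, hB⟩ := hu.bound
    have hi : IntegrableOn (fun z => |u (y - ε • z) - u y|) (Metric.closedBall (0 : Model n) 1) := by
      have hm' := hu.measurable.comp hm
      have hbm : BddMeas fun z => |u (y - ε • z) - u y| :=
        ⟨(hm'.sub_const _).abs, B + B, fun z => by
          rw [abs_abs]
          exact (abs_sub _ _).trans (add_le_add (hB _) (hB _))⟩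
      exact hbm.locallyIntegrable.integrableOn_isCompact (isCompact_closedBall 0 1)
    rw [← integral_mul_const, Real.norm_eq_abs]
    refine abs_integral_le_integral_abs.trans ?_
    rw [← integral_indicator measurableSet_closedBall]
    refine integral_mono_of_nonneg (Eventually.of_forall fun z => abs_nonneg _)
      ((integrable_indicator_iff measurableSet_closedBall).2 (hi.mul_const C))
      (Eventually.of_forall fun z => ?_)
    simp only [abs_mul]
    by_cases hz : z ∈ Metric.closedBall (0 : Model n) 1
    · rw [indicator_of_mem hz]
      exact mul_le_mul_of_nonneg_left (hC ε hε z) (abs_nonneg _)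
    · rw [indicator_of_notMem hz, (hk ε hε).supp z (by simpa using hz)]
      simp
  have h2 : Tendsto (fun ε => ∫ z, k ε z) (𝓝[>] 0) (𝓝 (∫ z, k₀ z)) := by
    refine tendsto_integral_filter_of_dominated_convergence
      ((Metric.closedBall (0 : Model n) 1).indicator fun _ => C) ?_ ?_ ?_
      (Eventually.of_forall hlim)
    · filter_upwards [self_mem_nhdsWithin] with ε hε
      exact (hk ε hε).measurable.aestronglyMeasurable
    · filter_upwards [self_mem_nhdsWithin] with ε hε
      refine Eventually.of_forall fun z => ?_
      by_cases hz : z ∈ Metric.closedBall (0 : Model n) 1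
      · rw [indicator_of_mem hz]
        exact hC ε hε z
      · rw [indicator_of_notMem hz, (hk ε hε).supp z (by simpa using hz)]
        simp
    · exact (integrable_indicator_iff measurableSet_closedBall).2
        (integrableOn_const measure_closedBall_lt_top.ne)
  have h3 := h1.add (h2.const_mul (u y))
  rw [zero_add] at h3
  refine h3.congr' ?_
  filter_upwards [self_mem_nhdsWithin] with ε hε
  rw [← integral_const_mul, ← integral_add]
  · congr 1
    ext z
    ring
  · simp only [sub_mul]
    exact (integrable_bddMeas_comp_mul hu (hk ε hε).integrable ε y).sub
      ((hk ε hε).integrable.const_mul _)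
  · exact (hk ε hε).integrable.const_mul _

/-- The mass of the kernel is left arbitrary because two cases are needed: `ρ`, of mass one,
recovers `u`, while `∂ₖρ`, of mass zero, shows that `ε ∂ₖ(u * ρ_ε)` tends to zero. -/
lemma BddMeas.conv_mol_kernel (hu : BddMeas u) (hκ : Ker κ) (U : Set (Model n)) :
    Conv U (fun ε => mol κ ε u) (fun y => u y * ∫ z, κ z) := by
  refine ⟨hu.bdd_mol hκ U, ?_⟩
  obtain ⟨C, hC⟩ := hκ.bound
  filter_upwards [hu.ae_tendsto_integral_abs_sub] with y hy _
  refine (tendsto_integral_kernel hy hu (k := fun _ => κ) (fun _ _ => hκ) (fun _ _ => hC)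
    fun _ => tendsto_const_nhds).congr' ?_
  filter_upwards [self_mem_nhdsWithin] with ε hε
  rw [mol_eq κ hε]

/-- A smooth mollifier supported in the unit ball. -/
structure Mollifier (ρ : Model n → ℝ) : Prop where
  smooth : ContDiff ℝ ∞ ρ
  supp : ∀ z, 1 < ‖z‖ → ρ z = 0
  integral : ∫ z, ρ z = 1

namespace Mollifier

lemma tsupport_subset (h : Mollifier ρ) : tsupport ρ ⊆ Metric.closedBall 0 1 :=
  closure_minimal (fun z hz => by
    by_contra h'
    exact hz (h.supp z (by simpa using h'))) Metric.isClosed_closedBall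

lemma compactSupport (h : Mollifier ρ) : HasCompactSupport ρ :=
  (isCompact_closedBall 0 1).of_isClosed_subset (isClosed_tsupport _) h.tsupport_subset

lemma contDiff_pd (h : Mollifier ρ) (k : Fin n) : ContDiff ℝ ∞ (pd k ρ) :=
  contDiff_iff_contDiffAt.2 fun _ => contDiffAt_pd h.smooth.contDiffAt k

lemma ker (h : Mollifier ρ) : Ker ρ where
  __ := BddMeas.of_continuous h.smooth.continuous h.compactSupport
  supp := h.supp

lemma tsupport_pd_subset (k : Fin n) (f : Model n → ℝ) : tsupport (pd k f) ⊆ tsupport f := by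
  refine closure_minimal (fun z hz => ?_) (isClosed_tsupport _)
  refine support_fderiv_subset ℝ (f := f) fun h => hz ?_
  simp [pd, h]

lemma ker_pd (h : Mollifier ρ) (k : Fin n) : Ker (pd k ρ) where
  __ := BddMeas.of_continuous (h.contDiff_pd k).continuous
    (h.compactSupport.mono' ((subset_tsupport _).trans (tsupport_pd_subset k ρ)))
  supp z hz := by
    by_contra h'
    have := h.tsupport_subset (tsupport_pd_subset k ρ (subset_tsupport _ h'))
    rw [mem_closedBall_zero_iff] at this
    linarith

lemma lipschitz (h : Mollifier ρ) : ∃ K, LipschitzWith K ρ :=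
  (h.smooth.of_le (m := 1) (by simp)).lipschitzWith_of_hasCompactSupport h.compactSupport
    one_ne_zero

/-- Integration by parts of a Lipschitz function against a mollifier. -/
lemma integral_mul_pd (h : Mollifier ρ) {K : NNReal} (hf : LipschitzWith K f) (k : Fin n) :
    ∫ z, f z * pd k ρ z = - ∫ z, pd k f z * ρ z := by
  obtain ⟨K', hK'⟩ := h.lipschitz
  have := hf.integral_lineDeriv_mul_eq (μ := volume) hK' h.compactSupport (e k)
  have h1 : ∫ z, pd k f z * ρ z = ∫ z, lineDeriv ℝ f z (e k) * ρ z := by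
    refine integral_congr_ae ?_
    filter_upwards [hf.ae_differentiableAt (μ := volume)] with z hz
    simp only [pd]
    rw [hz.lineDeriv_eq_fderiv]
  rw [h1, this, ← integral_neg]
  congr 1
  ext z
  rw [lineDeriv_neg, (h.smooth.differentiable (by simp) z).lineDeriv_eq_fderiv]
  simp [pd]
  ring

lemma integral_pd (h : Mollifier ρ) (k : Fin n) : ∫ z, pd k ρ z = 0 := by
  have := h.integral_mul_pd (LipschitzWith.const (1 : ℝ)) k
  simpa [pd_const] using this

/-- The first moments of `∂ₖρ`, which identify the limit of the Friedrichs commutator. -/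
lemma integral_linear_mul_pd (h : Mollifier ρ) (A : Model n →L[ℝ] ℝ) (k : Fin n) :
    ∫ z, A z * pd k ρ z = - A (e k) := by
  have h1 : ∀ z, pd k A z = A (e k) := fun z => by simp [pd]
  rw [h.integral_mul_pd A.lipschitz k]
  simp only [h1]
  rw [integral_const_mul, h.integral, mul_one]

/-- The rescaled mollifier. -/
def scaled (ρ : Model n → ℝ) (ε : ℝ) (z : Model n) : ℝ := (ε ^ n)⁻¹ * ρ (ε⁻¹ • z)

lemma contDiff_scaled (h : Mollifier ρ) (ε : ℝ) : ContDiff ℝ ∞ (scaled ρ ε) :=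
  contDiff_const.mul (h.smooth.comp (contDiff_id.const_smul ε⁻¹))

lemma hasCompactSupport_scaled (h : Mollifier ρ) {ε : ℝ} (hε : 0 < ε) :
    HasCompactSupport (scaled ρ ε) :=
  (h.compactSupport.comp_smul (inv_ne_zero hε.ne')).mul_left

lemma pd_scaled (h : Mollifier ρ) (ε : ℝ) (k : Fin n) (z : Model n) :
    pd k (scaled ρ ε) z = ε⁻¹ * scaled (pd k ρ) ε z := by
  have h1 : HasFDerivAt (fun z : Model n => ε⁻¹ • z) (ε⁻¹ • ContinuousLinearMap.id ℝ (Model n)) z :=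
    (hasFDerivAt_id z).const_smul ε⁻¹
  have h2 := ((h.smooth.differentiable (by simp) (ε⁻¹ • z)).hasFDerivAt.comp z h1)
  have h3 : pd k (fun z => ρ (ε⁻¹ • z)) z = ε⁻¹ * pd k ρ (ε⁻¹ • z) := by
    have : (fun z => ρ (ε⁻¹ • z)) = ρ ∘ fun z : Model n => ε⁻¹ • z := rfl
    rw [pd, this, h2.fderiv]
    simp [pd]
  change pd k (fun z => (ε ^ n)⁻¹ * ρ (ε⁻¹ • z)) z = _
  rw [pd_const_mul, h3, scaled]
  ring

lemma mol_eq_convolution (ρ : Model n → ℝ) (ε : ℝ) (u : Model n → ℝ) :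
    mol ρ ε u = convolution u (scaled ρ ε) (ContinuousLinearMap.mul ℝ ℝ) volume := by
  ext y
  rfl

lemma contDiff_mol (h : Mollifier ρ) {ε : ℝ} (hε : 0 < ε) (hu : LocallyIntegrable u) :
    ContDiff ℝ ∞ (mol ρ ε u) := by
  rw [mol_eq_convolution]
  exact (h.hasCompactSupport_scaled hε).contDiff_convolution_right (n := ⊤) _ hu (h.contDiff_scaled ε)

/-- The derivative falls on the kernel, at the cost of a factor `ε⁻¹`. No differentiability of `u`
is involved. -/
lemma pd_mol (h : Mollifier ρ) {ε : ℝ} (hε : 0 < ε) (hu : LocallyIntegrable u) (k : Fin n)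
    (y : Model n) : pd k (mol ρ ε u) y = ε⁻¹ * mol (pd k ρ) ε u y := by
  have h1 := (h.hasCompactSupport_scaled hε).hasFDerivAt_convolution_right
    (ContinuousLinearMap.mul ℝ ℝ) hu ((h.contDiff_scaled ε).of_le (by simp)) y
  rw [pd, mol_eq_convolution, h1.fderiv,
    convolution_precompR_apply _ hu ((h.hasCompactSupport_scaled hε).fderiv ℝ)
      ((h.contDiff_scaled ε).continuous_fderiv (by simp))]
  rw [mol, ← integral_const_mul]
  refine integral_congr_ae (Eventually.of_forall fun z => ?_)
  have := h.pd_scaled ε k (y - z)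
  simp only [ContinuousLinearMap.mul_apply']
  rw [pd] at this
  rw [this, scaled]
  ring

/-- Integration by parts in the rescaled variable moves the derivative from the kernel back to `f`;
the inner derivative `-ε` of `z ↦ f(y - εz)` cancels the factor `ε⁻¹` of `pd_mol`. -/
lemma pd_mol_of_lipschitz (h : Mollifier ρ) {ε : ℝ} (hε : 0 < ε) {K : NNReal}
    (hf : LipschitzWith K f) (k : Fin n) (y : Model n) :
    pd k (mol ρ ε f) y = mol ρ ε (pd k f) y := by
  rw [h.pd_mol hε hf.continuous.locallyIntegrable, mol_eq _ hε, mol_eq _ hε]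
  have hφ : LipschitzWith (K * (‖ε‖₊ * 1)) (fun z : Model n => f (y - ε • z)) := by
    refine hf.comp ?_
    refine LipschitzWith.of_dist_le_mul fun a b => ?_
    rw [dist_sub_left, dist_smul₀]
    simp
  have h1 := h.integral_mul_pd hφ k
  rw [h1]
  have h2 : ∀ z : Model n, pd k (fun z => f (y - ε • z)) z = - ε * pd k f (y - ε • z) := by
    intro z
    have h3 : (fun z => f (y - ε • z)) = fun z => (fun w => f (y + w)) ((-ε) • z) := by
      ext z; simp [sub_eq_add_neg]
    have h4 : fderiv ℝ (fun z => (fun w => f (y + w)) ((-ε) • z)) z =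
        (-ε) • fderiv ℝ (fun w => f (y + w)) ((-ε) • z) :=
      fderiv_comp_smul (f := fun w => f (y + w)) (-ε)
    rw [pd, h3, h4]
    simp only [smul_apply, smul_eq_mul]
    rw [fderiv_comp_add_left]
    simp [pd, sub_eq_add_neg]
  simp only [h2]
  rw [← integral_neg, ← integral_const_mul]
  congr 1
  ext z
  field_simp

/-- On the support of `ρ` one has `‖z‖ ≤ 1`, so `f(y - εz)` differs from `f(y)` by at most `K ε`. -/
lemma bigOEps_mol_sub (h : Mollifier ρ) {K : NNReal} (hf : LipschitzWith K f)
    (U : Set (Model n)) : BigOEps U (fun ε y => mol ρ ε f y - f y) := by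
  intro y _
  refine Asymptotics.IsBigO.of_bound (K * ∫ z, |ρ z|) ?_
  filter_upwards [eventually_pos_lz y] with p hp
  have h1 : mol ρ p.1 f p.2 - f p.2 = ∫ z, (f (p.2 - p.1 • z) - f p.2) * ρ z := by
    rw [mol_eq ρ hp]
    simp only [sub_mul]
    rw [integral_sub, integral_const_mul, h.integral, mul_one]
    · refine Continuous.integrable_of_hasCompactSupport ?_ h.compactSupport.mul_left
      have := hf.continuous
      have := h.smooth.continuous
      fun_prop
    · exact h.ker.integrable.const_mul _
  rw [h1, Real.norm_eq_abs, Real.norm_of_nonneg hp.le, mul_right_comm, ← integral_const_mul]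
  refine abs_integral_le_integral_abs.trans ?_
  refine integral_mono_of_nonneg (Eventually.of_forall fun z => abs_nonneg _)
    (h.ker.integrable.abs.const_mul _) (Eventually.of_forall fun z => ?_)
  simp only [abs_mul]
  rcases le_or_gt ‖z‖ 1 with hz | hz
  · refine mul_le_mul_of_nonneg_right ?_ (abs_nonneg _)
    have := hf.dist_le_mul (p.2 - p.1 • z) p.2
    rw [Real.dist_eq, dist_eq_norm, sub_sub_cancel_left, norm_neg, norm_smul,
      Real.norm_of_nonneg hp.le] at this
    refine this.trans ?_
    have : p.1 * ‖z‖ ≤ p.1 * 1 := mul_le_mul_of_nonneg_left hz hp.le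
    rw [mul_one] at this
    exact mul_le_mul_of_nonneg_left this K.2
  · simp [h.supp z hz]

lemma conv_mol (h : Mollifier ρ) (hu : BddMeas u) (U : Set (Model n)) :
    Conv U (fun ε => mol ρ ε u) u := by
  simpa [h.integral] using hu.conv_mol_kernel h.ker U

lemma approx_mol (h : Mollifier ρ) {K : NNReal} (hf : LipschitzWith K f) (U : Set (Model n)) :
    Approx U (fun ε => mol ρ ε f) f where
  smooth y _ := by
    filter_upwards [eventually_pos_lz y] with p hp
    exact (h.contDiff_mol hp hf.continuous.locallyIntegrable).contDiffAt
  lip y _ := ⟨K, univ, univ_mem, hf.lipschitzOnWith⟩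
  close := h.bigOEps_mol_sub hf U
  deriv k := by
    refine (h.conv_mol (BddMeas.pd_of_lipschitz hf k) U).congr fun y _ => ?_
    filter_upwards [eventually_pos_lz y] with p hp
    rw [h.pd_mol_of_lipschitz hp hf]

/-- The factor `ε` cancels the loss in `pd_mol` and leaves a mollification with the kernel `∂ₖρ` of
mass zero. With `u` a first derivative of a Lipschitz function, this says that second derivatives of
the mollified function are `o(1/ε)` almost everywhere. -/
lemma negl_eps_pd_mol (h : Mollifier ρ) (hu : BddMeas u) (k : Fin n) (U : Set (Model n)) :
    Negl U (fun ε y => ε * pd k (mol ρ ε u) y) := by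
  have := hu.conv_mol_kernel (h.ker_pd k) U
  simp only [h.integral_pd, mul_zero] at this
  refine this.congr fun y _ => ?_
  filter_upwards [eventually_pos_lz y] with p hp
  rw [h.pd_mol hp hu.locallyIntegrable]
  field_simp

/-- The Friedrichs commutator: `∂ₖ((a u) * ρ_ε) - a ∂ₖ(u * ρ_ε)` converges to `(∂ₖ a) u`. -/
lemma conv_commutator (h : Mollifier ρ) {K : NNReal} (ha : LipschitzWith K a) (hab : BddMeas a)
    (hu : BddMeas u) (k : Fin n) (U : Set (Model n)) :
    Conv U (fun ε y => pd k (mol ρ ε fun z => a z * u z) y - a y * pd k (mol ρ ε u) y)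
      (fun y => pd k a y * u y) := by
  have hau := hab.mul hu
  obtain ⟨B, hB⟩ := (h.ker_pd k).bound
  obtain ⟨C, hC⟩ := hu.bound
  -- After rescaling, the commutator is the integral of `u(y - εz)` against this kernel, a
  -- difference quotient of `a` times `∂ₖρ`. The Lipschitz bound makes it bounded uniformly in `ε`.
  -- Where `a` is differentiable it tends to `-Da(y)z · ∂ₖρ(z)`, whose integral is `∂ₖa(y)`.
  let q : Model n → ℝ → Model n → ℝ := fun y ε z => ε⁻¹ * (a (y - ε • z) - a y) * pd k ρ z
  have hq : ∀ ε > 0, ∀ y, pd k (mol ρ ε fun z => a z * u z) y - a y * pd k (mol ρ ε u) y =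
      ∫ z, u (y - ε • z) * q y ε z := by
    intro ε hε y
    rw [h.pd_mol hε hau.locallyIntegrable, h.pd_mol hε hu.locallyIntegrable, mol_eq _ hε,
      mol_eq _ hε, mul_left_comm, ← mul_sub, ← integral_const_mul, ← integral_sub,
      ← integral_const_mul]
    · congr 1
      ext z
      simp only [q]
      ring
    · exact integrable_bddMeas_comp_mul hau (h.ker_pd k).integrable ε y
    · exact (integrable_bddMeas_comp_mul hu (h.ker_pd k).integrable ε y).const_mul _
  have hqb : ∀ y, ∀ ε > 0, ∀ z, |q y ε z| ≤ K * |pd k ρ z| := by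
    intro y ε hε z
    rcases le_or_gt ‖z‖ 1 with hz | hz
    · simp only [q, abs_mul]
      refine mul_le_mul_of_nonneg_right ?_ (abs_nonneg _)
      have := ha.dist_le_mul (y - ε • z) y
      rw [Real.dist_eq, dist_eq_norm, sub_sub_cancel_left, norm_neg, norm_smul,
        Real.norm_of_nonneg hε.le] at this
      rw [abs_of_pos (inv_pos.2 hε), inv_mul_le_iff₀ hε]
      refine this.trans ?_
      have h1 : ε * ‖z‖ ≤ ε * 1 := mul_le_mul_of_nonneg_left hz hε.le
      have h2 := mul_le_mul_of_nonneg_left h1 K.2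
      simpa [mul_comm, mul_assoc] using h2
    · simp [q, (h.ker_pd k).supp z hz]
  have hqk : ∀ y, ∀ ε > 0, Ker (q y ε) := by
    intro y ε hε
    refine ⟨⟨?_, K * B, fun z => ?_⟩, fun z hz => ?_⟩
    · have := ha.continuous
      have := (h.contDiff_pd k).continuous
      exact Continuous.measurable (by fun_prop)
    · exact (hqb y ε hε z).trans (mul_le_mul_of_nonneg_left (hB z) K.2)
    · simp [q, (h.ker_pd k).supp z hz]
  refine ⟨?_, ?_⟩
  · refine Bdd.of_bound (C := ∫ z, C * (K * |pd k ρ z|)) fun ε hε y => ?_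
    rw [hq ε hε]
    refine abs_integral_le_integral_abs.trans ?_
    refine integral_mono_of_nonneg (Eventually.of_forall fun z => abs_nonneg _)
      (((h.ker_pd k).integrable.abs.const_mul _).const_mul _) (Eventually.of_forall fun z => ?_)
    simp only [abs_mul]
    exact mul_le_mul (hC _) (hqb y ε hε z) (abs_nonneg _) ((abs_nonneg _).trans (hC y))
  · filter_upwards [hu.ae_tendsto_integral_abs_sub, ha.ae_differentiableAt (μ := volume)]
      with y hy hay _
    have key := tendsto_integral_kernel hy hu (k := q y)
      (k₀ := fun z => - (fderiv ℝ a y z) * pd k ρ z) (C := K * B) (hqk y)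
      (fun ε hε z => (hqb y ε hε z).trans (mul_le_mul_of_nonneg_left (hB z) K.2)) (fun z => ?_)
    · have h1 : ∫ z, - (fderiv ℝ a y z) * pd k ρ z = pd k a y := by
        simp only [neg_mul]
        rw [integral_neg, h.integral_linear_mul_pd, neg_neg, pd]
      rw [h1, mul_comm] at key
      refine key.congr' ?_
      filter_upwards [self_mem_nhdsWithin] with ε hε
      rw [hq ε hε]
    · refine Tendsto.mul_const _ ?_
      -- The quotient of `a(y - εz) - a(y)` by `ε` is a one-sided slope in the direction `-z`.
      have h1 := (hay.hasFDerivAt.hasLineDerivAt (-z)).tendsto_slope_zero_right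
      simpa [sub_eq_add_neg] using h1

end Mollifier

end Mollification

/-! ### Entries of the inverse matrix -/

section MatrixInverse

variable {n : ℕ}

/-- Cramer's rule written with permutation sums. It reduces every regularity statement about the
inverse matrix to closure under sums, products and reciprocals. It also holds for singular matrices,
where both sides vanish because `0⁻¹ = 0`. -/
lemma inv_apply_eq (A : Matrix (Fin n) (Fin n) ℝ) (i j : Fin n) :
    A⁻¹ i j = (∑ σ : Equiv.Perm (Fin n), (σ.sign : ℝ) * ∏ k, A (σ k) k)⁻¹ *
      ∑ σ : Equiv.Perm (Fin n), (σ.sign : ℝ) *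
        ∏ k, (if σ k = j then (Pi.single i 1 : Fin n → ℝ) k else A (σ k) k) := by
  rw [Matrix.inv_def, Matrix.smul_apply, Matrix.adjugate_apply, Matrix.det_apply', 
    Matrix.det_apply', Ring.inverse_eq_inv', smul_eq_mul]
  congr 1
  refine Finset.sum_congr rfl fun σ _ => ?_
  congr 1
  refine Finset.prod_congr rfl fun k _ => ?_
  rw [Matrix.updateRow_apply]

variable {G : Model n → Matrix (Fin n) (Fin n) ℝ} {y : Model n}

lemma contDiffAt_det (h : ∀ i j, ContDiffAt ℝ ∞ (fun z => G z i j) y) :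
    ContDiffAt ℝ ∞ (fun z => (G z).det) y := by
  simp only [Matrix.det_apply']
  exact ContDiffAt.sum fun σ _ => contDiffAt_const.mul (contDiffAt_prod fun k _ => h _ _)

lemma contDiffAt_inv_apply (h : ∀ i j, ContDiffAt ℝ ∞ (fun z => G z i j) y)
    (hd : (G y).det ≠ 0) (i j : Fin n) : ContDiffAt ℝ ∞ (fun z => (G z)⁻¹ i j) y := by
  have h1 := contDiffAt_det h
  simp only [Matrix.det_apply'] at h1 hd
  simp only [inv_apply_eq]
  refine (h1.inv hd).mul (ContDiffAt.sum fun σ _ => contDiffAt_const.mul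
    (contDiffAt_prod fun k _ => ?_))
  split_ifs
  · exact contDiffAt_const
  · exact h _ _

lemma LipAt.inv_apply (h : ∀ i j, LipAt (fun z => G z i j) y)
    (hd : (G y).det ≠ 0) (i j : Fin n) : LipAt (fun z => (G z)⁻¹ i j) y := by
  simp only [Matrix.det_apply'] at hd
  simp only [inv_apply_eq]
  refine LipAt.mul (LipAt.inv (LipAt.sum fun σ _ => (LipAt.const _ _).mul
    (LipAt.prod fun k _ => h _ _)) hd) (LipAt.sum fun σ _ => (LipAt.const _ _).mul
    (LipAt.prod fun k _ => ?_))
  split_ifs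
  · exact LipAt.const _ _
  · exact h _ _

lemma measurable_inv_apply (h : ∀ i j, Measurable (fun z => G z i j)) (i j : Fin n) :
    Measurable (fun z => (G z)⁻¹ i j) := by
  simp only [inv_apply_eq]
  refine Measurable.mul (Measurable.inv (Finset.measurable_fun_sum _ fun σ _ => measurable_const.mul
    (Finset.measurable_fun_prod _ fun k _ => h _ _))) (Finset.measurable_fun_sum _ fun σ _ =>
    measurable_const.mul (Finset.measurable_fun_prod _ fun k _ => ?_))
  split_ifs
  · exact measurable_const
  · exact h _ _

lemma Approx.det {U : Set (Model n)} (hU : IsOpen U)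
    {E : ℝ → Model n → Matrix (Fin n) (Fin n) ℝ}
    (h : ∀ i j, Approx U (fun ε z => E ε z i j) (fun z => G z i j)) :
    Approx U (fun ε z => (E ε z).det) (fun z => (G z).det) := by
  simp only [Matrix.det_apply']
  exact Approx.sum hU fun σ _ => (Approx.const hU _).mul (Approx.prod hU fun k _ => h _ _)

lemma Approx.inv_apply {U : Set (Model n)} (hU : IsOpen U)
    {E : ℝ → Model n → Matrix (Fin n) (Fin n) ℝ}
    (h : ∀ i j, Approx U (fun ε z => E ε z i j) (fun z => G z i j))
    (hd : ∀ y ∈ U, (G y).det ≠ 0) (i j : Fin n) :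
    Approx U (fun ε z => (E ε z)⁻¹ i j) (fun z => (G z)⁻¹ i j) := by
  have h1 := Approx.det hU h
  simp only [Matrix.det_apply'] at h1 hd
  simp only [inv_apply_eq]
  refine (h1.inv hd).mul (Approx.sum hU fun σ _ => (Approx.const hU _).mul
    (Approx.prod hU fun k _ => ?_))
  split_ifs
  · exact Approx.const hU _
  · exact h _ _

end MatrixInverse

/-! ### Transformation law of the classical Ricci tensor -/

section Tensoriality

variable {n : ℕ}

/-- The Jacobian matrix `∂_i τ^a`. -/
def jac (τ : Model n → Model n) (y : Model n) : Matrix (Fin n) (Fin n) ℝ :=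
  fun a i => fderiv ℝ τ y (e i) a

/-- The components of the pull-back of `A_{ab} dx^a ⊗ dx^b` under `τ`. -/
def pullM (τ : Model n → Model n) (A : Model n → Matrix (Fin n) (Fin n) ℝ) (y : Model n) :
    Matrix (Fin n) (Fin n) ℝ :=
  fun i j => ∑ a, ∑ b, jac τ y a i * jac τ y b j * A (τ y) a b

lemma pullM_eq_mul (τ : Model n → Model n) (A : Model n → Matrix (Fin n) (Fin n) ℝ)
    (y : Model n) : pullM τ A y = (jac τ y).transpose * A (τ y) * jac τ y := by
  ext i j
  simp only [pullM, Matrix.mul_apply, Matrix.transpose_apply, Finset.sum_mul]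
  rw [Finset.sum_comm]
  exact Finset.sum_congr rfl fun a _ => Finset.sum_congr rfl fun b _ => by ring

/-- The combination `∂_i g_{jl} + ∂_j g_{il} - ∂_l g_{ij}`. -/
def lowerChr (G : Model n → Matrix (Fin n) (Fin n) ℝ) (i j l : Fin n) (y : Model n) : ℝ :=
  pd i (fun z => G z j l) y + pd j (fun z => G z i l) y - pd l (fun z => G z i j) y

lemma christoffel_eq (G : Model n → Matrix (Fin n) (Fin n) ℝ) (m i j : Fin n) (y : Model n) :
    christoffel G m i j y = (1 / 2 : ℝ) * ∑ l, (G y)⁻¹ m l * lowerChr G i j l y := rfl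

/-- The coordinate curvature endomorphism
`∂_k Γ_j - ∂_j Γ_k + Γ_k Γ_j - Γ_j Γ_k` with `(Γ_j)^c_b = Γ^c_{jb}`. -/
def curv (G : Model n → Matrix (Fin n) (Fin n) ℝ) (k j c b : Fin n) (y : Model n) : ℝ :=
  pd k (christoffel G c j b) y - pd j (christoffel G c k b) y +
    ∑ d, (christoffel G c k d y * christoffel G d j b y -
      christoffel G c j d y * christoffel G d k b y)

/-- Smooth nondegenerate symmetric matrix fields near a point. -/
structure MetricNear (A : Model n → Matrix (Fin n) (Fin n) ℝ) (y : Model n) : Prop where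
  smooth : ∀ᶠ z in 𝓝 y, ∀ i j, ContDiffAt ℝ ∞ (fun w => A w i j) z
  symm : ∀ᶠ z in 𝓝 y, ∀ i j, A z i j = A z j i
  nondeg : ∀ᶠ z in 𝓝 y, (A z).det ≠ 0

variable {A G : Model n → Matrix (Fin n) (Fin n) ℝ} {y : Model n}

lemma MetricNear.eventually (h : MetricNear A y) : ∀ᶠ z in 𝓝 y, MetricNear A z := by
  filter_upwards [eventually_eventually_nhds.2 h.smooth, eventually_eventually_nhds.2 h.symm,
    eventually_eventually_nhds.2 h.nondeg] with z h1 h2 h3 using ⟨h1, h2, h3⟩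

lemma MetricNear.contDiffAt_lowerChr (h : MetricNear A y) (i j l : Fin n) :
    ContDiffAt ℝ ∞ (lowerChr A i j l) y := by
  have h1 := h.smooth.self_of_nhds
  exact ((contDiffAt_pd (h1 j l) i).add (contDiffAt_pd (h1 i l) j)).sub (contDiffAt_pd (h1 i j) l)

lemma MetricNear.contDiffAt_christoffel (h : MetricNear A y) (m i j : Fin n) :
    ContDiffAt ℝ ∞ (christoffel A m i j) y :=
  contDiffAt_const.mul (ContDiffAt.sum fun l _ =>
    (contDiffAt_inv_apply (fun i j => h.smooth.self_of_nhds i j) h.nondeg.self_of_nhds m l).mul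
      (h.contDiffAt_lowerChr i j l))

lemma lowerChr_symm (h : ∀ᶠ z in 𝓝 y, ∀ i j, A z i j = A z j i) (i j l : Fin n) :
    lowerChr A i j l y = lowerChr A j i l y := by
  have : pd l (fun z => A z i j) y = pd l (fun z => A z j i) y :=
    pd_congr (h.mono fun z hz => hz i j)
  rw [lowerChr, lowerChr, this]
  ring

lemma christoffel_symm (h : ∀ᶠ z in 𝓝 y, ∀ i j, A z i j = A z j i) (m i j : Fin n) :
    christoffel A m i j y = christoffel A m j i y := by
  simp only [christoffel_eq, lowerChr_symm h i j]

/-- The Ricci tensor is a trace of the curvature endomorphism, so its transformation law follows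
from that of the connection matrices. The symmetry of the Christoffel symbols in their lower indices
matches the two index conventions. -/
lemma ricciComp_eq_sum_curv (h : ∀ᶠ z in 𝓝 y, ∀ i j, A z i j = A z j i) (i j : Fin n) :
    ricciComp A y i j = ∑ m, curv A m j m i y := by
  have hs : ∀ m i j, christoffel A m i j =ᶠ[𝓝 y] christoffel A m j i := fun m i j =>
    (eventually_eventually_nhds.2 h).mono fun z hz => christoffel_symm hz m i j
  have hs0 := fun m i j => christoffel_symm h m i j
  simp only [ricciComp, ricciQuad, curv, Finset.sum_add_distrib]
  congr 1
  · refine Finset.sum_congr rfl fun m _ => ?_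
    rw [pd_congr (hs m i j), pd_congr (hs m i m)]
  · simp only [Finset.sum_sub_distrib]
    congr 1
    · rw [Finset.sum_comm]
      refine Finset.sum_congr rfl fun m _ => Finset.sum_congr rfl fun k _ => ?_
      rw [hs0 k i j]
      ring
    · rw [Finset.sum_comm]
      refine Finset.sum_congr rfl fun m _ => Finset.sum_congr rfl fun k _ => ?_
      rw [hs0 k i m]
      ring

/-- Smooth local diffeomorphisms near a point. -/
structure DiffeoNear (τ : Model n → Model n) (y : Model n) : Prop where
  smooth : ∀ᶠ z in 𝓝 y, ContDiffAt ℝ ∞ τ z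
  nondeg : ∀ᶠ z in 𝓝 y, (jac τ z).det ≠ 0

variable {τ : Model n → Model n}

lemma DiffeoNear.eventually (h : DiffeoNear τ y) : ∀ᶠ z in 𝓝 y, DiffeoNear τ z := by
  filter_upwards [eventually_eventually_nhds.2 h.smooth,
    eventually_eventually_nhds.2 h.nondeg] with z h1 h3 using ⟨h1, h3⟩

lemma contDiffAt_jac (h : ContDiffAt ℝ ∞ τ y) (a i : Fin n) :
    ContDiffAt ℝ ∞ (fun z => jac τ z a i) y :=
  (EuclideanSpace.proj a : Model n →L[ℝ] ℝ).contDiff.contDiffAt.comp y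
    ((h.fderiv_right (m := ∞) (by simp)).clm_apply contDiffAt_const)

lemma pd_coord_eq_jac (h : ContDiffAt ℝ ∞ τ y) (a i : Fin n) :
    pd i (fun z => τ z a) y = jac τ y a i := pd_coord (h.differentiableAt (by simp)) a

lemma pd_jac_symm (h : ∀ᶠ z in 𝓝 y, ContDiffAt ℝ ∞ τ z) (a i j : Fin n) :
    pd i (fun z => jac τ z a j) y = pd j (fun z => jac τ z a i) y := by
  have h1 : ∀ i, (fun z => jac τ z a i) =ᶠ[𝓝 y] pd i (fun z => τ z a) := fun i =>
    h.mono fun z hz => (pd_coord_eq_jac hz a i).symm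
  rw [pd_congr (h1 j), pd_congr (h1 i)]
  exact pd_comm (contDiffAt_coord h.self_of_nhds a) i j

lemma pd_comp_eq_jac {f : Model n → ℝ} (hf : ContDiffAt ℝ ∞ f (τ y)) (h : ContDiffAt ℝ ∞ τ y)
    (k : Fin n) : pd k (fun z => f (τ z)) y = ∑ c, jac τ y c k * pd c f (τ y) := by
  rw [pd_comp hf.dif (h.differentiableAt (by simp))]
  exact Finset.sum_congr rfl fun c _ => by rw [pd_coord_eq_jac h, mul_comm]

lemma metricNear_pullM (h : DiffeoNear τ y) (hA : MetricNear A (τ y)) :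
    MetricNear (pullM τ A) y := by
  have hc : ContinuousAt τ y := h.smooth.self_of_nhds.continuousAt
  refine ⟨?_, ?_, ?_⟩
  · filter_upwards [h.smooth, hc.eventually hA.smooth] with z h1 h2 i j
    refine ContDiffAt.sum fun a _ => ContDiffAt.sum fun b _ => ?_
    exact ((contDiffAt_jac h1 a i).mul (contDiffAt_jac h1 b j)).mul ((h2 a b).comp z h1)
  · filter_upwards [hc.eventually hA.symm] with z h2 i j
    simp only [pullM]
    rw [Finset.sum_comm]
    refine Finset.sum_congr rfl fun a _ => Finset.sum_congr rfl fun b _ => ?_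
    rw [h2 b a]
    ring
  · filter_upwards [h.nondeg, hc.eventually hA.nondeg] with z h1 h2
    rw [pullM_eq_mul, Matrix.det_mul, Matrix.det_mul, Matrix.det_transpose]
    exact mul_ne_zero (mul_ne_zero h1 h2) h1

lemma pd_pullM (h : DiffeoNear τ y) (hA : MetricNear A (τ y)) (k i j : Fin n) :
    pd k (fun z => pullM τ A z i j) y = ∑ a, ∑ b,
      ((pd k (fun z => jac τ z a i) y * jac τ y b j + jac τ y a i * pd k (fun z => jac τ z b j) y)
        * A (τ y) a b + jac τ y a i * jac τ y b j *
          ∑ c, jac τ y c k * pd c (fun z => A z a b) (τ y)) := by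
  have h1 := h.smooth.self_of_nhds
  have h2 := hA.smooth.self_of_nhds
  have hJ : ∀ a i, DifferentiableAt ℝ (fun z => jac τ z a i) y := fun a i =>
    (contDiffAt_jac h1 a i).dif
  have hc : ∀ a b, DifferentiableAt ℝ (fun z => A (τ z) a b) y := fun a b =>
    ContDiffAt.dif ((h2 a b).comp y h1)
  simp only [pullM]
  rw [pd_sum fun a _ => DifferentiableAt.fun_sum fun b _ => ((hJ a i).fun_mul (hJ b j)).fun_mul (hc a b)]
  refine Finset.sum_congr rfl fun a _ => ?_
  rw [pd_sum fun b _ => ((hJ a i).fun_mul (hJ b j)).fun_mul (hc a b)]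
  refine Finset.sum_congr rfl fun b _ => ?_
  rw [pd_mul ((hJ a i).fun_mul (hJ b j)) (hc a b), pd_mul (hJ a i) (hJ b j),
    pd_comp_eq_jac (h2 a b) h1]

/-- Differentiating `JᵀAJ` produces six sums with second derivatives of `τ`. By the symmetry of `A`
and of second derivatives, four of them cancel in pairs and the other two coincide, whence the
factor `2`. -/
lemma lowerChr_pullM (h : DiffeoNear τ y) (hA : MetricNear A (τ y)) (i j l : Fin n) :
    lowerChr (pullM τ A) i j l y = ∑ c, jac τ y c l *
      (2 * ∑ a, A (τ y) c a * pd i (fun z => jac τ z a j) y +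
        ∑ a, ∑ b, jac τ y a i * jac τ y b j * lowerChr A a b c (τ y)) := by
  have hs := hA.symm.self_of_nhds
  have hJ := fun a i j => pd_jac_symm h.smooth a i j
  set J := jac τ y
  set B := A (τ y)
  simp only [lowerChr]
  rw [pd_pullM h hA, pd_pullM h hA, pd_pullM h hA]
  set T : Fin n → Fin n → Fin n → ℝ := fun a i j => pd i (fun z => jac τ z a j) y with hT
  set D : Fin n → Fin n → Fin n → ℝ := fun c a b => pd c (fun z => A z a b) (τ y) with hD
  have hTs : ∀ a i j, T a i j = T a j i := hJ
  change ∑ a, ∑ b, ((T a i j * J b l + J a j * T b i l) * B a b +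
        J a j * J b l * ∑ c, J c i * D c a b) +
      ∑ a, ∑ b, ((T a j i * J b l + J a i * T b j l) * B a b +
        J a i * J b l * ∑ c, J c j * D c a b) -
      ∑ a, ∑ b, ((T a l i * J b j + J a i * T b l j) * B a b +
        J a i * J b j * ∑ c, J c l * D c a b) =
    ∑ c, J c l * (2 * ∑ a, B c a * T a i j +
      ∑ a, ∑ b, J a i * J b j * (D a b c + D b a c - D c a b))
  simp only [mul_add, add_mul, mul_sub, Finset.sum_add_distrib, Finset.sum_sub_distrib,
    Finset.mul_sum]
  have e1 : ∑ a, ∑ b, T a i j * J b l * B a b = ∑ c, ∑ a, J c l * (B c a * T a i j) := by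
    rw [Finset.sum_comm]
    refine Finset.sum_congr rfl fun c _ => Finset.sum_congr rfl fun a _ => ?_
    rw [hs a c]; ring
  have e1' : ∑ a, ∑ b, T a j i * J b l * B a b = ∑ a, ∑ b, T a i j * J b l * B a b :=
    Finset.sum_congr rfl fun a _ => Finset.sum_congr rfl fun b _ => by rw [hTs]
  have e2 : ∑ a, ∑ b, T a l i * J b j * B a b = ∑ a, ∑ b, J a j * T b i l * B a b := by
    rw [Finset.sum_comm]
    refine Finset.sum_congr rfl fun c _ => Finset.sum_congr rfl fun a _ => ?_
    rw [hs a c, hTs a l i]; ring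
  have e3 : ∑ a, ∑ b, J a i * T b l j * B a b = ∑ a, ∑ b, J a i * T b j l * B a b :=
    Finset.sum_congr rfl fun a _ => Finset.sum_congr rfl fun b _ => by rw [hTs]
  have e4 : ∑ a, ∑ b, ∑ c, J a j * J b l * (J c i * D c a b) =
      ∑ c, ∑ a, ∑ b, J c l * (J a i * J b j * D a b c) := by
    rw [Finset.sum_comm]
    refine Finset.sum_congr rfl fun c _ => ?_
    rw [Finset.sum_comm]
    exact Finset.sum_congr rfl fun a _ => Finset.sum_congr rfl fun b _ => by ring
  have e5 : ∑ a, ∑ b, ∑ c, J a i * J b l * (J c j * D c a b) =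
      ∑ c, ∑ a, ∑ b, J c l * (J a i * J b j * D b a c) := by
    rw [Finset.sum_comm]
    exact Finset.sum_congr rfl fun c _ => Finset.sum_congr rfl fun a _ =>
      Finset.sum_congr rfl fun b _ => by ring
  have e6 : ∑ a, ∑ b, ∑ c, J a i * J b j * (J c l * D c a b) =
      ∑ c, ∑ a, ∑ b, J c l * (J a i * J b j * D c a b) := by
    have : ∀ a, ∑ b, ∑ c, J a i * J b j * (J c l * D c a b) =
        ∑ c, ∑ b, J c l * (J a i * J b j * D c a b) := fun a => by
      rw [Finset.sum_comm]
      exact Finset.sum_congr rfl fun c _ => Finset.sum_congr rfl fun b _ => by ring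
    simp only [this]
    rw [Finset.sum_comm]
  have e7 : ∑ c, ∑ a, J c l * (2 * (B c a * T a i j)) =
      2 * ∑ c, ∑ a, J c l * (B c a * T a i j) := by
    simp only [Finset.mul_sum]
    exact Finset.sum_congr rfl fun c _ => Finset.sum_congr rfl fun b _ => by ring
  rw [e1', e1, e2, e3, e4, e5, e6, e7]
  ring

/-- The inhomogeneous transformation law of a connection. It is kept multiplied by the Jacobian
matrix, so that differentiating it again never involves a derivative of the inverse Jacobian. -/
lemma jac_mul_christoffel_pullM (h : DiffeoNear τ y) (hA : MetricNear A (τ y)) (c i j : Fin n) :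
    ∑ m, jac τ y c m * christoffel (pullM τ A) m i j y =
      pd i (fun z => jac τ z c j) y +
        ∑ a, ∑ b, jac τ y a i * jac τ y b j * christoffel A c a b (τ y) := by
  have hAd := hA.nondeg.self_of_nhds
  have hJd := h.nondeg.self_of_nhds
  have hAu : IsUnit (A (τ y)).det := isUnit_iff_ne_zero.2 hAd
  have hJu : IsUnit (jac τ y).det := isUnit_iff_ne_zero.2 hJd
  have hJu' : IsUnit (jac τ y).transpose.det := by rwa [Matrix.det_transpose]
  set J := jac τ y
  let w : Fin n → ℝ := fun c => 2 * ∑ a, A (τ y) c a * pd i (fun z => jac τ z a j) y +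
        ∑ a, ∑ b, J a i * J b j * lowerChr A a b c (τ y)
  -- The inverse metric transforms contravariantly; this absorbs both Jacobians left over from the
  -- lowered symbols.
  have hinv : J * (pullM τ A y)⁻¹ * J.transpose = (A (τ y))⁻¹ := by
    rw [pullM_eq_mul, Matrix.mul_inv_rev, Matrix.mul_inv_rev]
    rw [← Matrix.mul_assoc, ← Matrix.mul_assoc, Matrix.mul_nonsing_inv _ hJu, Matrix.one_mul,
      Matrix.mul_assoc, Matrix.nonsing_inv_mul _ hJu', Matrix.mul_one]
  have hK : (fun l => lowerChr (pullM τ A) i j l y) = Matrix.mulVec J.transpose w := by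
    ext l
    rw [lowerChr_pullM h hA]
    rfl
  have hΓ : (fun m => christoffel (pullM τ A) m i j y) =
      (1 / 2 : ℝ) • Matrix.mulVec (pullM τ A y)⁻¹ (fun l => lowerChr (pullM τ A) i j l y) := by
    ext m
    rfl
  have h1 : Matrix.mulVec J (fun m => christoffel (pullM τ A) m i j y) =
      (1 / 2 : ℝ) • Matrix.mulVec (A (τ y))⁻¹ w := by
    rw [hΓ, hK, Matrix.mulVec_smul, Matrix.mulVec_mulVec, Matrix.mulVec_mulVec, ← hinv,
      Matrix.mul_assoc]
  have h2 : w = (2 : ℝ) • Matrix.mulVec (A (τ y)) (fun a => pd i (fun z => jac τ z a j) y) +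
      fun c => ∑ a, ∑ b, J a i * J b j * lowerChr A a b c (τ y) := by
    ext c
    rfl
  have h3 := congrFun h1 c
  rw [h2, Matrix.mulVec_add, Matrix.mulVec_smul, Matrix.mulVec_mulVec,
    Matrix.nonsing_inv_mul _ hAu, Matrix.one_mulVec] at h3
  refine (show ∑ m, J c m * christoffel (pullM τ A) m i j y = _ from h3).trans ?_
  simp only [Pi.smul_apply, Pi.add_apply, smul_eq_mul, mul_add, Matrix.mulVec, dotProduct]
  congr 1
  · ring
  · simp only [christoffel_eq, Finset.mul_sum]
    rw [Finset.sum_comm]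
    refine Finset.sum_congr rfl fun a _ => ?_
    rw [Finset.sum_comm]
    exact Finset.sum_congr rfl fun b _ => Finset.sum_congr rfl fun l _ => by ring

/-- The algebraic part of the transformation law of the curvature. -/
lemma curvature_gauge {R : Type*} [Ring R] {J c₁ c₂ D₁ D₂ ω₁ ω₂ dc₁₂ dc₂₁ DD dω₁₂ dω₂₁ : R}
    (h1 : J * c₁ = D₁ + ω₁ * J) (h2 : J * c₂ = D₂ + ω₂ * J)
    (h12 : D₁ * c₂ + J * dc₁₂ = DD + dω₁₂ * J + ω₂ * D₁)
    (h21 : D₂ * c₁ + J * dc₂₁ = DD + dω₂₁ * J + ω₁ * D₂) :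
    J * (dc₁₂ - dc₂₁ + (c₁ * c₂ - c₂ * c₁)) =
      (dω₁₂ - dω₂₁ + (ω₁ * ω₂ - ω₂ * ω₁)) * J := by
  -- The hypotheses are the gauge law `J c = dJ + ω J` in two directions and its crossed
  -- derivatives. The common second derivative `DD` of `J` cancels in the antisymmetrisation.
  have e12 : J * dc₁₂ = DD + dω₁₂ * J + ω₂ * D₁ - D₁ * c₂ := by rw [← h12]; abel
  have e21 : J * dc₂₁ = DD + dω₂₁ * J + ω₁ * D₂ - D₂ * c₁ := by rw [← h21]; abel
  have f12 : J * (c₁ * c₂) = D₁ * c₂ + ω₁ * D₂ + ω₁ * ω₂ * J := by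
    rw [← mul_assoc, h1, add_mul, mul_assoc ω₁ J, h2, mul_add]; noncomm_ring
  have f21 : J * (c₂ * c₁) = D₂ * c₁ + ω₂ * D₁ + ω₂ * ω₁ * J := by
    rw [← mul_assoc, h2, add_mul, mul_assoc ω₂ J, h1, mul_add]; noncomm_ring
  rw [mul_add, mul_sub, mul_sub, e12, e21, f12, f21]
  noncomm_ring

/-- The transformation law of the connection holds at all nearby points, so it may be differentiated
once more; this supplies the crossed derivatives needed in `curvature_gauge`. -/
lemma pd_jac_mul_christoffel_pullM (h : DiffeoNear τ y) (hA : MetricNear A (τ y))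
    (c k i j : Fin n) :
    ∑ m, (pd k (fun z => jac τ z c m) y * christoffel (pullM τ A) m i j y +
        jac τ y c m * pd k (christoffel (pullM τ A) m i j) y) =
      pd k (pd i fun z => jac τ z c j) y + ∑ a, ∑ b,
      ((pd k (fun z => jac τ z a i) y * jac τ y b j + jac τ y a i * pd k (fun z => jac τ z b j) y)
        * christoffel A c a b (τ y) + jac τ y a i * jac τ y b j *
          ∑ d, jac τ y d k * pd d (christoffel A c a b) (τ y)) := by
  have h1 := h.smooth.self_of_nhds
  have hc : ContinuousAt τ y := h1.continuousAt
  have hJ : ∀ a i, DifferentiableAt ℝ (fun z => jac τ z a i) y := fun a i =>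
    (contDiffAt_jac h1 a i).dif
  have hΓ : ∀ c a b, ContDiffAt ℝ ∞ (christoffel A c a b) (τ y) := hA.contDiffAt_christoffel
  have hΓτ : ∀ c a b, DifferentiableAt ℝ (fun z => christoffel A c a b (τ z)) y := fun c a b =>
    ContDiffAt.dif ((hΓ c a b).comp y h1)
  have hΓ' : ∀ m, DifferentiableAt ℝ (christoffel (pullM τ A) m i j) y := fun m =>
    ((metricNear_pullM h hA).contDiffAt_christoffel m i j).dif
  have hev : (fun z => ∑ m, jac τ z c m * christoffel (pullM τ A) m i j z) =ᶠ[𝓝 y]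
      fun z => pd i (fun w => jac τ w c j) z +
        ∑ a, ∑ b, jac τ z a i * jac τ z b j * christoffel A c a b (τ z) := by
    filter_upwards [h.eventually, hc.eventually hA.eventually] with z hz hz'
    exact jac_mul_christoffel_pullM hz hz' c i j
  have hl : pd k (fun z => ∑ m, jac τ z c m * christoffel (pullM τ A) m i j z) y =
      ∑ m, (pd k (fun z => jac τ z c m) y * christoffel (pullM τ A) m i j y +
        jac τ y c m * pd k (christoffel (pullM τ A) m i j) y) := by
    rw [pd_sum fun m _ => (hJ c m).fun_mul (hΓ' m)]
    exact Finset.sum_congr rfl fun m _ => pd_mul (hJ c m) (hΓ' m)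
  rw [← hl, pd_congr hev, pd_add (contDiffAt_pd (contDiffAt_jac h1 c j) i).dif
    (DifferentiableAt.fun_sum fun a _ => DifferentiableAt.fun_sum fun b _ =>
      ((hJ a i).fun_mul (hJ b j)).fun_mul (hΓτ c a b))]
  congr 1
  rw [pd_sum fun a _ => DifferentiableAt.fun_sum fun b _ =>
    ((hJ a i).fun_mul (hJ b j)).fun_mul (hΓτ c a b)]
  refine Finset.sum_congr rfl fun a _ => ?_
  rw [pd_sum fun b _ => ((hJ a i).fun_mul (hJ b j)).fun_mul (hΓτ c a b)]
  refine Finset.sum_congr rfl fun b _ => ?_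
  rw [pd_mul ((hJ a i).fun_mul (hJ b j)) (hΓτ c a b), pd_mul (hJ a i) (hJ b j),
    pd_comp_eq_jac (hΓ c a b) h1]

/-- The transformation law of the coordinate curvature. -/
lemma jac_mul_curv_pullM (h : DiffeoNear τ y) (hA : MetricNear A (τ y)) (k i : Fin n) :
    jac τ y * Matrix.of (fun c b => curv (pullM τ A) k i c b y) =
      Matrix.of (fun c d => ∑ a, ∑ b, jac τ y a k * jac τ y b i * curv A a b c d (τ y)) *
        jac τ y := by
  set J := jac τ y with hJdef
  let Γ : Fin n → Fin n → Fin n → ℝ := fun c a b => christoffel A c a b (τ y)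
  let dΓ : Fin n → Fin n → Fin n → Fin n → ℝ := fun d c a b => pd d (christoffel A c a b) (τ y)
  let T : Fin n → Fin n → Fin n → ℝ := fun k a i => pd k (fun z => jac τ z a i) y
  let C : Fin n → Matrix (Fin n) (Fin n) ℝ := fun i =>
    Matrix.of fun c b => christoffel (pullM τ A) c i b y
  let D : Fin n → Matrix (Fin n) (Fin n) ℝ := fun i => Matrix.of fun c b => T i c b
  let θ : Fin n → Matrix (Fin n) (Fin n) ℝ := fun i =>
    Matrix.of fun c d => ∑ a, J a i * Γ c a d
  let dC : Fin n → Fin n → Matrix (Fin n) (Fin n) ℝ := fun k i =>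
    Matrix.of fun c b => pd k (christoffel (pullM τ A) c i b) y
  let DD : Fin n → Fin n → Matrix (Fin n) (Fin n) ℝ := fun k i =>
    Matrix.of fun c b => pd k (pd i fun z => jac τ z c b) y
  let dθ : Fin n → Fin n → Matrix (Fin n) (Fin n) ℝ := fun k i =>
    Matrix.of fun c d => ∑ a, (T k a i * Γ c a d + J a i * ∑ b, J b k * dΓ b c a d)
  have h1 : ∀ i, J * C i = D i + θ i * J := by
    intro i
    ext c j
    have := jac_mul_christoffel_pullM h hA c i j
    simp only [Matrix.mul_apply, Matrix.add_apply, C, D, θ, Matrix.of_apply, T, Γ]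
    rw [this, Finset.sum_comm]
    congr 1
    refine Finset.sum_congr rfl fun a _ => ?_
    rw [Finset.sum_mul]
    exact Finset.sum_congr rfl fun b _ => by ring
  have h2 : ∀ k i, D k * C i + J * dC k i = DD k i + dθ k i * J + θ i * D k := by
    intro k i
    ext c j
    have := pd_jac_mul_christoffel_pullM h hA c k i j
    simp only [Matrix.mul_apply, Matrix.add_apply, C, D, θ, Matrix.of_apply, T, Γ, dC, DD, dθ, dΓ]
    rw [← Finset.sum_add_distrib, this, add_assoc, ← Finset.sum_add_distrib, Finset.sum_comm]
    congr 1
    refine Finset.sum_congr rfl fun b _ => ?_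
    rw [Finset.sum_mul, Finset.sum_mul, ← Finset.sum_add_distrib]
    exact Finset.sum_congr rfl fun a _ => by ring
  have h3 : DD k i = DD i k := by
    ext c b
    exact pd_comm (contDiffAt_jac h.smooth.self_of_nhds c b) k i
  have key := curvature_gauge (h1 k) (h1 i) (h2 k i) ((h2 i k).trans (by rw [h3]))
  have e1 : Matrix.of (fun c b => curv (pullM τ A) k i c b y) =
      dC k i - dC i k + (C k * C i - C i * C k) := by
    ext c b
    simp only [curv, Matrix.of_apply, Matrix.add_apply, Matrix.sub_apply, Matrix.mul_apply, dC, C,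
      Finset.sum_sub_distrib]
  have e2 : Matrix.of (fun c d => ∑ a, ∑ b, J a k * J b i * curv A a b c d (τ y)) =
      dθ k i - dθ i k + (θ k * θ i - θ i * θ k) := by
    ext c d
    -- The terms containing second derivatives of `τ` are symmetric in `k` and `i`, so they drop out
    -- of the antisymmetrised derivative of `θ`.
    have hT : ∀ a, T k a i = T i a k := fun a => pd_jac_symm h.smooth a k i
    simp only [curv, Matrix.of_apply, Matrix.add_apply, Matrix.sub_apply, Matrix.mul_apply, dθ, θ]
    change ∑ a, ∑ b, J a k * J b i * (dΓ a c b d - dΓ b c a d +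
      ∑ f, (Γ c a f * Γ f b d - Γ c b f * Γ f a d)) = _
    simp only [mul_add, mul_sub, Finset.sum_add_distrib, Finset.sum_sub_distrib, hT]
    have r1 : ∑ a, ∑ b, J a k * J b i * dΓ a c b d = ∑ a, J a i * ∑ b, J b k * dΓ b c a d := by
      rw [Finset.sum_comm]
      simp only [Finset.mul_sum]
      exact Finset.sum_congr rfl fun a _ => Finset.sum_congr rfl fun b _ => by ring
    have r2 : ∑ a, ∑ b, J a k * J b i * dΓ b c a d = ∑ a, J a k * ∑ b, J b i * dΓ b c a d := by
      simp only [Finset.mul_sum]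
      exact Finset.sum_congr rfl fun a _ => Finset.sum_congr rfl fun b _ => by ring
    have r3 : ∑ a, ∑ b, J a k * J b i * ∑ f, Γ c a f * Γ f b d =
        ∑ f, (∑ a, J a k * Γ c a f) * ∑ b, J b i * Γ f b d := by
      simp only [Finset.mul_sum, Finset.sum_mul]
      have : ∀ a, ∑ b, ∑ f, J a k * J b i * (Γ c a f * Γ f b d) =
          ∑ f, ∑ b, J a k * Γ c a f * (J b i * Γ f b d) := fun a => by
        rw [Finset.sum_comm]
        exact Finset.sum_congr rfl fun f _ => Finset.sum_congr rfl fun b _ => by ring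
      simp only [this]
      rw [Finset.sum_comm]
      refine Finset.sum_congr rfl fun f _ => ?_
      rw [Finset.sum_comm]
    have r4 : ∑ a, ∑ b, J a k * J b i * ∑ f, Γ c b f * Γ f a d =
        ∑ f, (∑ a, J a i * Γ c a f) * ∑ b, J b k * Γ f b d := by
      simp only [Finset.mul_sum, Finset.sum_mul]
      rw [Finset.sum_comm]
      have : ∀ a, ∑ b, ∑ f, J b k * J a i * (Γ c a f * Γ f b d) =
          ∑ f, ∑ b, J a i * Γ c a f * (J b k * Γ f b d) := fun a => by
        rw [Finset.sum_comm]
        exact Finset.sum_congr rfl fun f _ => Finset.sum_congr rfl fun b _ => by ring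
      simp only [this]
      rw [Finset.sum_comm]
      refine Finset.sum_congr rfl fun f _ => ?_
      rw [Finset.sum_comm]
    rw [r1, r2, r3, r4]
    ring
  rw [e1, e2]
  exact key

/-- The coordinate expression of the Ricci tensor of a smooth metric is tensorial. -/
theorem ricciComp_pullM (h : DiffeoNear τ y) (hA : MetricNear A (τ y)) :
    ricciComp (pullM τ A) y = pullM τ (ricciComp A) y := by
  have hJu : IsUnit (jac τ y).det := isUnit_iff_ne_zero.2 h.nondeg.self_of_nhds
  ext i j
  rw [ricciComp_eq_sum_curv (metricNear_pullM h hA).symm]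
  simp only [pullM]
  simp only [ricciComp_eq_sum_curv hA.symm]
  set J := jac τ y
  let Z : Fin n → Fin n → ℝ := fun a c => ∑ b, ∑ d, J b j * curv A a b c d (τ y) * J d i
  -- Multiplication by `J⁻¹` exhibits the curvature endomorphism as a conjugate; in the contraction
  -- over `m` the matrices `J` and `J⁻¹` then cancel.
  have h1 : ∀ m, curv (pullM τ A) m j m i y = ∑ a, ∑ c, J a m * J⁻¹ m c * Z a c := by
    intro m
    have := jac_mul_curv_pullM h hA m j
    have h2 := congrArg (fun X => J⁻¹ * X) this
    simp only [← Matrix.mul_assoc] at h2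
    rw [Matrix.nonsing_inv_mul _ hJu, Matrix.one_mul, Matrix.mul_assoc] at h2
    have h3 := congrFun (congrFun h2 m) i
    rw [Matrix.of_apply] at h3
    rw [h3, Matrix.mul_apply, Finset.sum_comm]
    refine Finset.sum_congr rfl fun c _ => ?_
    rw [Matrix.mul_apply]
    simp only [Matrix.of_apply, Z, Finset.mul_sum, Finset.sum_mul]
    rw [Finset.sum_comm]
    refine Finset.sum_congr rfl fun a _ => ?_
    rw [Finset.sum_comm]
    exact Finset.sum_congr rfl fun b _ => Finset.sum_congr rfl fun d _ => by ring
  have h4 : ∀ a c, ∑ m, J a m * J⁻¹ m c = (1 : Matrix (Fin n) (Fin n) ℝ) a c := by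
    intro a c
    rw [← Matrix.mul_nonsing_inv _ hJu, Matrix.mul_apply]
  have h5 : ∑ m, curv (pullM τ A) m j m i y = ∑ a, Z a a := by
    simp only [h1]
    rw [Finset.sum_comm]
    refine Finset.sum_congr rfl fun a _ => ?_
    rw [Finset.sum_comm]
    simp only [← Finset.sum_mul, h4]
    simp [Matrix.one_apply]
  rw [h5]
  simp only [Z, Finset.mul_sum]
  rw [Finset.sum_comm]
  have : ∀ b, ∑ a, ∑ d, J b j * curv A a b a d (τ y) * J d i =
      ∑ d, ∑ a, J d i * J b j * curv A a b a d (τ y) := fun b => by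
    rw [Finset.sum_comm]
    exact Finset.sum_congr rfl fun f _ => Finset.sum_congr rfl fun b _ => by ring
  simp only [this]
  rw [Finset.sum_comm]

end Tensoriality

/-! ### Quasi-linear structure of the Ricci tensor and gluing of metric families -/

section RicciExpansion

variable {n : ℕ}

/-- The second order part of the Ricci tensor as a function of the inverse metric `I` and of the
second derivatives `S k l i j = ∂_k ∂_l g_{ij}`. -/
def princ (I : Matrix (Fin n) (Fin n) ℝ) (S : Fin n → Fin n → Fin n → Fin n → ℝ)
    (i j : Fin n) : ℝ :=
  ∑ m, (1 / 2 : ℝ) * ∑ l, I m l * ((S m i j l + S m j i l - S m l i j) -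
    (S j i m l + S j m i l - S j l i m))

/-- For a fixed inverse metric the second order part is linear in the second derivatives. This
linearity is what makes the Ricci tensor compatible with partitions of unity in the limit. -/
lemma princ_sub_sum {ι : Type*} (F : Finset ι) (c : ι → ℝ) (I : Matrix (Fin n) (Fin n) ℝ)
    (S : Fin n → Fin n → Fin n → Fin n → ℝ) (Sa : ι → Fin n → Fin n → Fin n → Fin n → ℝ)
    (i j : Fin n) : princ I (fun k l i j => S k l i j - ∑ α ∈ F, c α * Sa α k l i j) i j =
      princ I S i j - ∑ α ∈ F, c α * princ I (Sa α) i j := by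
  classical
  induction F using Finset.induction_on with
  | empty => simp
  | insert a s ha ih =>
    have h1 : princ I (fun k l i j => S k l i j - ∑ α ∈ insert a s, c α * Sa α k l i j) i j =
        princ I (fun k l i j => S k l i j - ∑ α ∈ s, c α * Sa α k l i j) i j -
          c a * princ I (Sa a) i j := by
      simp only [princ, Finset.sum_insert ha, Finset.mul_sum, ← Finset.sum_sub_distrib]
      exact Finset.sum_congr rfl fun m _ => Finset.sum_congr rfl fun l _ => by ring
    rw [h1, ih, Finset.sum_insert ha]
    ring

/-- The second derivatives of a matrix field. -/
def sec (A : Model n → Matrix (Fin n) (Fin n) ℝ) (y : Model n) (k l i j : Fin n) : ℝ :=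
  pd k (pd l fun z => A z i j) y

/-- The part of the Ricci tensor involving only first derivatives. -/
def lower (A : Model n → Matrix (Fin n) (Fin n) ℝ) (i j : Fin n) (y : Model n) : ℝ :=
  ∑ m, (1 / 2 : ℝ) * ∑ l, (pd m (fun z => (A z)⁻¹ m l) y * lowerChr A i j l y -
    pd j (fun z => (A z)⁻¹ m l) y * lowerChr A i m l y) + ricciQuad A i j y

variable {A G : Model n → Matrix (Fin n) (Fin n) ℝ} {y : Model n}

lemma pd_lowerChr (h : ∀ i j, ContDiffAt ℝ ∞ (fun w => A w i j) y) (k i j l : Fin n) :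
    pd k (lowerChr A i j l) y = sec A y k i j l + sec A y k j i l - sec A y k l i j := by
  have h1 := fun i j k => (contDiffAt_pd (h i j) k).dif
  change pd k (fun z => pd i (fun z => A z j l) z + pd j (fun z => A z i l) z -
    pd l (fun z => A z i j) z) y = _
  rw [pd_sub ((h1 _ _ _).fun_add (h1 _ _ _)) (h1 _ _ _), pd_add (h1 _ _ _) (h1 _ _ _)]
  rfl

lemma pd_christoffel (h : ∀ i j, ContDiffAt ℝ ∞ (fun w => A w i j) y) (hd : (A y).det ≠ 0)
    (k m i j : Fin n) :
    pd k (christoffel A m i j) y = (1 / 2 : ℝ) * ∑ l,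
      (pd k (fun z => (A z)⁻¹ m l) y * lowerChr A i j l y +
        (A y)⁻¹ m l * (sec A y k i j l + sec A y k j i l - sec A y k l i j)) := by
  have h1 := fun l => (contDiffAt_inv_apply h hd m l).dif
  have h2 : ∀ l, DifferentiableAt ℝ (lowerChr A i j l) y := fun l =>
    (((contDiffAt_pd (h j l) i).add (contDiffAt_pd (h i l) j)).sub
      (contDiffAt_pd (h i j) l)).dif
  change pd k (fun z => (1 / 2 : ℝ) * ∑ l, (A z)⁻¹ m l * lowerChr A i j l z) y = _
  rw [pd_const_mul, pd_sum fun l _ => (h1 l).fun_mul (h2 l)]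
  congr 1
  refine Finset.sum_congr rfl fun l _ => ?_
  rw [pd_mul (h1 l) (h2 l), pd_lowerChr h]

lemma ricciComp_expand (h : ∀ i j, ContDiffAt ℝ ∞ (fun w => A w i j) y) (hd : (A y).det ≠ 0)
    (i j : Fin n) : ricciComp A y i j = princ (A y)⁻¹ (sec A y) i j + lower A i j y := by
  rw [ricciComp, lower, princ, ← add_assoc, ← Finset.sum_add_distrib]
  congr 1
  refine Finset.sum_congr rfl fun m _ => ?_
  rw [pd_christoffel h hd, pd_christoffel h hd, ← mul_sub, ← mul_add, ← Finset.sum_sub_distrib,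
    ← Finset.sum_add_distrib]
  congr 1
  refine Finset.sum_congr rfl fun l _ => ?_
  ring

variable {U : Set (Model n)} {E : ℝ → Model n → Matrix (Fin n) (Fin n) ℝ}

lemma conv_lowerChr (h : ∀ i j, Approx U (fun ε z => E ε z i j) (fun z => G z i j))
    (i j l : Fin n) : Conv U (fun ε => lowerChr (E ε) i j l) (lowerChr G i j l) :=
  (((h j l).deriv i).add ((h i l).deriv j)).sub ((h i j).deriv l)

lemma conv_christoffel (hU : IsOpen U)
    (h : ∀ i j, Approx U (fun ε z => E ε z i j) (fun z => G z i j))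
    (hd : ∀ y ∈ U, (G y).det ≠ 0) (m i j : Fin n) :
    Conv U (fun ε => christoffel (E ε) m i j) (christoffel G m i j) :=
  (Conv.sum fun l _ => (Approx.inv_apply hU h hd m l).conv.mul (conv_lowerChr h i j l)).const_mul _

lemma conv_ricciQuad (hU : IsOpen U)
    (h : ∀ i j, Approx U (fun ε z => E ε z i j) (fun z => G z i j))
    (hd : ∀ y ∈ U, (G y).det ≠ 0) (i j : Fin n) :
    Conv U (fun ε => ricciQuad (E ε) i j) (ricciQuad G i j) :=
  Conv.sum fun m _ => Conv.sum fun k _ =>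
    ((conv_christoffel hU h hd m i j).mul (conv_christoffel hU h hd k k m)).sub
      ((conv_christoffel hU h hd m i k).mul (conv_christoffel hU h hd k j m))

lemma conv_lower (hU : IsOpen U)
    (h : ∀ i j, Approx U (fun ε z => E ε z i j) (fun z => G z i j))
    (hd : ∀ y ∈ U, (G y).det ≠ 0) (i j : Fin n) :
    Conv U (fun ε => lower (E ε) i j) (lower G i j) :=
  (Conv.sum fun m _ => (Conv.sum fun l _ =>
    (((Approx.inv_apply hU h hd m l).deriv m).mul (conv_lowerChr h i j l)).sub
      (((Approx.inv_apply hU h hd m l).deriv j).mul (conv_lowerChr h i m l))).const_mul _).add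
    (conv_ricciQuad hU h hd i j)

lemma pd_pd_const_mul (c : ℝ) (f : Model n → ℝ) (k l : Fin n) (y : Model n) :
    pd k (pd l fun z => c * f z) y = c * pd k (pd l f) y := by
  have : (pd l fun z => c * f z) = fun z => c * pd l f z := funext fun z => pd_const_mul c
  rw [this, pd_const_mul]

/-- A metric family with controlled second derivatives has, up to its second order part, a
convergent Ricci tensor. -/
lemma conv_ricciComp (hU : IsOpen U)
    (h : ∀ i j, Approx U (fun ε z => E ε z i j) (fun z => G z i j))
    (hd : ∀ y ∈ U, (G y).det ≠ 0) (h2 : ∀ i j, NeglTwo U (fun ε z => ε * E ε z i j))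
    (i j : Fin n) :
    Conv U (fun ε y => ricciComp (E ε) y i j - princ (G y)⁻¹ (sec (E ε) y) i j) (lower G i j) := by
  have hs : ∀ k l i j, Negl U (fun ε y => ε * sec (E ε) y k l i j) := fun k l i j =>
    ((h2 i j).two k l).congr fun y _ => Eventually.of_forall fun p => pd_pd_const_mul _ _ _ _ _
  -- Exchanging the inverse of `E ε` for that of `G` in the second order part: the difference of the
  -- inverses is `O(ε)` and the second derivatives are `o(1/ε)`.
  have h1 : Negl U (fun ε y => ∑ m, (1 / 2 : ℝ) * ∑ l, ((E ε y)⁻¹ m l - (G y)⁻¹ m l) *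
      ((sec (E ε) y m i j l + sec (E ε) y m j i l - sec (E ε) y m l i j) -
        (sec (E ε) y j i m l + sec (E ε) y j m i l - sec (E ε) y j l i m))) := by
    refine Negl.sum fun m _ => Negl.const_mul _ (Negl.sum fun l _ =>
      Negl.bigOEps_mul (Approx.inv_apply hU h hd m l).close ?_)
    refine ((((hs m i j l).add (hs m j i l)).sub (hs m l i j)).sub
      (((hs j i m l).add (hs j m i l)).sub (hs j l i m))).congr
      fun y _ => Eventually.of_forall fun p => by ring
  have h3 := Conv.add h1 (conv_lower hU h hd i j)
  simp only [zero_add] at h3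
  refine h3.congr fun y hy => ?_
  have hsm : ∀ᶠ p in lz y, ∀ i j, ContDiffAt ℝ ∞ (fun z => E p.1 z i j) p.2 :=
    eventually_all.2 fun i => eventually_all.2 fun j => (h i j).smooth y hy
  filter_upwards [hsm, (Approx.det hU h).eventually_ne_zero hy (hd y hy)] with p hp hp'
  rw [ricciComp_expand hp hp']
  simp only [princ, sub_mul, Finset.sum_sub_distrib, mul_sub]
  ring

/-- Gluing: the Ricci tensor of a convex combination of metric families with the same limit. -/
lemma negl_ricciComp_glue (hU : IsOpen U) {ι : Type*} {F : Finset ι}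
    {Ea : ι → ℝ → Model n → Matrix (Fin n) (Fin n) ℝ} {ζ : ι → Model n → ℝ}
    {Da : ι → ℝ → Model n → Matrix (Fin n) (Fin n) ℝ}
    (hE : ∀ α ∈ F, ∀ i j, Approx U (fun ε z => Ea α ε z i j) (fun z => G z i j))
    (h2 : ∀ α ∈ F, ∀ i j, NeglTwo U (fun ε z => ε * Ea α ε z i j))
    (hζ : ∀ α ∈ F, ∀ y ∈ U, ContDiffAt ℝ ∞ (ζ α) y) (hsum : ∀ y ∈ U, ∑ α ∈ F, ζ α y = 1)
    (hD : ∀ α ∈ F, ∀ i j, NeglTwo U (fun ε z => Da α ε z i j))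
    (hD0 : ∀ α ∈ F, ∀ i j, BigOEps U (fun ε z => Da α ε z i j))
    (hd : ∀ y ∈ U, (G y).det ≠ 0)
    (hG : ∀ i j, EvEq U (fun ε z => ∑ α ∈ F, (ζ α z * Ea α ε z i j + Da α ε z i j))
      (fun ε z => E ε z i j)) :
    (∀ i j, Approx U (fun ε z => E ε z i j) (fun z => G z i j)) ∧
    ∀ i j, Negl U (fun ε y => ricciComp (E ε) y i j -
      ∑ α ∈ F, ζ α y * ricciComp (Ea α ε) y i j) := by
  -- The error terms are treated as approximations of zero, so that the calculus of `Approx` applies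
  -- to the whole sum.
  have hDa : ∀ α ∈ F, ∀ i j, Approx U (fun ε z => Da α ε z i j) (fun _ => 0) := fun α hα i j =>
    ⟨(hD α hα i j).smooth, fun y _ => LipAt.const 0 y, by simpa using hD0 α hα i j, fun k => by
      simpa only [show pd k (fun _ : Model n => (0 : ℝ)) = fun _ => 0 from
        funext fun _ => pd_const 0] using (hD α hα i j).one k⟩
  have hEA : ∀ i j, Approx U (fun ε z => E ε z i j) (fun z => G z i j) := by
    intro i j
    refine ((Approx.sum hU fun α hα => ((Approx.of_smooth hU (hζ α hα)).mul (hE α hα i j)).add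
      (hDa α hα i j)).congr (hG i j)).congr_lim hU fun y hy => ?_
    simp only [add_zero]
    rw [← Finset.sum_mul, hsum y hy, one_mul]
  have hsmU : ∀ y ∈ U, ∀ᶠ z in 𝓝 y, z ∈ U := fun y hy => hU.eventually_mem hy
  have hζev : ∀ y ∈ U, ∀ᶠ p in lz y, ∀ α ∈ F, ContDiffAt ℝ ∞ (ζ α) p.2 := fun y hy =>
    eventually_lz_of_nhds ((hsmU y hy).mono fun z hz α hα => hζ α hα z hz)
  have hEsm : ∀ y ∈ U, ∀ᶠ p in lz y, ∀ α ∈ F, ∀ i j,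
      ContDiffAt ℝ ∞ (fun z => Ea α p.1 z i j) p.2 := fun y hy =>
    (Finset.eventually_all F).2 fun α hα => eventually_all.2 fun i => eventually_all.2 fun j =>
      (hE α hα i j).smooth y hy
  have hDsm : ∀ y ∈ U, ∀ᶠ p in lz y, ∀ α ∈ F, ∀ i j,
      ContDiffAt ℝ ∞ (fun z => Da α p.1 z i j) p.2 := fun y hy =>
    (Finset.eventually_all F).2 fun α hα => eventually_all.2 fun i => eventually_all.2 fun j =>
      (hD α hα i j).smooth y hy
  have hE2 : ∀ i j, NeglTwo U (fun ε z => ε * E ε z i j) := by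
    intro i j
    have hε : ∀ α ∈ F, NeglTwo U (fun ε z => ε * Da α ε z i j) := by
      intro α hα
      have hb : Bdd U (fun ε _ => ε) := fun y _ => isBigO_lz_fst_one y
      refine ⟨fun y hy => ?_, Negl.bdd_mul hb (hD α hα i j).zero, fun k => ?_, fun k l => ?_⟩
      · exact ((hD α hα i j).smooth y hy).mono fun p hp => contDiffAt_const.mul hp
      · exact (Negl.bdd_mul hb ((hD α hα i j).one k)).congr fun y _ =>
          Eventually.of_forall fun p => (pd_const_mul _).symm
      · exact (Negl.bdd_mul hb ((hD α hα i j).two k l)).congr fun y _ =>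
          Eventually.of_forall fun p => (pd_pd_const_mul _ _ _ _ _).symm
    refine (NeglTwo.sum fun α hα => (NeglTwo.smooth_mul hU (hζ α hα) (h2 α hα i j)).add
      (hε α hα)).congr fun y hy => ?_
    filter_upwards [hG i j y hy] with p hp
    rw [← hp, Finset.mul_sum]
    exact Finset.sum_congr rfl fun α _ => by ring
  have e1 : ∀ l i j, EvEq U (fun ε z => ∑ α ∈ F, (pd l (ζ α) z * Ea α ε z i j +
      ζ α z * pd l (fun w => Ea α ε w i j) z + pd l (fun w => Da α ε w i j) z))
      (fun ε => pd l fun z => E ε z i j) := by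
    intro l i j y hy
    filter_upwards [((hG i j).pd l) y hy, hζev y hy, hEsm y hy, hDsm y hy] with p hp h1 h2 h3
    rw [← hp, pd_sum fun α hα => ((h1 α hα).mul (h2 α hα i j)).dif.fun_add (h3 α hα i j).dif]
    refine Finset.sum_congr rfl fun α hα => ?_
    rw [pd_add ((h1 α hα).mul (h2 α hα i j)).dif (h3 α hα i j).dif,
      pd_mul (h1 α hα).dif (h2 α hα i j).dif]
  -- By the Leibniz rule every remaining term with a derivative of a weight has a limit in which the
  -- same factor `G`, or a derivative of `G`, multiplies a derivative of `∑ ζ α = 1`; these limits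
  -- vanish.
  have hsec : ∀ k l i j, Negl U (fun ε y => sec (E ε) y k l i j -
      ∑ α ∈ F, ζ α y * sec (Ea α ε) y k l i j) := by
    intro k l i j
    have c : Conv U (fun ε y => ∑ α ∈ F, (pd k (pd l (ζ α)) y * Ea α ε y i j +
        pd l (ζ α) y * pd k (fun w => Ea α ε w i j) y +
        pd k (ζ α) y * pd l (fun w => Ea α ε w i j) y + pd k (pd l fun w => Da α ε w i j) y))
        (fun y => ∑ α ∈ F, (pd k (pd l (ζ α)) y * G y i j +
        pd l (ζ α) y * pd k (fun w => G w i j) y +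
        pd k (ζ α) y * pd l (fun w => G w i j) y + 0)) := by
      refine Conv.sum fun α hα => ?_
      have c0 : ∀ l, Conv U (fun _ => pd l (ζ α)) (pd l (ζ α)) := fun l =>
        Conv.of_continuousAt fun y hy => (contDiffAt_pd (hζ α hα y hy) l).continuousAt
      have c1 : Conv U (fun _ => pd k (pd l (ζ α))) (pd k (pd l (ζ α))) :=
        Conv.of_continuousAt fun y hy =>
          (contDiffAt_pd (contDiffAt_pd (hζ α hα y hy) l) k).continuousAt
      exact (((c1.mul (hE α hα i j).conv).add ((c0 l).mul ((hE α hα i j).deriv k))).add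
        ((c0 k).mul ((hE α hα i j).deriv l))).add ((hD α hα i j).two k l)
    refine (c.congr_lim (Eventually.of_forall fun y hy => ?_)).congr fun y hy => ?_
    · have s1 : ∀ l, ∀ y ∈ U, ∑ α ∈ F, pd l (ζ α) y = 0 := by
        intro l y hy
        rw [← pd_sum fun α hα => (hζ α hα y hy).dif]
        rw [pd_congr ((hsmU y hy).mono fun z hz => hsum z hz), pd_const]
      have s2 : ∑ α ∈ F, pd k (pd l (ζ α)) y = 0 := by
        rw [← pd_sum fun α hα => (contDiffAt_pd (hζ α hα y hy) l).dif]
        rw [pd_congr ((hsmU y hy).mono fun z hz => s1 l z hz), pd_const]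
      simp only [add_zero, Finset.sum_add_distrib, ← Finset.sum_mul, s1 _ y hy, s2, zero_mul]
    · filter_upwards [(e1 l i j).pd k y hy, hζev y hy, hEsm y hy, hDsm y hy] with p hp h1 h2 h3
      have d1 := fun α hα => contDiffAt_pd (h1 α hα) l
      have d2 := fun α hα => contDiffAt_pd (h2 α hα i j) l
      have d3 := fun α hα => contDiffAt_pd (h3 α hα i j) l
      rw [sec, ← hp, pd_sum fun α hα => (((d1 α hα).mul (h2 α hα i j)).dif.fun_add
        ((h1 α hα).mul (d2 α hα)).dif).fun_add (d3 α hα).dif, ← Finset.sum_sub_distrib]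
      refine Finset.sum_congr rfl fun α hα => ?_
      rw [pd_add (((d1 α hα).mul (h2 α hα i j)).dif.fun_add ((h1 α hα).mul (d2 α hα)).dif)
        (d3 α hα).dif, pd_add ((d1 α hα).mul (h2 α hα i j)).dif ((h1 α hα).mul (d2 α hα)).dif,
        pd_mul (d1 α hα).dif (h2 α hα i j).dif, pd_mul (h1 α hα).dif (d2 α hα).dif, sec]
      ring
  refine ⟨hEA, fun i j => ?_⟩
  have hζc : ∀ α ∈ F, Conv U (fun _ => ζ α) (ζ α) := fun α hα =>
    Conv.of_continuousAt fun y hy => (hζ α hα y hy).continuousAt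
  -- Once the second order parts are removed, the glued family and the weighted sum of the pieces
  -- both converge to `lower G`, the weights having sum one. The second order parts are compared in
  -- `k2`.
  have k1 := (conv_ricciComp hU hEA hd hE2 i j).sub (Conv.sum fun α hα => (hζc α hα).mul
    (conv_ricciComp hU (hE α hα) hd (h2 α hα) i j))
  have hI : ∀ m l, Bdd U (fun _ y => (G y)⁻¹ m l) := fun m l =>
    (Approx.inv_apply hU hEA hd m l).bdd_lim
  have k2 : Negl U (fun ε y => princ (G y)⁻¹ (fun k l i j => sec (E ε) y k l i j -
      ∑ α ∈ F, ζ α y * sec (Ea α ε) y k l i j) i j) := by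
    refine Negl.sum fun m _ => Negl.const_mul _ (Negl.sum fun l _ => Negl.bdd_mul (hI m l) ?_)
    exact (((hsec m i j l).add (hsec m j i l)).sub (hsec m l i j)).sub
      (((hsec j i m l).add (hsec j m i l)).sub (hsec j l i m))
  refine ((k1.add k2).congr_lim (Eventually.of_forall fun y hy => ?_)).congr
    fun y hy => Eventually.of_forall fun p => ?_
  · rw [← Finset.sum_mul, hsum y hy]
    ring
  · beta_reduce
    rw [princ_sub_sum F (fun α => ζ α p.2) (G p.2)⁻¹ (sec (E p.1) p.2)
      (fun α => sec (Ea α p.1) p.2)]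
    simp only [mul_sub, Finset.sum_sub_distrib]
    ring

end RicciExpansion

/-! ### The comparison of mollified Ricci tensors on Euclidean space -/

section LocalRicci

variable {n : ℕ} {ρ : Model n → ℝ}

/-- Compactly supported Lipschitz functions. -/
structure LipComp (f : Model n → ℝ) : Prop where
  lip : ∃ K, LipschitzWith K f
  supp : HasCompactSupport f

/-- On a ball whose radius exceeds that of a ball containing the support by one, compactness gives a
Lipschitz constant. If one of two points lies outside, then either `f` vanishes at both or they are
at distance at least one, and the bound `B` on `|f|` suffices. -/
lemma LipComp.of_lipAt {f : Model n → ℝ} (hf : ∀ y, LipAt f y) (hs : HasCompactSupport f) :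
    LipComp f := by
  refine ⟨?_, hs⟩
  have hc : Continuous f := continuous_iff_continuousAt.2 fun y => (hf y).continuousAt
  obtain ⟨B, hB⟩ := hs.exists_bound_of_continuous hc
  obtain ⟨R, hR⟩ := hs.isCompact.isBounded.subset_closedBall (0 : Model n)
  have hl : LocallyLipschitzOn (Metric.closedBall (0 : Model n) (R + 1)) f := fun y _ => by
    obtain ⟨K, t, ht, hK⟩ := hf y
    exact ⟨K, t, mem_nhdsWithin_of_mem_nhds ht, hK⟩
  obtain ⟨K, hK⟩ := hl.exists_lipschitzOnWith_of_compact (isCompact_closedBall _ _)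
  have hB0 : 0 ≤ B := (norm_nonneg _).trans (hB 0)
  have hzero : ∀ y, R < ‖y‖ → f y = 0 := fun y hy => by
    by_contra h
    have := hR (subset_tsupport _ h)
    rw [mem_closedBall_zero_iff] at this
    linarith
  have key : ∀ x y, ‖x‖ ≤ ‖y‖ → dist (f x) (f y) ≤ max K ⟨B, hB0⟩ * dist x y := by
    intro x y hxy
    rcases le_or_gt ‖y‖ (R + 1) with hy | hy
    · refine (hK.dist_le_mul x (by simpa using hxy.trans hy) y (by simpa using hy)).trans ?_
      exact mul_le_mul_of_nonneg_right (mod_cast le_max_left _ _) dist_nonneg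
    · rw [hzero y (by linarith)]
      rcases le_or_gt ‖x‖ R with hx | hx
      · have h1 : 1 ≤ dist x y := by
          rw [dist_comm, dist_eq_norm]
          have := norm_sub_norm_le y x
          linarith
        have h2 : dist (f x) 0 ≤ B := by simpa using hB x
        have h3 : B ≤ ((max K ⟨B, hB0⟩ : NNReal) : ℝ) :=
          NNReal.coe_le_coe.2 (le_max_right K ⟨B, hB0⟩)
        exact h2.trans (h3.trans (le_mul_of_one_le_right (NNReal.coe_nonneg _) h1))
      · rw [hzero x hx, dist_self]
        positivity
  refine ⟨max K ⟨B, hB0⟩, LipschitzWith.of_dist_le_mul fun x y => ?_⟩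
  rcases le_total ‖x‖ ‖y‖ with h | h
  · exact key x y h
  · rw [dist_comm, dist_comm x]
    exact key y x h

namespace LipComp

variable {f g : Model n → ℝ}

lemma continuous (h : LipComp f) : Continuous f := h.lip.choose_spec.continuous

lemma bddMeas (h : LipComp f) : BddMeas f := BddMeas.of_continuous h.continuous h.supp

lemma bddMeas_pd (h : LipComp f) (k : Fin n) : BddMeas (pd k f) :=
  BddMeas.pd_of_lipschitz h.lip.choose_spec k

lemma lipAt (h : LipComp f) (y : Model n) : LipAt f y :=
  ⟨_, univ, univ_mem, h.lip.choose_spec.lipschitzOnWith⟩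

lemma ae_differentiableAt (h : LipComp f) : ∀ᵐ y, DifferentiableAt ℝ f y :=
  h.lip.choose_spec.ae_differentiableAt

lemma of_contDiff (h : ContDiff ℝ ∞ f) (hs : HasCompactSupport f) : LipComp f :=
  LipComp.of_lipAt (fun _ => LipAt.of_contDiffAt h.contDiffAt) hs

lemma mul (hf : LipComp f) (hg : LipComp g) : LipComp (fun y => f y * g y) :=
  LipComp.of_lipAt (fun y => (hf.lipAt y).mul (hg.lipAt y)) hf.supp.mul_right

end LipComp

namespace Mollifier

variable {f u v ξ : Model n → ℝ}

lemma integrable_mul_scaled (h : Mollifier ρ) {ε : ℝ} (hε : 0 < ε) (hu : BddMeas u)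
    (y : Model n) : Integrable fun z => u z * ((ε ^ n)⁻¹ * ρ (ε⁻¹ • (y - z))) := by
  obtain ⟨C, hC⟩ := hu.bound
  have h1 : Integrable (scaled ρ ε) :=
    (h.contDiff_scaled ε).continuous.integrable_of_hasCompactSupport (h.hasCompactSupport_scaled hε)
  exact (h1.comp_sub_left y).bdd_mul (c := C) hu.measurable.aestronglyMeasurable
    (Eventually.of_forall hC)

lemma mol_add (h : Mollifier ρ) {ε : ℝ} (hε : 0 < ε) (hu : BddMeas u) (hv : BddMeas v)
    (y : Model n) : mol ρ ε (fun z => u z + v z) y = mol ρ ε u y + mol ρ ε v y := by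
  rw [mol, mol, mol, ← integral_add (h.integrable_mul_scaled hε hu y)
    (h.integrable_mul_scaled hε hv y)]
  simp only [add_mul]

lemma mol_const_mul (c ε : ℝ) (u : Model n → ℝ) (y : Model n) :
    mol ρ ε (fun z => c * u z) y = c * mol ρ ε u y := by
  rw [mol, mol, ← integral_const_mul]
  simp only [mul_assoc]

lemma mol_sum (h : Mollifier ρ) {ε : ℝ} (hε : 0 < ε) {ι : Type*} {s : Finset ι}
    {u : ι → Model n → ℝ} (hu : ∀ i ∈ s, BddMeas (u i)) (y : Model n) :
    mol ρ ε (fun z => ∑ i ∈ s, u i z) y = ∑ i ∈ s, mol ρ ε (u i) y := by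
  simp only [mol, Finset.sum_mul]
  exact integral_finsetSum _ fun i hi => h.integrable_mul_scaled hε (hu i hi) y

lemma mol_congr_ae {ε : ℝ} (huv : ∀ᵐ z, u z = v z) (y : Model n) :
    mol ρ ε u y = mol ρ ε v y :=
  integral_congr_ae (huv.mono fun z hz => by simp only [hz])

lemma approx_mol' (h : Mollifier ρ) (hf : LipComp f) (U : Set (Model n)) :
    Approx U (fun ε => mol ρ ε f) f := h.approx_mol hf.lip.choose_spec U

lemma pd_mol' (h : Mollifier ρ) {ε : ℝ} (hε : 0 < ε) (hf : LipComp f) (k : Fin n) :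
    pd k (mol ρ ε f) = mol ρ ε (pd k f) :=
  funext fun y => h.pd_mol_of_lipschitz hε hf.lip.choose_spec k y

lemma conv_commutator' (h : Mollifier ρ) {a : Model n → ℝ} (ha : LipComp a) (hu : BddMeas u)
    (k : Fin n) (U : Set (Model n)) :
    Conv U (fun ε y => pd k (mol ρ ε fun z => a z * u z) y - a y * pd k (mol ρ ε u) y)
      (fun y => pd k a y * u y) := h.conv_commutator ha.lip.choose_spec ha.bddMeas hu k U

/-- Only the second derivatives need an argument: one derivative is moved onto `f`, and the other
falls on the kernel as in `negl_eps_pd_mol`. -/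
lemma neglTwo_eps_mol (h : Mollifier ρ) (hf : LipComp f) (U : Set (Model n)) :
    NeglTwo U (fun ε y => ε * mol ρ ε f y) := by
  have hε : Negl U (fun ε _ => ε) :=
    BigOEps.negl fun y _ => Asymptotics.isBigO_refl _ _
  have ha := h.approx_mol' hf U
  refine ⟨fun y hy => ?_, ?_, fun k => ?_, fun k l => ?_⟩
  · exact (ha.smooth y hy).mono fun p hp => contDiffAt_const.mul hp
  · exact (Negl.bdd_mul ha.bdd hε).congr fun y _ => Eventually.of_forall fun p => by ring
  · refine (Negl.bdd_mul (ha.deriv k).bdd hε).congr fun y _ => Eventually.of_forall fun p => ?_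
    simp only [pd_const_mul]
    ring
  · refine (h.negl_eps_pd_mol (hf.bddMeas_pd l) k U).congr fun y _ => ?_
    filter_upwards [eventually_pos_lz y] with p hp
    rw [pd_pd_const_mul, h.pd_mol' hp hf]

/-- The commutator of mollification with multiplication by a smooth function is negligible
together with its derivatives of order two. -/
lemma neglTwo_commutator (h : Mollifier ρ) (hf : LipComp f) (hξ : ContDiff ℝ ∞ ξ)
    (hξs : HasCompactSupport ξ) (U : Set (Model n)) :
    NeglTwo U (fun ε y => mol ρ ε (fun z => ξ z * f z) y - ξ y * mol ρ ε f y) ∧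
    BigOEps U (fun ε y => mol ρ ε (fun z => ξ z * f z) y - ξ y * mol ρ ε f y) := by
  suffices H : NeglTwo univ (fun ε y => mol ρ ε (fun z => ξ z * f z) y - ξ y * mol ρ ε f y) ∧
      BigOEps univ (fun ε y => mol ρ ε (fun z => ξ z * f z) y - ξ y * mol ρ ε f y) from
    ⟨H.1.mono (subset_univ _), H.2.mono (subset_univ _)⟩
  have hξL : LipComp ξ := LipComp.of_contDiff hξ hξs
  have hξf : LipComp (fun z => ξ z * f z) := hξL.mul hf
  have hξd : ∀ k, ContDiff ℝ ∞ (pd k ξ) := fun k =>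
    contDiff_iff_contDiffAt.2 fun _ => contDiffAt_pd hξ.contDiffAt k
  have hξdL : ∀ k, LipComp (pd k ξ) := fun k => LipComp.of_contDiff (hξd k)
    (hξs.mono' ((subset_tsupport _).trans (tsupport_pd_subset k ξ)))
  have hcs : ∀ {φ : Model n → ℝ}, ContDiff ℝ ∞ φ → Conv univ (fun _ => φ) φ := fun hφ =>
    Conv.of_continuousAt fun y _ => hφ.continuous.continuousAt
  have ha := h.approx_mol' hξf univ
  have hm := h.approx_mol' hf univ
  have hb := (Approx.of_smooth isOpen_univ fun y _ => hξ.contDiffAt).mul hm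
  have hO : BigOEps univ (fun ε y => mol ρ ε (fun z => ξ z * f z) y - ξ y * mol ρ ε f y) := by
    refine (ha.close.add (hb.close.mul_bdd (Conv.const (-1 : ℝ)).bdd)).congr
      fun y _ => Eventually.of_forall fun p => by ring
  have hsm : ∀ y : Model n, ∀ᶠ p in lz y, ContDiffAt ℝ ∞ (mol ρ p.1 fun z => ξ z * f z) p.2 ∧
      ContDiffAt ℝ ∞ (mol ρ p.1 f) p.2 := fun y =>
    (ha.smooth y trivial).and (hm.smooth y trivial)
  refine ⟨⟨fun y _ => ?_, hO.negl, fun k => ?_, fun k l => ?_⟩, hO⟩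
  · exact (hsm y).mono fun p hp => hp.1.sub (hξ.contDiffAt.mul hp.2)
  · have := (ha.deriv k).sub (hb.deriv k)
    simp only [sub_self] at this
    refine this.congr fun y _ => (hsm y).mono fun p hp => ?_
    rw [pd_sub hp.1.dif (hξ.contDiffAt.mul hp.2).dif]
  · have e0 : EvEq univ (fun ε y => mol ρ ε (fun z => pd l ξ z * f z) y +
        mol ρ ε (fun z => ξ z * pd l f z) y - (pd l ξ y * mol ρ ε f y + ξ y * pd l (mol ρ ε f) y))
        (fun ε => pd l fun y => mol ρ ε (fun z => ξ z * f z) y - ξ y * mol ρ ε f y) := by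
      intro y _
      filter_upwards [hsm y, eventually_pos_lz y] with p hp hpos
      rw [pd_sub hp.1.dif (hξ.contDiffAt.mul hp.2).dif,
        show pd l (fun y => mol ρ p.1 (fun z => ξ z * f z) y) p.2 =
          mol ρ p.1 (pd l fun z => ξ z * f z) p.2 from congrFun (h.pd_mol' hpos hξf l) p.2,
        pd_mul hξ.contDiffAt.dif hp.2.dif]
      rw [← h.mol_add hpos ((hξdL l).bddMeas.mul hf.bddMeas) (hξL.bddMeas.mul (hf.bddMeas_pd l))]
      congr 1
      refine mol_congr_ae ?_ _
      filter_upwards [hf.ae_differentiableAt] with z hz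
      rw [pd_mul hξ.contDiffAt.dif hz]
    have hl1 := (h.approx_mol' ((hξdL l).mul hf) univ)
    -- In the second derivative, the mollification of `ξ ∂ₗf` is differentiated although `∂ₗf` is
    -- merely bounded. The Friedrichs commutator replaces it by `ξ ∂ₖ((∂ₗf) * ρ_ε)` plus a term
    -- tending to `∂ₖξ ∂ₗf`, and then all limits cancel.
    have hl2 := h.conv_commutator' hξL (hf.bddMeas_pd l) k univ
    have c1 := ((hl1.deriv k).add hl2).sub (((((hcs (contDiff_iff_contDiffAt.2 fun _ =>
      contDiffAt_pd (hξd l).contDiffAt k)).mul hm.conv).add ((hcs (hξd l)).mul (hm.deriv k)))).add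
      ((hcs (hξd k)).mul (hm.deriv l)))
    refine ((c1.congr_lim ?_).congr fun y _ => ?_).congr (e0.pd k)
    · filter_upwards [hf.ae_differentiableAt] with y hy _
      rw [pd_mul (hξd l).contDiffAt.dif hy]
      ring
    · filter_upwards [hsm y, eventually_pos_lz y, hl1.smooth y trivial] with p hp hpos hs1
      have s2 : ContDiffAt ℝ ∞ (fun y => mol ρ p.1 (fun z => ξ z * pd l f z) y) p.2 :=
        (h.contDiff_mol hpos (hξL.bddMeas.mul (hf.bddMeas_pd l)).locallyIntegrable).contDiffAt
      have s3 := contDiffAt_pd hp.2 l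
      have s4 : ContDiffAt ℝ ∞ (pd l ξ) p.2 := (hξd l).contDiffAt
      have s5 : ContDiffAt ℝ ∞ ξ p.2 := hξ.contDiffAt
      rw [pd_sub (hs1.dif.fun_add s2.dif) ((s4.mul hp.2).dif.fun_add (s5.mul s3).dif),
        pd_add hs1.dif s2.dif, pd_add (s4.mul hp.2).dif (s5.mul s3).dif, pd_mul s4.dif hp.2.dif,
        pd_mul s5.dif s3.dif, ← h.pd_mol' hpos hf l]
      ring

end Mollifier

/-- The mollification of `ξ Ric[A]`, with the derivatives moved to the cut-off function and to the
mollifier. -/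
def molRicci (ρ ξ : Model n → ℝ) (A : Model n → Matrix (Fin n) (Fin n) ℝ) (ε : ℝ) (i j : Fin n)
    (y : Model n) : ℝ :=
  ∑ m, ((pd m (mol ρ ε fun z => ξ z * christoffel A m i j z) y -
      mol ρ ε (fun z => pd m ξ z * christoffel A m i j z) y) -
    (pd j (mol ρ ε fun z => ξ z * christoffel A m i m z) y -
      mol ρ ε (fun z => pd j ξ z * christoffel A m i m z) y)) +
    mol ρ ε (fun z => ξ z * ricciQuad A i j z) y

/-- Data for the local mollification lemma: a compactly supported Lipschitz matrix field,
nondegenerate on the support of the cut-off function `ξ`. -/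
structure LocalData (ξ : Model n → ℝ) (A : Model n → Matrix (Fin n) (Fin n) ℝ) : Prop where
  lip : ∀ i j, LipComp fun z => A z i j
  smooth : ContDiff ℝ ∞ ξ
  supp : HasCompactSupport ξ
  nondeg : ∀ y ∈ tsupport ξ, (A y).det ≠ 0

namespace LocalData

variable {ξ : Model n → ℝ} {A : Model n → Matrix (Fin n) (Fin n) ℝ}

lemma lipAt_inv (h : LocalData ξ A) {y : Model n} (hy : y ∈ tsupport ξ) (i j : Fin n) :
    LipAt (fun z => (A z)⁻¹ i j) y :=
  LipAt.inv_apply (fun i j => (h.lip i j).lipAt y) (h.nondeg y hy) i j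

/-- Where `A` may degenerate, the product vanishes identically near the point. -/
lemma lipComp_mul_inv (h : LocalData ξ A) {φ : Model n → ℝ} (hφ : ContDiff ℝ ∞ φ)
    (hs : tsupport φ ⊆ tsupport ξ) (i j : Fin n) : LipComp (fun z => φ z * (A z)⁻¹ i j) := by
  have hcs : HasCompactSupport φ := h.supp.of_isClosed_subset (isClosed_tsupport _) hs
  refine LipComp.of_lipAt (fun y => ?_) hcs.mul_right
  by_cases hy : y ∈ tsupport φ
  · exact (LipAt.of_contDiffAt hφ.contDiffAt).mul (h.lipAt_inv (hs hy) i j)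
  · refine (LipAt.const 0 y).congr ?_
    filter_upwards [notMem_tsupport_iff_eventuallyEq.1 hy] with z hz
    simp [hz]

lemma bddMeas_lowerChr (h : LocalData ξ A) (i j l : Fin n) : BddMeas (lowerChr A i j l) := by
  have h1 := (((h.lip j l).bddMeas_pd i).add ((h.lip i l).bddMeas_pd j)).add
    ((BddMeas.const (-1)).mul ((h.lip i j).bddMeas_pd l))
  have : lowerChr A i j l = fun y => pd i (fun z => A z j l) y + pd j (fun z => A z i l) y +
      (-1) * pd l (fun z => A z i j) y := by
    funext y; rw [lowerChr]; ring
  rw [this]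
  exact h1

lemma mul_christoffel_eq (φ : Model n → ℝ) (A : Model n → Matrix (Fin n) (Fin n) ℝ)
    (m i j : Fin n) (z : Model n) : φ z * christoffel A m i j z =
      (1 / 2 : ℝ) * ∑ l, (φ z * (A z)⁻¹ m l) * lowerChr A i j l z := by
  rw [christoffel_eq]
  simp only [Finset.mul_sum]
  exact Finset.sum_congr rfl fun l _ => by ring

lemma bddMeas_mul_christoffel (h : LocalData ξ A) {φ : Model n → ℝ} (hφ : ContDiff ℝ ∞ φ)
    (hs : tsupport φ ⊆ tsupport ξ) (m i j : Fin n) :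
    BddMeas (fun z => φ z * christoffel A m i j z) := by
  simp only [mul_christoffel_eq]
  exact (BddMeas.const _).mul (BddMeas.sum fun l _ =>
    (h.lipComp_mul_inv hφ hs m l).bddMeas.mul (h.bddMeas_lowerChr i j l))

lemma measurable_christoffel (h : LocalData ξ A) (m i j : Fin n) :
    Measurable (christoffel A m i j) :=
  measurable_const.mul (Finset.measurable_fun_sum _ fun l _ =>
    (measurable_inv_apply (fun i j => (h.lip i j).continuous.measurable) m l).mul
      (h.bddMeas_lowerChr i j l).measurable)

/-- `ricciQuad` is quadratic in the Christoffel symbols, while only one factor `ξ` is at hand; the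
indicator function bounds each of the two factors separately. -/
lemma bddMeas_indicator_christoffel (h : LocalData ξ A) (m i j : Fin n) :
    BddMeas ((tsupport ξ).indicator (christoffel A m i j)) := by
  refine ⟨(h.measurable_christoffel m i j).indicator (isClosed_tsupport ξ).measurableSet, ?_⟩
  have hI : ∀ l, ∃ C, ∀ y ∈ tsupport ξ, |(A y)⁻¹ m l| ≤ C := fun l => by
    obtain ⟨C, hC⟩ := h.supp.isCompact.exists_bound_of_continuousOn
      (f := fun y => (A y)⁻¹ m l) fun y hy => (h.lipAt_inv hy m l).continuousAt.continuousWithinAt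
    exact ⟨C, fun y hy => hC y hy⟩
  choose C hC using hI
  choose B hB using fun l => (h.bddMeas_lowerChr i j l).bound
  have hn : ∀ y, 0 ≤ |(1 / 2 : ℝ)| * ∑ l, |C l| * B l := fun y =>
    mul_nonneg (abs_nonneg _) (Finset.sum_nonneg fun l _ =>
      mul_nonneg (abs_nonneg _) ((abs_nonneg _).trans (hB l y)))
  refine ⟨|(1 / 2 : ℝ)| * ∑ l, |C l| * B l, fun y => ?_⟩
  by_cases hy : y ∈ tsupport ξ
  · rw [indicator_of_mem hy, christoffel_eq, abs_mul]
    refine mul_le_mul_of_nonneg_left ((Finset.abs_sum_le_sum_abs _ _).trans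
      (Finset.sum_le_sum fun l _ => ?_)) (abs_nonneg _)
    rw [abs_mul]
    exact mul_le_mul ((hC l y hy).trans (le_abs_self _)) (hB l y) (abs_nonneg _) (abs_nonneg _)
  · rw [indicator_of_notMem hy, abs_zero]
    exact hn y

lemma bddMeas_mul_ricciQuad (h : LocalData ξ A) (i j : Fin n) :
    BddMeas (fun z => ξ z * ricciQuad A i j z) := by
  have hΓ := h.bddMeas_indicator_christoffel
  have h1 := (LipComp.of_contDiff h.smooth h.supp).bddMeas.mul
    (BddMeas.sum (s := Finset.univ) fun m _ => BddMeas.sum (s := Finset.univ) fun k _ =>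
      ((hΓ m i j).mul (hΓ k k m)).add ((BddMeas.const (-1)).mul ((hΓ m i k).mul (hΓ k j m))))
  convert h1 using 2 with z
  by_cases hz : z ∈ tsupport ξ
  · simp only [indicator_of_mem hz, ricciQuad]
    congr 1
    exact Finset.sum_congr rfl fun m _ => Finset.sum_congr rfl fun k _ => by ring
  · simp [image_eq_zero_of_notMem_tsupport hz]

end LocalData

/-- The component-wise mollification of a matrix field. -/
def molM (ρ : Model n → ℝ) (ε : ℝ) (A : Model n → Matrix (Fin n) (Fin n) ℝ) (y : Model n) :
    Matrix (Fin n) (Fin n) ℝ := fun i j => mol ρ ε (fun z => A z i j) y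

namespace Mollifier

variable {ξ : Model n → ℝ} {A : Model n → Matrix (Fin n) (Fin n) ℝ}

/-- The lowered symbols are linear in the first derivatives, so they commute with mollification.
Thus the mollified bounded factor in the Friedrichs commutator is again formed from derivatives of
the mollified metric. -/
lemma lowerChr_molM (h : Mollifier ρ) (d : LocalData ξ A) {ε : ℝ} (hε : 0 < ε) (i j l : Fin n) :
    lowerChr (molM ρ ε A) i j l = mol ρ ε (lowerChr A i j l) := by
  funext y
  have h1 : lowerChr A i j l = fun y => (pd i (fun z => A z j l) y + pd j (fun z => A z i l) y) +
      (-1) * pd l (fun z => A z i j) y := by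
    funext y; rw [lowerChr]; ring
  rw [h1, h.mol_add hε (((d.lip j l).bddMeas_pd i).add ((d.lip i l).bddMeas_pd j))
    ((BddMeas.const _).mul ((d.lip i j).bddMeas_pd l)),
    h.mol_add hε ((d.lip j l).bddMeas_pd i) ((d.lip i l).bddMeas_pd j), mol_const_mul]
  change pd i (mol ρ ε fun z => A z j l) y + pd j (mol ρ ε fun z => A z i l) y -
    pd l (mol ρ ε fun z => A z i j) y = _
  rw [h.pd_mol' hε (d.lip j l), h.pd_mol' hε (d.lip i l), h.pd_mol' hε (d.lip i j)]
  ring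

/-- The Friedrichs commutator with the Lipschitz factor `ξ g^{ml}` and the bounded factor
`lowerChr`. In the limit, the contribution of `∂ₖξ` cancels against the mollification of `∂ₖξ Γ`
that is subtracted. -/
lemma conv_pd_mol_christoffel (h : Mollifier ρ) (d : LocalData ξ A) (k m i j : Fin n) :
    Conv univ (fun ε y => pd k (mol ρ ε fun z => ξ z * christoffel A m i j z) y -
        mol ρ ε (fun z => pd k ξ z * christoffel A m i j z) y -
        (1 / 2 : ℝ) * ∑ l, (ξ y * (A y)⁻¹ m l) * pd k (lowerChr (molM ρ ε A) i j l) y)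
      (fun y => ξ y * ((1 / 2 : ℝ) * ∑ l, pd k (fun z => (A z)⁻¹ m l) y * lowerChr A i j l y)) := by
  have hξk : ContDiff ℝ ∞ (pd k ξ) :=
    contDiff_iff_contDiffAt.2 fun _ => contDiffAt_pd d.smooth.contDiffAt k
  have ha : ∀ l, LipComp (fun z => ξ z * (A z)⁻¹ m l) := fun l =>
    d.lipComp_mul_inv d.smooth subset_rfl m l
  have hu := fun l => d.bddMeas_lowerChr i j l
  have c1 := (Conv.sum (s := Finset.univ) fun l _ =>
    h.conv_commutator' (ha l) (hu l) k univ).const_mul (1 / 2 : ℝ)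
  have c2 := h.conv_mol (d.bddMeas_mul_christoffel hξk (tsupport_pd_subset k ξ) m i j) univ
  refine ((c1.sub c2).congr_lim ?_).congr fun y _ => ?_
  · have hae : ∀ᵐ y, ∀ l, y ∈ tsupport ξ → DifferentiableAt ℝ (fun z => (A z)⁻¹ m l) y :=
      ae_all_iff.2 fun l => ae_differentiableAt_of_lipAt fun y hy => d.lipAt_inv hy m l
    filter_upwards [hae] with y hy _
    -- Outside the support of `ξ` the inverse matrix need not be differentiable, but both sides
    -- vanish there.
    have hp : ∀ l, pd k (fun z => ξ z * (A z)⁻¹ m l) y =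
        pd k ξ y * (A y)⁻¹ m l + ξ y * pd k (fun z => (A z)⁻¹ m l) y := by
      intro l
      by_cases hys : y ∈ tsupport ξ
      · rw [pd_mul d.smooth.contDiffAt.dif (hy l hys)]
      · have h0 := notMem_tsupport_iff_eventuallyEq.1 hys
        have h1 : pd k ξ y = 0 := by
          rw [pd_congr h0]; exact pd_const 0
        have h2 : (fun z => ξ z * (A z)⁻¹ m l) =ᶠ[𝓝 y] fun _ => 0 := by
          filter_upwards [h0] with z hz
          simp [hz]
        rw [pd_congr h2, pd_const, h1, h0.self_of_nhds]
        simp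
    simp only [hp, christoffel_eq, Finset.mul_sum]
    rw [← Finset.sum_sub_distrib]
    exact Finset.sum_congr rfl fun l _ => by ring
  · filter_upwards [eventually_pos_lz y] with p hp
    have hs : ∀ l, DifferentiableAt ℝ
        (mol ρ p.1 fun z => (ξ z * (A z)⁻¹ m l) * lowerChr A i j l z) p.2 := fun l =>
      (h.contDiff_mol hp ((ha l).bddMeas.mul (hu l)).locallyIntegrable).contDiffAt.dif
    have e1 : (mol ρ p.1 fun z => ξ z * christoffel A m i j z) = fun y => (1 / 2 : ℝ) *
        ∑ l, mol ρ p.1 (fun z => (ξ z * (A z)⁻¹ m l) * lowerChr A i j l z) y := by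
      funext y
      simp only [LocalData.mul_christoffel_eq]
      rw [mol_const_mul, h.mol_sum hp fun l _ => (ha l).bddMeas.mul (hu l)]
    rw [e1, pd_const_mul, pd_sum fun l _ => hs l]
    simp only [h.lowerChr_molM d hp, Finset.sum_sub_distrib, mul_sub]
    ring

lemma approx_molM (h : Mollifier ρ) (d : LocalData ξ A) (U : Set (Model n)) (i j : Fin n) :
    Approx U (fun ε z => molM ρ ε A z i j) (fun z => A z i j) := h.approx_mol' (d.lip i j) U

/-- The local form of the theorem: the mollification of `ξ Ric[A]` is close to `ξ` times the Ricci
tensor of the mollified metric. -/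
lemma negl_molRicci_sub (h : Mollifier ρ) (d : LocalData ξ A) {V : Set (Model n)} (hV : IsOpen V)
    (hd : ∀ y ∈ V, (A y).det ≠ 0) (i j : Fin n) :
    Negl V (fun ε y => molRicci ρ ξ A ε i j y - ξ y * ricciComp (molM ρ ε A) y i j) := by
  -- Here `c1` says that `molRicci` minus `ξ` times the second order part converges to `ξ lower A`,
  -- and `c2` that the Ricci tensor of the mollified metric minus the same second order part
  -- converges to `lower A`.
  have c1 := (Conv.sum (s := Finset.univ) fun m _ => (h.conv_pd_mol_christoffel d m m i j).sub
    (h.conv_pd_mol_christoffel d j m i m)).add (h.conv_mol (d.bddMeas_mul_ricciQuad i j) univ)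
  have c2 := conv_ricciComp hV (h.approx_molM d V) hd (fun i j => h.neglTwo_eps_mol (d.lip i j) V)
    i j
  have c3 : Conv V (fun _ => ξ) ξ :=
    Conv.of_continuousAt fun y _ => d.smooth.continuous.continuousAt
  refine (((c1.mono (subset_univ V)).sub (c3.mul c2)).congr_lim
    (Eventually.of_forall fun y _ => ?_)).congr fun y _ => ?_
  · rw [lower, mul_add, Finset.mul_sum]
    rw [sub_eq_zero]
    congr 1
    refine Finset.sum_congr rfl fun m _ => ?_
    simp only [Finset.sum_sub_distrib]
    ring
  · filter_upwards [eventually_pos_lz y] with p hp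
    have hsm : ∀ i j, ContDiffAt ℝ ∞ (fun w => molM ρ p.1 A w i j) p.2 := fun i j =>
      (h.contDiff_mol hp (d.lip i j).bddMeas.locallyIntegrable).contDiffAt
    have e1 : ξ p.2 * princ (A p.2)⁻¹ (sec (molM ρ p.1 A) p.2) i j =
        ∑ m, ((1 / 2 : ℝ) * ∑ l, (ξ p.2 * (A p.2)⁻¹ m l) *
          pd m (lowerChr (molM ρ p.1 A) i j l) p.2 -
          (1 / 2 : ℝ) * ∑ l, (ξ p.2 * (A p.2)⁻¹ m l) *
          pd j (lowerChr (molM ρ p.1 A) i m l) p.2) := by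
      rw [princ, Finset.mul_sum]
      refine Finset.sum_congr rfl fun m _ => ?_
      simp only [pd_lowerChr hsm, Finset.mul_sum]
      rw [← Finset.sum_sub_distrib]
      exact Finset.sum_congr rfl fun l _ => by ring
    rw [mul_sub, e1, molRicci]
    simp only [Finset.sum_sub_distrib]
    ring

lemma contDiff_molRicci (h : Mollifier ρ) (d : LocalData ξ A) {ε : ℝ} (hε : 0 < ε) (i j : Fin n) :
    ContDiff ℝ ∞ (molRicci ρ ξ A ε i j) := by
  have hξk : ∀ k, ContDiff ℝ ∞ (pd k ξ) := fun k =>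
    contDiff_iff_contDiffAt.2 fun _ => contDiffAt_pd d.smooth.contDiffAt k
  have h0 : ∀ m i j, ContDiff ℝ ∞ (mol ρ ε fun z => ξ z * christoffel A m i j z) := fun m i j =>
    h.contDiff_mol hε (d.bddMeas_mul_christoffel d.smooth subset_rfl m i j).locallyIntegrable
  have h1 : ∀ k m i j, ContDiff ℝ ∞ (mol ρ ε fun z => pd k ξ z * christoffel A m i j z) :=
    fun k m i j => h.contDiff_mol hε
      (d.bddMeas_mul_christoffel (hξk k) (tsupport_pd_subset k ξ) m i j).locallyIntegrable
  have h2 : ∀ k m i j, ContDiff ℝ ∞ (pd k (mol ρ ε fun z => ξ z * christoffel A m i j z)) :=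
    fun k m i j => contDiff_iff_contDiffAt.2 fun _ => contDiffAt_pd (h0 m i j).contDiffAt k
  exact (ContDiff.sum fun m _ => ((h2 m m i j).sub (h1 m m i j)).sub
    ((h2 j m i m).sub (h1 j m i m))).add
    (h.contDiff_mol hε (d.bddMeas_mul_ricciQuad i j).locallyIntegrable)

end Mollifier

end LocalRicci

/-! ### Tensor components in charts and coordinate changes -/

section ChartCalculus

variable {n : ℕ} {M : Type*} [TopologicalSpace M] [ChartedSpace (Model n) M]

/-- The coordinate change from the chart `ψ` to the chart `ψ'`. -/
def trans (ψ ψ' : Chart n M) (y : Model n) : Model n := ψ'.1 (ψ.1.symm y)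

/-- The domain of the coordinate change from `ψ` to `ψ'`. -/
def transDom (ψ ψ' : Chart n M) : Set (Model n) := ψ.1.target ∩ ψ.1.symm ⁻¹' ψ'.1.source

lemma isOpen_transDom (ψ ψ' : Chart n M) : IsOpen (transDom ψ ψ') :=
  ψ.1.isOpen_inter_preimage_symm ψ'.1.open_source

lemma symm_trans {ψ ψ' : Chart n M} {y : Model n} (hy : y ∈ transDom ψ ψ') :
    ψ'.1.symm (trans ψ ψ' y) = ψ.1.symm y := ψ'.1.left_inv hy.2

lemma mapsTo_trans (ψ ψ' : Chart n M) : MapsTo (trans ψ ψ') (transDom ψ ψ') (transDom ψ' ψ) :=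
  fun y hy => ⟨ψ'.1.map_source hy.2, by
    rw [mem_preimage, symm_trans hy]; exact ψ.1.map_target hy.1⟩

lemma contDiffOn_trans (ψ ψ' : Chart n M) : ContDiffOn ℝ ∞ (trans ψ ψ') (transDom ψ ψ') := by
  rw [← contMDiffOn_iff_contDiffOn]
  exact (contMDiffOn_of_mem_maximalAtlas ψ'.2).comp
    ((contMDiffOn_symm_of_mem_maximalAtlas ψ.2).mono inter_subset_left) fun y hy => hy.2

lemma coordChange_trans (ψ ψ' : Chart n M) :
    CoordChange (trans ψ ψ') (trans ψ' ψ) (transDom ψ ψ') (transDom ψ' ψ) where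
  isOpen_left := isOpen_transDom _ _
  isOpen_right := isOpen_transDom _ _
  smooth := contDiffOn_trans _ _
  smooth_inv := contDiffOn_trans _ _
  mapsTo := mapsTo_trans _ _
  left_inv y hy := by rw [trans, symm_trans hy, ψ.1.right_inv hy.1]

lemma CoordChange.jac_mul_jac {τ σ : Model n → Model n} {U V : Set (Model n)}
    (h : CoordChange τ σ U V) {y : Model n} (hy : y ∈ U) : jac σ (τ y) * jac τ y = 1 := by
  have h1 := (h.contDiffAt_inv (h.mapsTo hy)).differentiableAt (by simp : (∞ : WithTop ℕ∞) ≠ 0)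
  have h2 := (h.contDiffAt hy).differentiableAt (by simp : (∞ : WithTop ℕ∞) ≠ 0)
  have h3 : (σ ∘ τ) =ᶠ[𝓝 y] id := (h.isOpen_left.eventually_mem hy).mono h.left_inv
  have h4 : (fderiv ℝ σ (τ y)).comp (fderiv ℝ τ y) = ContinuousLinearMap.id ℝ (Model n) := by
    rw [← fderiv_comp y h1 h2, h3.fderiv_eq, fderiv_id]
  ext c i
  have h5 : fderiv ℝ σ (τ y) (fderiv ℝ τ y (e i)) = e i :=
    congrArg (fun L : Model n →L[ℝ] Model n => L (e i)) h4
  have h6 : fderiv ℝ σ (τ y) (fderiv ℝ τ y (e i)) =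
      ∑ a, (fderiv ℝ τ y (e i)) a • fderiv ℝ σ (τ y) (e a) := by
    conv_lhs => rw [← sum_smul_e (fderiv ℝ τ y (e i)), map_sum]
    simp
  rw [h6] at h5
  have h7 := congrArg (fun v : Model n => v c) h5
  simp only [WithLp.ofLp_sum, Finset.sum_apply, PiLp.smul_apply, smul_eq_mul] at h7
  rw [Matrix.mul_apply]
  refine (Finset.sum_congr rfl fun a _ => mul_comm _ _).trans (h7.trans ?_)
  simp [e, Matrix.one_apply]

lemma CoordChange.diffeoNear {τ σ : Model n → Model n} {U V : Set (Model n)}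
    (h : CoordChange τ σ U V) {y : Model n} (hy : y ∈ U) : DiffeoNear τ y := by
  refine ⟨(h.isOpen_left.eventually_mem hy).mono fun z hz => h.contDiffAt hz,
    (h.isOpen_left.eventually_mem hy).mono fun z hz h0 => ?_⟩
  have := congrArg Matrix.det (h.jac_mul_jac hz)
  rw [Matrix.det_mul, h0, mul_zero, Matrix.det_one] at this
  exact zero_ne_one this

lemma mdifferentiableAt_chart (ψ : Chart n M) {x : M} (hx : x ∈ ψ.1.source) :
    MDifferentiableAt 𝓘(ℝ, Model n) 𝓘(ℝ, Model n) ψ.1 x :=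
  ((contMDiffOn_of_mem_maximalAtlas ψ.2).contMDiffAt
    (ψ.1.open_source.mem_nhds hx)).mdifferentiableAt (by simp)

lemma mdifferentiableAt_chart_symm (ψ : Chart n M) {y : Model n} (hy : y ∈ ψ.1.target) :
    MDifferentiableAt 𝓘(ℝ, Model n) 𝓘(ℝ, Model n) ψ.1.symm y :=
  ((contMDiffOn_symm_of_mem_maximalAtlas ψ.2).contMDiffAt
    (ψ.1.open_target.mem_nhds hy)).mdifferentiableAt (by simp)

/-- The differential of the inverse of a chart, as a map of the model space. -/
def dsymm (ψ : Chart n M) (y : Model n) : Model n →L[ℝ] Model n :=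
  mfderiv 𝓘(ℝ, Model n) 𝓘(ℝ, Model n) ψ.1.symm y

/-- The differential of a chart, as a map of the model space. -/
def dchart (ψ : Chart n M) (x : M) : Model n →L[ℝ] Model n :=
  mfderiv 𝓘(ℝ, Model n) 𝓘(ℝ, Model n) ψ.1 x

lemma dchart_comp_dsymm {ψ ψ' : Chart n M} {y : Model n} (hy : y ∈ transDom ψ ψ') (v : Model n) :
    dchart ψ' (ψ.1.symm y) (dsymm ψ y v) = fderiv ℝ (trans ψ ψ') y v := by
  have h1 := mfderiv_comp y (mdifferentiableAt_chart ψ' hy.2) (mdifferentiableAt_chart_symm ψ hy.1)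
  have h2 : mfderiv 𝓘(ℝ, Model n) 𝓘(ℝ, Model n) (ψ'.1 ∘ ψ.1.symm) y = fderiv ℝ (trans ψ ψ') y :=
    mfderiv_eq_fderiv
  rw [← h2, h1]
  rfl

lemma dsymm_trans {ψ ψ' : Chart n M} {y : Model n} (hy : y ∈ transDom ψ ψ') (v : Model n) :
    dsymm ψ' (trans ψ ψ' y) (fderiv ℝ (trans ψ ψ') y v) = dsymm ψ y v := by
  have hy' := mapsTo_trans ψ ψ' hy
  have hd : MDifferentiableAt 𝓘(ℝ, Model n) 𝓘(ℝ, Model n) (trans ψ ψ') y :=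
    ((contDiffOn_trans ψ ψ').contDiffAt ((isOpen_transDom ψ ψ').mem_nhds hy)).differentiableAt
      (by simp) |>.mdifferentiableAt
  have h1 := mfderiv_comp y (mdifferentiableAt_chart_symm ψ' hy'.1) hd
  have h2 : (ψ'.1.symm ∘ trans ψ ψ') =ᶠ[𝓝 y] ψ.1.symm :=
    ((isOpen_transDom ψ ψ').eventually_mem hy).mono fun z hz => symm_trans hz
  have h3 := h2.mfderiv_eq (I := 𝓘(ℝ, Model n)) (I' := 𝓘(ℝ, Model n))
  have h4 : mfderiv 𝓘(ℝ, Model n) 𝓘(ℝ, Model n) (trans ψ ψ') y = fderiv ℝ (trans ψ ψ') y :=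
    mfderiv_eq_fderiv
  rw [h1] at h3
  have h5 := congrArg (fun L : Model n →L[ℝ] Model n => L v) h3
  rw [dsymm, dsymm, ← h4]
  exact h5

/-- A tensor field as a bilinear form on the model space. -/
def ev (T : TensorField n M) (x : M) : Model n →L[ℝ] Model n →L[ℝ] ℝ := T x

lemma comp_apply (T : TensorField n M) (ψ : Chart n M) (y : Model n) (i j : Fin n) :
    comp T ψ.1 y i j = ev T (ψ.1.symm y) (dsymm ψ y (e i)) (dsymm ψ y (e j)) := rfl

lemma ev_dsymm (T : TensorField n M) (ψ : Chart n M) (y v w : Model n) :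
    ev T (ψ.1.symm y) (dsymm ψ y v) (dsymm ψ y w) =
      ∑ a, ∑ b, v a * w b * comp T ψ.1 y a b := by
  conv_lhs => rw [← sum_smul_e v, ← sum_smul_e w]
  simp only [map_sum, map_smul, sum_apply, smul_apply, smul_eq_mul, comp_apply,
    Finset.mul_sum]
  rw [Finset.sum_comm]
  exact Finset.sum_congr rfl fun a _ => Finset.sum_congr rfl fun b _ => by ring

lemma ev_pull (ψ : Chart n M) (A : Model n → Matrix (Fin n) (Fin n) ℝ) (x : M) (v w : Model n) :
    ev (fun x => pull ψ.1 A x) x v w =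
      ∑ a, ∑ b, dchart ψ x v a * dchart ψ x w b * A (ψ.1 x) a b := by
  have h : ev (fun x => pull ψ.1 A x) x = ∑ i, ∑ j, A (ψ.1 x) i j •
      ((EuclideanSpace.proj i : Model n →L[ℝ] ℝ) ∘L dchart ψ x).smulRight
        ((EuclideanSpace.proj j : Model n →L[ℝ] ℝ) ∘L dchart ψ x) := rfl
  rw [h]
  simp only [sum_apply, smul_apply, ContinuousLinearMap.smulRight_apply,
    ContinuousLinearMap.comp_apply, smul_eq_mul]
  refine Finset.sum_congr rfl fun a _ => Finset.sum_congr rfl fun b _ => ?_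
  change A (ψ.1 x) a b * (dchart ψ x v a * dchart ψ x w b) = _
  ring

lemma comp_pull {ψ ψ' : Chart n M} (A : Model n → Matrix (Fin n) (Fin n) ℝ) {y : Model n}
    (hy : y ∈ transDom ψ ψ') :
    comp (fun x => pull ψ'.1 A x) ψ.1 y = pullM (trans ψ ψ') A y := by
  ext i j
  rw [comp_apply, ev_pull, dchart_comp_dsymm hy, dchart_comp_dsymm hy]
  rfl

lemma comp_eq_pullM (T : TensorField n M) {ψ ψ' : Chart n M} {y : Model n}
    (hy : y ∈ transDom ψ ψ') : comp T ψ.1 y = pullM (trans ψ ψ') (comp T ψ'.1) y := by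
  ext i j
  rw [comp_apply, ← dsymm_trans hy, ← dsymm_trans hy, ← symm_trans hy, ev_dsymm]
  rfl

lemma comp_congr {T T' : TensorField n M} {ψ : Chart n M} {y : Model n}
    (h : T (ψ.1.symm y) = T' (ψ.1.symm y)) : comp T ψ.1 y = comp T' ψ.1 y := by
  ext i j
  rw [comp_apply, comp_apply, ev, ev, h]

lemma comp_sub (T T' : TensorField n M) (ψ : Chart n M) (y : Model n) (i j : Fin n) :
    comp (fun x => T x - T' x) ψ.1 y i j = comp T ψ.1 y i j - comp T' ψ.1 y i j := rfl

lemma christoffel_congr {A B : Model n → Matrix (Fin n) (Fin n) ℝ} {y : Model n}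
    (h : A =ᶠ[𝓝 y] B) (m i j : Fin n) : christoffel A m i j y = christoffel B m i j y := by
  have h1 : ∀ i j, (fun z => A z i j) =ᶠ[𝓝 y] fun z => B z i j := fun i j =>
    h.mono fun z hz => by simp only [hz]
  simp only [christoffel, h.self_of_nhds, pd_congr (h1 _ _)]

lemma ricciQuad_congr {A B : Model n → Matrix (Fin n) (Fin n) ℝ} {y : Model n}
    (h : A =ᶠ[𝓝 y] B) (i j : Fin n) : ricciQuad A i j y = ricciQuad B i j y := by
  simp only [ricciQuad, christoffel_congr h]

lemma ricciComp_congr {A B : Model n → Matrix (Fin n) (Fin n) ℝ} {y : Model n}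
    (h : A =ᶠ[𝓝 y] B) : ricciComp A y = ricciComp B y := by
  have h1 : ∀ m i j, christoffel A m i j =ᶠ[𝓝 y] christoffel B m i j := fun m i j =>
    (eventually_eventually_nhds.2 h).mono fun z hz => christoffel_congr hz m i j
  ext i j
  simp only [ricciComp, pd_congr (h1 _ _ _), ricciQuad_congr h]

lemma MetricNear.congr {A B : Model n → Matrix (Fin n) (Fin n) ℝ} {y : Model n}
    (hA : MetricNear A y) (h : A =ᶠ[𝓝 y] B) : MetricNear B y := by
  refine ⟨?_, ?_, ?_⟩
  · filter_upwards [eventually_eventually_nhds.2 h, hA.smooth] with z hz h1 i j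
    exact (h1 i j).congr_of_eventuallyEq (hz.mono fun w hw => by simp only [hw])
  · filter_upwards [h, hA.symm] with z hz h1
    rwa [← hz]
  · filter_upwards [h, hA.nondeg] with z hz h1
    rwa [← hz]

lemma comp_eventuallyEq_pullM (T : TensorField n M) {ψ ψ' : Chart n M} {y : Model n}
    (hy : y ∈ transDom ψ ψ') : pullM (trans ψ ψ') (comp T ψ'.1) =ᶠ[𝓝 y] comp T ψ.1 :=
  ((isOpen_transDom ψ ψ').eventually_mem hy).mono fun _ hz => (comp_eq_pullM T hz).symm

/-- Components in the second chart are the pull-back of those in the first under the opposite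
coordinate change, so regularity passes from one chart to another. -/
lemma metricNear_comp_trans (T : TensorField n M) {ψ ψ' : Chart n M} {y : Model n}
    (hy : y ∈ transDom ψ ψ') (h : MetricNear (comp T ψ.1) y) :
    MetricNear (comp T ψ'.1) (trans ψ ψ' y) := by
  have hc := coordChange_trans ψ ψ'
  have hc' := coordChange_trans ψ' ψ
  have hy' := mapsTo_trans ψ ψ' hy
  refine (metricNear_pullM (hc'.diffeoNear hy') ?_).congr (comp_eventuallyEq_pullM T hy')
  rwa [hc.left_inv y hy]

variable [IsManifold 𝓘(ℝ, Model n) ∞ M]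

/-- The preferred chart at a point, as a chart of the maximal atlas. -/
def prefChart (x : M) : Chart n M :=
  ⟨chartAt (Model n) x, IsManifold.chart_mem_maximalAtlas x⟩

/-- In every chart the Ricci tensor of a smooth metric is given by the coordinate formula. -/
lemma comp_ricci (T : TensorField n M) {ψ : Chart n M} {y : Model n} (hy : y ∈ ψ.1.target)
    (h : MetricNear (comp T ψ.1) y) : comp (ricci T) ψ.1 y = ricciComp (comp T ψ.1) y := by
  let ψ' : Chart n M := prefChart (ψ.1.symm y)
  have hy' : y ∈ transDom ψ ψ' := ⟨hy, mem_chart_source (Model n) (ψ.1.symm y)⟩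
  have h1 : comp (ricci T) ψ.1 y =
      comp (fun x => pull ψ'.1 (ricciComp (comp T ψ'.1)) x) ψ.1 y := comp_congr rfl
  rw [h1, comp_pull _ hy', ← ricciComp_pullM ((coordChange_trans ψ ψ').diffeoNear hy')
    (metricNear_comp_trans T hy' h)]
  exact ricciComp_congr (comp_eventuallyEq_pullM T hy')

end ChartCalculus

/-! ### Openness and chart description of the Lorentzian condition -/

section Lorentz

variable {n : ℕ}

/-- The bilinear form of a matrix. -/
def mform (B : Matrix (Fin n) (Fin n) ℝ) (v w : Model n) : ℝ := ∑ a, ∑ b, v a * w b * B a b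

/-- Matrices of Lorentzian bilinear forms. -/
def IsLorentzMat (B : Matrix (Fin n) (Fin n) ℝ) : Prop :=
  (∀ i j, B i j = B j i) ∧ ∃ v, mform B v v < 0 ∧ ∀ w, w ≠ 0 → mform B v w = 0 → 0 < mform B w w

lemma mform_symm {B : Matrix (Fin n) (Fin n) ℝ} (h : ∀ i j, B i j = B j i) (v w : Model n) :
    mform B v w = mform B w v := by
  rw [mform, mform, Finset.sum_comm]
  exact Finset.sum_congr rfl fun a _ => Finset.sum_congr rfl fun b _ => by rw [h]; ring

lemma mform_eq_dot (B : Matrix (Fin n) (Fin n) ℝ) (v w : Model n) :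
    mform B v w = dotProduct v (B.mulVec w) := by
  simp only [mform, dotProduct, Matrix.mulVec, Finset.mul_sum]
  exact Finset.sum_congr rfl fun a _ => Finset.sum_congr rfl fun b _ => by ring

/-- A nonzero vector in the kernel is orthogonal to the timelike vector, so its square would have to
be positive, yet it is zero. -/
lemma IsLorentzMat.det_ne_zero {B : Matrix (Fin n) (Fin n) ℝ} (h : IsLorentzMat B) :
    B.det ≠ 0 := by
  intro h0
  obtain ⟨u, hu, hBu⟩ := Matrix.exists_mulVec_eq_zero_iff.2 h0
  obtain ⟨-, v, -, hv⟩ := h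
  have hz : ∀ w : Model n, mform B w (WithLp.toLp 2 u) = 0 := fun w => by
    rw [mform_eq_dot]
    simp [hBu]
  have := hv (WithLp.toLp 2 u) (fun h => hu (by simpa using h)) (hz v)
  rw [hz] at this
  exact lt_irrefl _ this

lemma continuous_mform : Continuous fun p : Matrix (Fin n) (Fin n) ℝ × Model n × Model n =>
    mform p.1 p.2.1 p.2.2 := by
  unfold mform
  fun_prop

lemma mform_smul (B : Matrix (Fin n) (Fin n) ℝ) (c : ℝ) (v w : Model n) :
    mform B v (c • w) = c * mform B v w := by
  simp only [mform, Finset.mul_sum, PiLp.smul_apply, smul_eq_mul]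
  exact Finset.sum_congr rfl fun a _ => Finset.sum_congr rfl fun b _ => by ring

lemma mform_smul_left (B : Matrix (Fin n) (Fin n) ℝ) (c : ℝ) (v w : Model n) :
    mform B (c • v) w = c * mform B v w := by
  simp only [mform, Finset.mul_sum, PiLp.smul_apply, smul_eq_mul]
  exact Finset.sum_congr rfl fun a _ => Finset.sum_congr rfl fun b _ => by ring

/-- Being Lorentzian is an open condition on symmetric matrices. -/
lemma IsLorentzMat.eventually {B : Matrix (Fin n) (Fin n) ℝ} (h : IsLorentzMat B) :
    ∀ᶠ C in 𝓝 B, (∀ i j, C i j = C j i) → IsLorentzMat C := by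
  obtain ⟨hs, v, hv, hw⟩ := h
  have c1 : Continuous fun C : Matrix (Fin n) (Fin n) ℝ => mform C v v :=
    continuous_mform.comp (by fun_prop : Continuous fun C : Matrix (Fin n) (Fin n) ℝ => (C, v, v))
  have c2 : Continuous fun p : Matrix (Fin n) (Fin n) ℝ × Model n => mform p.1 v p.2 :=
    continuous_mform.comp
      (by fun_prop : Continuous fun p : Matrix (Fin n) (Fin n) ℝ × Model n => (p.1, v, p.2))
  have c3 : Continuous fun p : Matrix (Fin n) (Fin n) ℝ × Model n => mform p.1 p.2 p.2 :=
    continuous_mform.comp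
      (by fun_prop : Continuous fun p : Matrix (Fin n) (Fin n) ℝ × Model n => (p.1, p.2, p.2))
  have h1 : ∀ᶠ C in 𝓝 B, mform C v v < 0 := c1.continuousAt.eventually_lt_const hv
  -- The timelike vector `v` is kept fixed. Positivity on its orthogonal complement, which varies
  -- with `C`, is rewritten as a disjunction of two open conditions; compactness of the unit sphere
  -- makes the neighbourhood uniform in `w`.
  have h2 : ∀ᶠ C in 𝓝 B, ∀ w ∈ Metric.sphere (0 : Model n) 1,
      mform C v w ≠ 0 ∨ 0 < mform C w w := by
    refine (isCompact_sphere (0 : Model n) 1).eventually_forall_of_forall_eventually fun w hws => ?_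
    have hw0 : w ≠ 0 := by
      rintro rfl
      simp at hws
    rcases eq_or_ne (mform B v w) 0 with h0 | h0
    · filter_upwards [c3.continuousAt.eventually_const_lt (hw w hw0 h0)] with p hp using Or.inr hp
    · filter_upwards [c2.continuousAt.eventually_ne (x := (B, w)) h0] with p hp using Or.inl hp
  filter_upwards [h1, h2] with C hC1 hC2 hCs
  refine ⟨hCs, v, hC1, fun w hw0 hvw => ?_⟩
  have hn : 0 < ‖w‖ := norm_pos_iff.2 hw0
  have := hC2 (‖w‖⁻¹ • w) (by simp [norm_smul, hn.ne'])
  rw [mform_smul, mform_smul, mform_smul_left, hvw] at this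
  rcases this with h | h
  · simp at h
  · by_contra hneg
    have : ‖w‖⁻¹ * (‖w‖⁻¹ * mform C w w) ≤ 0 :=
      mul_nonpos_of_nonneg_of_nonpos (inv_nonneg.2 hn.le)
        (mul_nonpos_of_nonneg_of_nonpos (inv_nonneg.2 hn.le) (not_lt.1 hneg))
    linarith

variable {M : Type*} [TopologicalSpace M] [ChartedSpace (Model n) M]

lemma dsymm_dchart {ψ : Chart n M} {y : Model n} (hy : y ∈ ψ.1.target) (v : Model n) :
    dsymm ψ y (dchart ψ (ψ.1.symm y) v) = v := by
  have hx := ψ.1.map_target hy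
  have hr : ψ.1 (ψ.1.symm y) = y := ψ.1.right_inv hy
  have h1 := mfderiv_comp (ψ.1.symm y) (f := ψ.1) (g := ψ.1.symm)
    (mdifferentiableAt_chart_symm ψ (by rw [hr]; exact hy)) (mdifferentiableAt_chart ψ hx)
  have h2 : (ψ.1.symm ∘ ψ.1) =ᶠ[𝓝 (ψ.1.symm y)] id :=
    (ψ.1.open_source.eventually_mem hx).mono fun z hz => ψ.1.left_inv hz
  have h3 := h2.mfderiv_eq (I := 𝓘(ℝ, Model n)) (I' := 𝓘(ℝ, Model n))
  rw [h1, mfderiv_id] at h3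
  have h5 := congrArg (fun L : Model n →L[ℝ] Model n => L v) h3
  have h6 : dsymm ψ (ψ.1 (ψ.1.symm y)) (dchart ψ (ψ.1.symm y) v) = v := h5
  rwa [hr] at h6

lemma dchart_dsymm {ψ : Chart n M} {y : Model n} (hy : y ∈ ψ.1.target) (v : Model n) :
    dchart ψ (ψ.1.symm y) (dsymm ψ y v) = v := by
  have hy' : y ∈ transDom ψ ψ := ⟨hy, ψ.1.map_target hy⟩
  rw [dchart_comp_dsymm hy']
  have : trans ψ ψ =ᶠ[𝓝 y] id :=
    ((isOpen_transDom ψ ψ).eventually_mem hy').mono fun z hz => ψ.1.right_inv hz.1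
  rw [this.fderiv_eq]
  simp

lemma isLorentzForm_iff_ev (T : TensorField n M) (x : M) : IsLorentzForm (T x) ↔
    (∀ v w : Model n, ev T x v w = ev T x w v) ∧ ∃ v : Model n, ev T x v v < 0 ∧
      ∀ w : Model n, w ≠ 0 → ev T x v w = 0 → 0 < ev T x w w := Iff.rfl

/-- The Lorentzian condition in a chart. -/
lemma isLorentzForm_iff (T : TensorField n M) {ψ : Chart n M} {y : Model n}
    (hy : y ∈ ψ.1.target) : IsLorentzForm (T (ψ.1.symm y)) ↔ IsLorentzMat (comp T ψ.1 y) := by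
  have hT : ∀ v w : Model n, ev T (ψ.1.symm y) (dsymm ψ y v) (dsymm ψ y w) =
      mform (comp T ψ.1 y) v w := fun v w => ev_dsymm T ψ y v w
  have hT' : ∀ v w : Model n, ev T (ψ.1.symm y) v w =
      mform (comp T ψ.1 y) (dchart ψ (ψ.1.symm y) v) (dchart ψ (ψ.1.symm y) w) := fun v w => by
    rw [← hT, dsymm_dchart hy, dsymm_dchart hy]
  rw [isLorentzForm_iff_ev]
  constructor
  · rintro ⟨h1, v, hv, hw⟩
    refine ⟨fun i j => h1 _ _, dchart ψ (ψ.1.symm y) v, ?_, fun w hw0 hvw => ?_⟩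
    · rwa [← hT']
    · rw [← hT]
      refine hw (dsymm ψ y w) (fun h0 => hw0 ?_) ?_
      · rw [← dchart_dsymm hy w, h0, map_zero]
      · rw [hT', dchart_dsymm hy, hvw]
  · rintro ⟨h1, v, hv, hw⟩
    refine ⟨fun v w => ?_, dsymm ψ y v, ?_, fun w hw0 hvw => ?_⟩
    · rw [hT', hT', mform_symm h1]
    · rwa [hT]
    · rw [hT']
      refine hw (dchart ψ (ψ.1.symm y) w) (fun h0 => hw0 ?_) ?_
      · rw [← dsymm_dchart hy w, h0, map_zero]
      · rwa [← hT, dsymm_dchart hy]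

end Lorentz

/-! ### Cut-off functions and regular distributions -/

section Cutoff

variable {n : ℕ} {φ ξ f : Model n → ℝ} {A : Model n → Matrix (Fin n) (Fin n) ℝ}
  {Ω : Set (Model n)}

lemma LipComp.cutoff (hφ : ContDiff ℝ ∞ φ) (hs : HasCompactSupport φ) (hsub : tsupport φ ⊆ Ω)
    (hf : ∀ y ∈ Ω, LipAt f y) : LipComp (fun z => φ z * f z) := by
  refine LipComp.of_lipAt (fun y => ?_) hs.mul_right
  by_cases hy : y ∈ tsupport φ
  · exact (LipAt.of_contDiffAt hφ.contDiffAt).mul (hf y (hsub hy))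
  · refine (LipAt.const 0 y).congr ?_
    filter_upwards [notMem_tsupport_iff_eventuallyEq.1 hy] with z hz
    simp [hz]

/-- A smooth function `φ` with compact support in `Ω` that equals one near the support of `ξ`. -/
structure IsCutoff (Ω : Set (Model n)) (φ ξ : Model n → ℝ) : Prop where
  smooth : ContDiff ℝ ∞ φ
  compact : HasCompactSupport φ
  subset : tsupport φ ⊆ Ω
  smooth' : ContDiff ℝ ∞ ξ
  compact' : HasCompactSupport ξ
  eq_one : ∀ y ∈ tsupport ξ, ∀ᶠ z in 𝓝 y, φ z = 1

namespace IsCutoff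

lemma mem_of_ne_zero (h : IsCutoff Ω φ ξ) {y : Model n} (hy : φ y ≠ 0) : y ∈ Ω :=
  h.subset (subset_tsupport φ hy)

lemma eventuallyEq (h : IsCutoff Ω φ ξ) {y : Model n} (hy : y ∈ tsupport ξ) :
    (fun z => φ z • A z) =ᶠ[𝓝 y] A :=
  (h.eq_one y hy).mono fun z hz => by simp only [hz, one_smul]

/-- Cutting off replaces a matrix field controlled only on `Ω` by a compactly supported Lipschitz
field on the whole space that has the same germs along the support of `ξ`. -/
lemma localData (h : IsCutoff Ω φ ξ) (hA : ∀ y ∈ Ω, ∀ i j, LipAt (fun z => A z i j) y)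
    (hd : ∀ y ∈ Ω, (A y).det ≠ 0) : LocalData ξ (fun z => φ z • A z) where
  lip i j := LipComp.cutoff h.smooth h.compact h.subset fun y hy => hA y hy i j
  smooth := h.smooth'
  supp := h.compact'
  nondeg y hy := by
    have h1 := (h.eq_one y hy).self_of_nhds
    simp only [h1, one_smul]
    exact hd y (h.mem_of_ne_zero (by rw [h1]; exact one_ne_zero))

lemma mul_christoffel (h : IsCutoff Ω φ ξ) {η : Model n → ℝ} (hη : tsupport η ⊆ tsupport ξ)
    (m i j : Fin n) (z : Model n) :
    η z * christoffel (fun z => φ z • A z) m i j z = η z * christoffel A m i j z := by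
  by_cases hz : z ∈ tsupport η
  · rw [christoffel_congr (h.eventuallyEq (hη hz))]
  · simp [image_eq_zero_of_notMem_tsupport hz]

lemma mul_ricciQuad (h : IsCutoff Ω φ ξ) (i j : Fin n) (z : Model n) :
    ξ z * ricciQuad (fun z => φ z • A z) i j z = ξ z * ricciQuad A i j z := by
  by_cases hz : z ∈ tsupport ξ
  · rw [ricciQuad_congr (h.eventuallyEq hz)]
  · simp [image_eq_zero_of_notMem_tsupport hz]

lemma mul_apply (h : IsCutoff Ω φ ξ) (i j : Fin n) (z : Model n) :
    ξ z * (φ z • A z) i j = ξ z * A z i j := by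
  by_cases hz : z ∈ tsupport ξ
  · have h1 := (h.eq_one z hz).self_of_nhds
    rw [h1, one_smul]
  · simp [image_eq_zero_of_notMem_tsupport hz]

end IsCutoff

lemma exists_isCutoff (hΩ : IsOpen Ω) {y : Model n} (hy : y ∈ Ω) :
    ∃ φ ξ : Model n → ℝ, IsCutoff Ω φ ξ ∧ ∀ᶠ z in 𝓝 y, ξ z = 1 := by
  obtain ⟨r, hr, hsub⟩ := Metric.nhds_basis_closedBall.mem_iff.1 (hΩ.mem_nhds hy)
  -- The radii are arranged so that `φ` equals one on the closed ball of radius `r / 2`, whose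
  -- interior contains the support of `ξ`, the closed ball of radius `r / 4`.
  let φ : ContDiffBump y := ⟨r / 2, r, by positivity, by linarith⟩
  let ξ : ContDiffBump y := ⟨r / 8, r / 4, by positivity, by linarith⟩
  refine ⟨φ, ξ, ⟨φ.contDiff, φ.hasCompactSupport, ?_, ξ.contDiff, ξ.hasCompactSupport, ?_⟩,
    ξ.eventuallyEq_one⟩
  · rw [φ.tsupport_eq]
    exact hsub
  · intro z hz
    rw [ξ.tsupport_eq] at hz
    have hz' : z ∈ Metric.ball y (r / 2) :=
      Metric.closedBall_subset_ball (by change r / 4 < r / 2; linarith) hz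
    filter_upwards [Metric.isOpen_ball.mem_nhds hz'] with w hw
    exact φ.one_of_mem_closedBall (Metric.ball_subset_closedBall hw)

lemma locallyIntegrableOn_of_bddMeas {f : Model n → ℝ}
    (h : ∀ y ∈ Ω, ∃ u : Model n → ℝ, BddMeas u ∧ ∀ᶠ z in 𝓝 y, u z = f z) :
    LocallyIntegrableOn f Ω := by
  intro y hy
  obtain ⟨u, hu, he⟩ := h y hy
  obtain ⟨s, hs, hi⟩ := hu.locallyIntegrable y
  refine IntegrableAtFilter.filter_mono nhdsWithin_le_nhds ?_
  obtain ⟨t, htsub, hto, hyt⟩ := mem_nhds_iff.1 (inter_mem hs he)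
  refine ⟨t, hto.mem_nhds hyt, ?_⟩
  exact (hi.mono_set fun z hz => (htsub hz).1).congr_fun (fun z hz => (htsub hz).2)
    hto.measurableSet

/-- Local integrability is what `regular_apply` requires in order to evaluate the regular
distribution of the Christoffel symbol as an integral. -/
lemma locallyIntegrableOn_christoffel (hΩ : IsOpen Ω)
    (hA : ∀ y ∈ Ω, ∀ i j, LipAt (fun z => A z i j) y) (hd : ∀ y ∈ Ω, (A y).det ≠ 0)
    (m i j : Fin n) : LocallyIntegrableOn (christoffel A m i j) Ω := by
  refine locallyIntegrableOn_of_bddMeas fun y hy => ?_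
  obtain ⟨φ, ξ, h, h1⟩ := exists_isCutoff hΩ hy
  refine ⟨_, (h.localData hA hd).bddMeas_mul_christoffel h.smooth' subset_rfl m i j,
    h1.mono fun z hz => ?_⟩
  rw [h.mul_christoffel subset_rfl, hz, one_mul]

lemma locallyIntegrableOn_ricciQuad (hΩ : IsOpen Ω)
    (hA : ∀ y ∈ Ω, ∀ i j, LipAt (fun z => A z i j) y) (hd : ∀ y ∈ Ω, (A y).det ≠ 0)
    (i j : Fin n) : LocallyIntegrableOn (ricciQuad A i j) Ω := by
  refine locallyIntegrableOn_of_bddMeas fun y hy => ?_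
  obtain ⟨φ, ξ, h, h1⟩ := exists_isCutoff hΩ hy
  refine ⟨_, (h.localData hA hd).bddMeas_mul_ricciQuad i j, h1.mono fun z hz => ?_⟩
  rw [h.mul_ricciQuad, hz, one_mul]

lemma regular_apply {Ω : Opens (Model n)} {f : Model n → ℝ}
    (hf : LocallyIntegrableOn f Ω) (φ : 𝓓(Ω, ℝ)) : regular Ω f φ = ∫ z, φ z * f z :=
  TestFunction.integralAgainstBilinCLM_eq_integral hf

lemma lineDeriv_regular_apply {Ω : Opens (Model n)} {f : Model n → ℝ}
    (hf : LocallyIntegrableOn f Ω) (m : Fin n) (φ : 𝓓(Ω, ℝ)) :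
    (∂_{(e m : Model n)} (regular Ω f)) φ = - ∫ z, pd m φ z * f z := by
  rw [Distribution.lineDerivOp_apply_apply, map_neg, regular_apply hf]
  rfl

end Cutoff

/-! ### The test functions of the manifold convolution in a chart -/

namespace MollifierData

variable {n : ℕ} {M : Type*} [TopologicalSpace M] [ChartedSpace (Model n) M]
  (D : MollifierData n M) (α : ℕ)

lemma mollifier : Mollifier D.ρ where
  smooth := D.ρ_smooth
  supp z hz := by
    by_contra h
    have := D.ρ_supp (subset_tsupport _ h)
    rw [mem_ball_zero_iff] at this
    linarith
  integral := D.ρ_integral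

/-- The function `χ_α ∘ ψ_α⁻¹`, extended by zero to `ℝⁿ`. -/
def locχ : Model n → ℝ := (D.ψ α).1.target.indicator (fun z => D.χ α ((D.ψ α).1.symm z))

lemma isCompact_image_χ : IsCompact ((D.ψ α).1 '' tsupport (D.χ α)) :=
  ((D.relCompact α).of_isClosed_subset (isClosed_tsupport _)
    ((D.χ_supp α).trans subset_closure)).image_of_continuousOn
    ((D.ψ α).1.continuousOn.mono (D.χ_supp α))

lemma image_χ_subset : (D.ψ α).1 '' tsupport (D.χ α) ⊆ (D.ψ α).1.target := by
  rintro _ ⟨x, hx, rfl⟩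
  exact (D.ψ α).1.map_source (D.χ_supp α hx)

lemma locχ_eq_zero (z : Model n) (hz : z ∉ (D.ψ α).1 '' tsupport (D.χ α)) : D.locχ α z = 0 := by
  by_cases h : z ∈ (D.ψ α).1.target
  · rw [locχ, indicator_of_mem h]
    by_contra h0
    exact hz ⟨_, subset_tsupport _ h0, (D.ψ α).1.right_inv h⟩
  · rw [locχ, indicator_of_notMem h]

lemma tsupport_locχ_subset : tsupport (D.locχ α) ⊆ (D.ψ α).1 '' tsupport (D.χ α) :=
  closure_minimal (fun z hz => by by_contra h; exact hz (D.locχ_eq_zero α z h))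
    (D.isCompact_image_χ α).isClosed

lemma contDiff_locχ : ContDiff ℝ ∞ (D.locχ α) := by
  rw [contDiff_iff_contDiffAt]
  intro z
  by_cases hz : z ∈ (D.ψ α).1.target
  · have h1 : ContMDiffOn 𝓘(ℝ, Model n) 𝓘(ℝ, ℝ) ∞ (fun z => D.χ α ((D.ψ α).1.symm z))
        (D.ψ α).1.target :=
      (D.χ_smooth α).comp_contMDiffOn (contMDiffOn_symm_of_mem_maximalAtlas (D.ψ α).2)
    refine ((contMDiffOn_iff_contDiffOn.1 h1).contDiffAt
      ((D.ψ α).1.open_target.mem_nhds hz)).congr_of_eventuallyEq ?_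
    filter_upwards [(D.ψ α).1.open_target.mem_nhds hz] with w hw
    rw [locχ, indicator_of_mem hw]
  · have hz' : z ∉ (D.ψ α).1 '' tsupport (D.χ α) := fun h => hz (D.image_χ_subset α h)
    refine (contDiffAt_const (c := (0 : ℝ))).congr_of_eventuallyEq ?_
    filter_upwards [(D.isCompact_image_χ α).isClosed.isOpen_compl.mem_nhds hz'] with w hw
    exact D.locχ_eq_zero α w hw

/-- Since `χ_α` is one near the support of `ξ_α`, a tensor field may be multiplied by `χ_α` before
`ξ_α T` is mollified without changing the result. -/
lemma isCutoff : IsCutoff (D.ψ α).1.target (D.locχ α) (D.locξ α) where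
  smooth := D.contDiff_locχ α
  compact := (D.isCompact_image_χ α).of_isClosed_subset (isClosed_tsupport _)
    (D.tsupport_locχ_subset α)
  subset := (D.tsupport_locχ_subset α).trans (D.image_χ_subset α)
  smooth' := D.contDiff_locξ α
  compact' := (D.isCompact_image α).of_isClosed_subset (isClosed_tsupport _)
    (D.tsupport_locξ_subset α)
  eq_one y hy := by
    obtain ⟨x, hx, rfl⟩ := D.tsupport_locξ_subset α hy
    have hxs := D.ξ_subordinate α hx
    have hyt := (D.ψ α).1.map_source hxs
    have h1 : Tendsto (D.ψ α).1.symm (𝓝 ((D.ψ α).1 x)) (𝓝 x) := by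
      have := (D.ψ α).1.continuousAt_symm hyt
      rwa [ContinuousAt, (D.ψ α).1.left_inv hxs] at this
    filter_upwards [h1.eventually (D.χ_one α x hx), (D.ψ α).1.open_target.mem_nhds hyt] with z hz ht
    rw [locχ, indicator_of_mem ht, hz]

lemma regular_kernel {f : Model n → ℝ} (hf : LocallyIntegrableOn f (D.ψ α).1.target) (ε : ℝ)
    (y : Model n) : regular (targetOpens (D.ψ α)) f (D.kernel α ε y) =
      mol D.ρ ε (fun z => D.locξ α z * f z) y := by
  rw [regular_apply hf, mol]
  refine integral_congr_ae (Eventually.of_forall fun z => ?_)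
  change D.locξ α z * ((ε ^ n)⁻¹ * D.ρ (ε⁻¹ • (y - z))) * f z = _
  ring

lemma pd_kernel (ε : ℝ) (m : Fin n) (y z : Model n) : pd m (D.kernel α ε y) z =
    pd m (D.locξ α) z * ((ε ^ n)⁻¹ * D.ρ (ε⁻¹ • (y - z))) -
      D.locξ α z * (ε⁻¹ * ((ε ^ n)⁻¹ * pd m D.ρ (ε⁻¹ • (y - z)))) := by
  have h1 : DifferentiableAt ℝ (D.locξ α) z := (D.contDiff_locξ α).differentiable (by simp) z
  have h2 : DifferentiableAt ℝ (Mollifier.scaled D.ρ ε) (y - z) :=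
    (D.mollifier.contDiff_scaled ε).differentiable (by simp) _
  have h3 : HasFDerivAt (fun z => Mollifier.scaled D.ρ ε (y - z))
      ((fderiv ℝ (Mollifier.scaled D.ρ ε) (y - z)).comp
        (-ContinuousLinearMap.id ℝ (Model n))) z :=
    h2.hasFDerivAt.comp z ((hasFDerivAt_id z).const_sub y)
  have h4 : pd m (fun z => Mollifier.scaled D.ρ ε (y - z)) z =
      - (ε⁻¹ * ((ε ^ n)⁻¹ * pd m D.ρ (ε⁻¹ • (y - z)))) := by
    rw [pd, h3.fderiv]
    have := D.mollifier.pd_scaled ε m (y - z)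
    rw [pd, Mollifier.scaled] at this
    simp [this]
  have h5 : pd m (fun z => D.locξ α z * Mollifier.scaled D.ρ ε (y - z)) z = _ :=
    pd_mul h1 h3.differentiableAt
  change pd m (fun z => D.locξ α z * Mollifier.scaled D.ρ ε (y - z)) z = _
  rw [h5, h4, Mollifier.scaled]
  ring

/-- The test function is `ξ(z) ρ_ε(y - z)`. A derivative in `z` on the second factor is minus the
derivative in `y` and leaves the integral; the derivative on `ξ` gives the remaining term. -/
lemma lineDeriv_regular_kernel {f : Model n → ℝ} (hf : LocallyIntegrableOn f (D.ψ α).1.target)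
    (m : Fin n) (h0 : BddMeas fun z => D.locξ α z * f z)
    (h1 : BddMeas fun z => pd m (D.locξ α) z * f z) {ε : ℝ} (hε : 0 < ε) (y : Model n) :
    (∂_{(e m : Model n)} (regular (targetOpens (D.ψ α)) f)) (D.kernel α ε y) =
      pd m (mol D.ρ ε fun z => D.locξ α z * f z) y -
        mol D.ρ ε (fun z => pd m (D.locξ α) z * f z) y := by
  rw [lineDeriv_regular_apply hf, D.mollifier.pd_mol hε h0.locallyIntegrable, mol, mol,
    ← integral_const_mul, ← integral_sub, ← integral_neg]
  · refine integral_congr_ae (Eventually.of_forall fun z => ?_)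
    simp only [pd_kernel]
    ring
  · obtain ⟨C, hC⟩ := h0.bound
    have h2 : Integrable (fun z => (ε ^ n)⁻¹ * pd m D.ρ (ε⁻¹ • (y - z))) :=
      (((D.mollifier.ker_pd m).integrable.comp_smul (inv_ne_zero hε.ne')).const_mul
        _).comp_sub_left y
    exact (h2.bdd_mul (c := C) h0.measurable.aestronglyMeasurable
      (Eventually.of_forall hC)).const_mul _
  · exact D.mollifier.integrable_mul_scaled hε h1 y

end MollifierData

/-! ### The mollified metric and Ricci tensor in the charts of the cover -/

section Metric

variable {n : ℕ} {M : Type*} [TopologicalSpace M] [ChartedSpace (Model n) M]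
  (g : LipschitzLorentzMetric n M) (D : MollifierData n M) (α : ℕ)

lemma LipschitzLorentzMetric.lipAt (ψ : Chart n M) {y : Model n} (hy : y ∈ ψ.1.target)
    (i j : Fin n) : LipAt (fun z => comp g.toField ψ.1 z i j) y :=
  lipAt_of_locallyLipschitzOn ψ.1.open_target (g.lipschitz ψ i j) hy

lemma LipschitzLorentzMetric.isLorentzMat (ψ : Chart n M) {y : Model n} (hy : y ∈ ψ.1.target) :
    IsLorentzMat (comp g.toField ψ.1 y) := (isLorentzForm_iff _ hy).1 (g.lorentz _)

/-- The metric in the chart `ψ_α`, cut off by `χ_α`. -/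
def locMetric : Model n → Matrix (Fin n) (Fin n) ℝ :=
  fun z => D.locχ α z • comp g.toField (D.ψ α).1 z

lemma localData_locMetric : LocalData (D.locξ α) (locMetric g D α) :=
  (D.isCutoff α).localData (fun _ hy => g.lipAt (D.ψ α) hy)
    fun _ hy => (g.isLorentzMat (D.ψ α) hy).det_ne_zero

lemma localConv_toDist (ε : ℝ) (y : Model n) (i j : Fin n) :
    D.localConv ε (toDist g.toField) α y i j =
      mol D.ρ ε (fun z => D.locξ α z * locMetric g D α z i j) y := by
  have hf : LocallyIntegrableOn (fun z => comp g.toField (D.ψ α).1 z i j) (D.ψ α).1.target :=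
    ContinuousOn.locallyIntegrableOn (fun y hy =>
      (g.lipAt (D.ψ α) hy i j).continuousAt.continuousWithinAt)
      (D.ψ α).1.open_target.measurableSet
  simp only [locMetric, (D.isCutoff α).mul_apply]
  exact D.regular_kernel α hf ε y

/-- This evaluates the distributional Ricci tensor on the test functions: from here on only
integrals of bounded measurable functions occur. -/
lemma localConv_distRicci {ε : ℝ} (hε : 0 < ε) (y : Model n) (i j : Fin n) :
    D.localConv ε (distRicci g.toField) α y i j =
      molRicci D.ρ (D.locξ α) (locMetric g D α) ε i j y := by
  have hA := fun y hy => g.lipAt (D.ψ α) (y := y) hy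
  have hd := fun y hy => (g.isLorentzMat (D.ψ α) (y := y) hy).det_ne_zero
  have hc := D.isCutoff α
  have d := localData_locMetric g D α
  have hξk : ∀ k, ContDiff ℝ ∞ (pd k (D.locξ α)) := fun k =>
    contDiff_iff_contDiffAt.2 fun _ => contDiffAt_pd d.smooth.contDiffAt k
  have q0 : ∀ m i j z, D.locξ α z * christoffel (locMetric g D α) m i j z =
      D.locξ α z * christoffel (comp g.toField (D.ψ α).1) m i j z :=
    hc.mul_christoffel subset_rfl
  have q1 : ∀ k m i j z, pd k (D.locξ α) z * christoffel (locMetric g D α) m i j z =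
      pd k (D.locξ α) z * christoffel (comp g.toField (D.ψ α).1) m i j z := fun k =>
    hc.mul_christoffel (Mollifier.tsupport_pd_subset k _)
  have q2 : ∀ i j z, D.locξ α z * ricciQuad (locMetric g D α) i j z =
      D.locξ α z * ricciQuad (comp g.toField (D.ψ α).1) i j z := hc.mul_ricciQuad
  have e1 : ∀ k m i j, (∂_{(e k : Model n)} (regular (targetOpens (D.ψ α))
      (christoffel (comp g.toField (D.ψ α).1) m i j))) (D.kernel α ε y) =
      pd k (mol D.ρ ε fun z => D.locξ α z * christoffel (locMetric g D α) m i j z) y -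
        mol D.ρ ε (fun z => pd k (D.locξ α) z * christoffel (locMetric g D α) m i j z) y := by
    intro k m i j
    have b0 := d.bddMeas_mul_christoffel d.smooth subset_rfl m i j
    have b1 := d.bddMeas_mul_christoffel (hξk k) (Mollifier.tsupport_pd_subset k _) m i j
    simp only [q0, q1] at b0 b1 ⊢
    exact D.lineDeriv_regular_kernel α (locallyIntegrableOn_christoffel (D.ψ α).1.open_target
      hA hd m i j) k b0 b1 hε y
  have e2 : regular (targetOpens (D.ψ α)) (ricciQuad (comp g.toField (D.ψ α).1) i j)
      (D.kernel α ε y) =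
      mol D.ρ ε (fun z => D.locξ α z * ricciQuad (locMetric g D α) i j z) y := by
    simp only [q2]
    exact D.regular_kernel α (locallyIntegrableOn_ricciQuad (D.ψ α).1.open_target hA hd i j) ε y
  rw [molRicci, ← e2]
  simp only [← e1]
  rw [MollifierData.localConv, distRicci, distRicciComp]
  simp [Finset.sum_add_distrib]

end Metric

/-! ### Pull-back of families of matrix fields -/

section PullBack

variable {n : ℕ} {τ σ : Model n → Model n} {U V : Set (Model n)}
  {A : ℝ → Model n → Matrix (Fin n) (Fin n) ℝ} {A₀ : Model n → Matrix (Fin n) (Fin n) ℝ}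

lemma CoordChange.contDiffAt_jac_mul_jac (h : CoordChange τ σ U V) (a b i j : Fin n) :
    ∀ y ∈ U, ContDiffAt ℝ ∞ (fun z => jac τ z a i * jac τ z b j) y := fun _ hy =>
  (contDiffAt_jac (h.contDiffAt hy) a i).mul (contDiffAt_jac (h.contDiffAt hy) b j)

lemma CoordChange.bdd_jac_mul_jac (h : CoordChange τ σ U V) (a b i j : Fin n) :
    Bdd U (fun _ z => jac τ z a i * jac τ z b j) :=
  Bdd.of_continuousAt fun y hy => (h.contDiffAt_jac_mul_jac a b i j y hy).continuousAt

lemma CoordChange.approx_pullM (h : CoordChange τ σ U V)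
    (hA : ∀ i j, Approx V (fun ε z => A ε z i j) (fun z => A₀ z i j)) (i j : Fin n) :
    Approx U (fun ε z => pullM τ (A ε) z i j) (fun z => pullM τ A₀ z i j) :=
  Approx.sum h.isOpen_left fun a _ => Approx.sum h.isOpen_left fun b _ =>
    (Approx.of_smooth h.isOpen_left (h.contDiffAt_jac_mul_jac a b i j)).mul ((hA a b).comp_map h)

lemma CoordChange.neglTwo_pullM (h : CoordChange τ σ U V)
    (hA : ∀ i j, NeglTwo V (fun ε z => A ε z i j)) (i j : Fin n) :
    NeglTwo U (fun ε z => pullM τ (A ε) z i j) :=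
  NeglTwo.sum fun a _ => NeglTwo.sum fun b _ =>
    ((hA a b).comp_map h).smooth_mul h.isOpen_left (h.contDiffAt_jac_mul_jac a b i j)

lemma CoordChange.negl_pullM (h : CoordChange τ σ U V)
    (hA : ∀ i j, Negl V (fun ε z => A ε z i j)) (i j : Fin n) :
    Negl U (fun ε z => pullM τ (A ε) z i j) :=
  Negl.sum fun a _ => Negl.sum fun b _ =>
    Negl.bdd_mul (h.bdd_jac_mul_jac a b i j) ((hA a b).comp_map h)

lemma BigOEps.sum {ι : Type*} {s : Finset ι} {f : ι → ℝ → Model n → ℝ}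
    (hf : ∀ i ∈ s, BigOEps U (f i)) : BigOEps U (fun ε y => ∑ i ∈ s, f i ε y) :=
  fun y hy => Asymptotics.IsBigO.fun_sum fun i hi => hf i hi y hy

lemma CoordChange.bigOEps_pullM (h : CoordChange τ σ U V)
    (hA : ∀ i j, BigOEps V (fun ε z => A ε z i j)) (i j : Fin n) :
    BigOEps U (fun ε z => pullM τ (A ε) z i j) :=
  BigOEps.sum fun a _ => BigOEps.sum fun b _ =>
    (((hA a b).comp_map h).mul_bdd (h.bdd_jac_mul_jac a b i j)).congr
      fun _ _ => Eventually.of_forall fun _ => mul_comm _ _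

lemma pullM_const_mul_add (c : ℝ) {B C E : Model n → Matrix (Fin n) (Fin n) ℝ} {y : Model n}
    (h : ∀ i j, E (τ y) i j = c * B (τ y) i j + C (τ y) i j) (i j : Fin n) :
    pullM τ E y i j = c * pullM τ B y i j + pullM τ C y i j := by
  simp only [pullM, h, Finset.mul_sum, ← Finset.sum_add_distrib]
  exact Finset.sum_congr rfl fun a _ => Finset.sum_congr rfl fun b _ => by ring

lemma pullM_symm {B : Model n → Matrix (Fin n) (Fin n) ℝ} {y : Model n}
    (h : ∀ i j, B (τ y) i j = B (τ y) j i) (i j : Fin n) :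
    pullM τ B y i j = pullM τ B y j i := by
  simp only [pullM]
  rw [Finset.sum_comm]
  refine Finset.sum_congr rfl fun a _ => Finset.sum_congr rfl fun b _ => ?_
  rw [h b a]
  ring

lemma contDiffAt_pullM {B : Model n → Matrix (Fin n) (Fin n) ℝ} {y : Model n}
    (hτ : ContDiffAt ℝ ∞ τ y) (hB : ∀ i j, ContDiffAt ℝ ∞ (fun z => B z i j) (τ y))
    (i j : Fin n) : ContDiffAt ℝ ∞ (fun z => pullM τ B z i j) y :=
  ContDiffAt.sum fun a _ => ContDiffAt.sum fun b _ =>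
    ((contDiffAt_jac hτ a i).mul (contDiffAt_jac hτ b j)).mul ((hB a b).comp y hτ)

lemma eventually_metricNear (hU : IsOpen U)
    (hA : ∀ i j, Approx U (fun ε z => A ε z i j) (fun z => A₀ z i j))
    (hs : ∀ y ∈ U, ∀ᶠ p in lz y, ∀ i j, A p.1 p.2 i j = A p.1 p.2 j i)
    (hd : ∀ y ∈ U, (A₀ y).det ≠ 0) {y : Model n} (hy : y ∈ U) :
    ∀ᶠ p in lz y, MetricNear (A p.1) p.2 := by
  have h1 : ∀ᶠ p in lz y, ∀ i j, ContDiffAt ℝ ∞ (fun w => A p.1 w i j) p.2 :=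
    eventually_all.2 fun i => eventually_all.2 fun j => (hA i j).smooth y hy
  have h2 : ∀ᶠ p in lz y, (A p.1 p.2).det ≠ 0 := (Approx.det hU hA).eventually_ne_zero hy (hd y hy)
  filter_upwards [eventually_lz_nhds h1, eventually_lz_nhds (hs y hy), eventually_lz_nhds h2]
    with p h1 h2 h3 using ⟨h1, h2, h3⟩

end PullBack

/-! ### Localisation of the manifold convolution -/

section ConvLocal

variable {n : ℕ} {M : Type*} [TopologicalSpace M] [ChartedSpace (Model n) M]

lemma comp_smul (c : M → ℝ) (T : TensorField n M) (ψ : Chart n M) (y : Model n) (i j : Fin n) :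
    comp (fun x => c x • T x) ψ.1 y i j = c (ψ.1.symm y) * comp T ψ.1 y i j := rfl

lemma comp_sum {ι : Type*} (s : Finset ι) (T : ι → TensorField n M) (ψ : Chart n M)
    (y : Model n) (i j : Fin n) :
    comp (fun x => ∑ a ∈ s, T a x) ψ.1 y i j = ∑ a ∈ s, comp (T a) ψ.1 y i j := by
  classical
  induction s using Finset.induction_on with
  | empty => rfl
  | insert a s ha ih =>
    rw [Finset.sum_insert ha, ← ih]
    have : comp (fun x => ∑ a ∈ insert a s, T a x) ψ.1 y =
        comp (fun x => T a x + ∑ a ∈ s, T a x) ψ.1 y := comp_congr (Finset.sum_insert ha)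
    rw [this]
    rfl

/-- The part of the target of a chart corresponding to a subset of the manifold. -/
def dom (ψ : Chart n M) (N : Set M) : Set (Model n) := ψ.1.target ∩ ψ.1.symm ⁻¹' N

lemma isOpen_dom (ψ : Chart n M) {N : Set M} (hN : IsOpen N) : IsOpen (dom ψ N) :=
  ψ.1.isOpen_inter_preimage_symm hN

lemma dom_subset_transDom {ψ ψ' : Chart n M} {N : Set M} (h : N ⊆ ψ'.1.source) :
    dom ψ N ⊆ transDom ψ ψ' := fun _ hy => ⟨hy.1, h hy.2⟩

lemma coordChange_dom {ψ ψ' : Chart n M} {N : Set M} (hN : IsOpen N) (h : N ⊆ ψ.1.source)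
    (h' : N ⊆ ψ'.1.source) :
    CoordChange (trans ψ ψ') (trans ψ' ψ) (dom ψ N) (dom ψ' N) :=
  (coordChange_trans ψ ψ').mono (isOpen_dom ψ hN) (isOpen_dom ψ' hN) (dom_subset_transDom h')
    (dom_subset_transDom h) fun y hy => ⟨ψ'.1.map_source (h' hy.2), by
      rw [mem_preimage, symm_trans (dom_subset_transDom h' hy)]
      exact hy.2⟩

namespace MollifierData

variable (D : MollifierData n M)

/-- A neighbourhood on which only the summands with index in `F` contribute to the manifold
convolution for small parameters. -/
structure Good (F : Finset ℕ) (N : Set M) : Prop where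
  isOpen : IsOpen N
  subset : ∀ α ∈ F, N ⊆ (D.ψ α).1.source
  χ_eq_one : ∀ α ∈ F, ∀ x ∈ N, D.χ α x = 1
  notMem : ∀ α ∉ F, ∀ x ∈ N, x ∉ tsupport (D.ξ α)
  finite : {α | ((D.ψ α).1.source ∩ N).Nonempty}.Finite

/-- `F` consists of the indices with `x` in the support of `ξ α`. By local finiteness only finitely
many other charts come near `x`, and for these the closed support of `ξ α` is avoided by shrinking
the neighbourhood. -/
lemma exists_good (x : M) : ∃ F N, D.Good F N ∧ x ∈ N := by
  classical
  obtain ⟨N₀, hN₀, hfin⟩ := D.locallyFinite x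
  have hx₀ : x ∈ N₀ := mem_of_mem_nhds hN₀
  let F : Finset ℕ := hfin.toFinset.filter fun α => x ∈ tsupport (D.ξ α)
  have hF : ∀ α, α ∈ F ↔ x ∈ tsupport (D.ξ α) := fun α => by
    simp only [F, Finset.mem_filter, Set.Finite.mem_toFinset, mem_ofPred_eq, and_iff_right_iff_imp]
    exact fun h => ⟨x, D.ξ_subordinate α h, hx₀⟩
  have h1 : ∀ᶠ z in 𝓝 x, ∀ α ∈ F, z ∈ (D.ψ α).1.source ∧ D.χ α z = 1 :=
    (Finset.eventually_all F).2 fun α hα =>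
      ((D.ψ α).1.open_source.eventually_mem (D.ξ_subordinate α ((hF α).1 hα))).and
        (D.χ_one α x ((hF α).1 hα))
  have h2 : ∀ᶠ z in 𝓝 x, ∀ α ∈ hfin.toFinset.filter (fun α => α ∉ F), z ∉ tsupport (D.ξ α) :=
    (Finset.eventually_all _).2 fun α hα => by
      have : x ∉ tsupport (D.ξ α) := fun h => (Finset.mem_filter.1 hα).2 ((hF α).2 h)
      exact (isClosed_tsupport _).isOpen_compl.eventually_mem this
  obtain ⟨N, hsub, hN, hx⟩ := mem_nhds_iff.1 (((eventually_mem_set.2 hN₀).and h1).and h2)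
  refine ⟨F, N, ⟨hN, fun α hα z hz => ((hsub hz).1.2 α hα).1,
    fun α hα z hz => ((hsub hz).1.2 α hα).2, fun α hα z hz hzξ => ?_, ?_⟩, hx⟩
  · refine (hsub hz).2 α ?_ hzξ
    simp only [Finset.mem_filter, Set.Finite.mem_toFinset, mem_ofPred_eq]
    exact ⟨⟨z, D.ξ_subordinate α hzξ, (hsub hz).1.1⟩, hα⟩
  · exact hfin.subset fun α ⟨z, hz1, hz2⟩ => ⟨z, hz1, (hsub hz2).1.1⟩

variable {D} in
lemma Good.mono {F : Finset ℕ} {N N' : Set M} (h : D.Good F N) (hN' : IsOpen N') (hs : N' ⊆ N) :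
    D.Good F N' :=
  ⟨hN', fun α hα => hs.trans (h.subset α hα), fun α hα x hx => h.χ_eq_one α hα x (hs hx),
    fun α hα x hx => h.notMem α hα x (hs hx),
    h.finite.subset fun _ hα => hα.mono (inter_subset_inter_right _ hs)⟩

variable {D} in
lemma Good.sum_ξ {F : Finset ℕ} {N : Set M} (h : D.Good F N) {x : M} (hx : x ∈ N) :
    ∑ α ∈ F, D.ξ α x = 1 := by
  rw [← D.ξ.sum_eq_one (mem_univ x), finsum_eq_sum_of_support_subset]
  intro α hα
  by_contra hαF
  exact h.notMem α hαF x hx (subset_tsupport _ hα)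

lemma kernel_eq_zero {α : ℕ} {ε : ℝ} (hε : 0 < ε) {y : Model n}
    (h : ∀ w ∈ (D.ψ α).1 '' tsupport (D.ξ α), ε < ‖y - w‖) : D.kernel α ε y = 0 := by
  ext z
  change D.locξ α z * ((ε ^ n)⁻¹ * D.ρ (ε⁻¹ • (y - z))) = 0
  by_cases hz : z ∈ (D.ψ α).1 '' tsupport (D.ξ α)
  · rw [D.mollifier.supp, mul_zero, mul_zero]
    rw [norm_smul, norm_inv, Real.norm_of_nonneg hε.le, ← div_eq_inv_mul]
    exact (one_lt_div hε).2 (h z hz)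
  · rw [D.locξ_eq_zero α z hz, zero_mul]

lemma localConv_eq_zero (T : DistTensorField n M) {α : ℕ} {ε : ℝ} {y : Model n}
    (h : D.kernel α ε y = 0) : D.localConv ε T α y = 0 := by
  ext i j
  rw [localConv, h, map_zero]
  rfl

lemma zero_smul_form {x : M} (B : FormAt n x) : (0 : ℝ) • B = 0 :=
  ContinuousLinearMap.ext fun v => ContinuousLinearMap.ext fun w => zero_mul (B v w)

lemma smul_zero_form (c : ℝ) (x : M) : c • (0 : FormAt n x) = 0 :=
  ContinuousLinearMap.ext fun _ => ContinuousLinearMap.ext fun _ => mul_zero c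

lemma pull_eq_zero (ψ : Chart n M) {A : Model n → Matrix (Fin n) (Fin n) ℝ} {x : M}
    (h : A (ψ.1 x) = 0) : pull ψ.1 A x = 0 := by
  rw [pull]
  refine Finset.sum_eq_zero fun i _ => Finset.sum_eq_zero fun j _ => ?_
  rw [h]
  exact zero_smul_form _

variable {D} in
lemma Good.conv_eq_sum {F : Finset ℕ} {N : Set M} (h : D.Good F N) (ε : ℝ)
    (T : DistTensorField n M) {x : M} (hx : x ∈ N) :
    D.conv ε T x = ∑ α ∈ h.finite.toFinset, D.χ α x • pull (D.ψ α).1 (D.localConv ε T α) x := by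
  refine finsum_eq_sum_of_support_subset _ fun α hα => ?_
  simp only [Set.Finite.coe_toFinset, mem_ofPred_eq]
  refine ⟨x, D.χ_supp α (subset_tsupport _ fun h0 => hα ?_), hx⟩
  simp only [h0, zero_smul_form]

variable {D} in
-- Off the support of `χ_α` the term vanishes nearby. On it, the point lies in the chart domain but,
-- since `α ∉ F`, off the support of `ξ_α`. In the chart it then has positive distance from that
-- support, and mollification enlarges supports by at most `ε`.
lemma Good.eventually_term_eq_zero {F : Finset ℕ} {N : Set M} (h : D.Good F N)
    (T : DistTensorField n M) {ψ : Chart n M} {y : Model n} (hy : y ∈ dom ψ N) {α : ℕ}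
    (hα : α ∉ F) : ∀ᶠ p in lz y, D.χ α (ψ.1.symm p.2) •
      pull (D.ψ α).1 (D.localConv p.1 T α) (ψ.1.symm p.2) = 0 := by
  have hc : ContinuousAt ψ.1.symm y := ψ.1.continuousAt_symm hy.1
  by_cases hx : ψ.1.symm y ∈ tsupport (D.χ α)
  · have hxs := D.χ_supp α hx
    have hcτ : ContinuousAt (fun z => (D.ψ α).1 (ψ.1.symm z)) y :=
      ContinuousAt.comp (g := (D.ψ α).1) ((D.ψ α).1.continuousAt hxs) hc
    have hnot : (D.ψ α).1 (ψ.1.symm y) ∉ (D.ψ α).1 '' tsupport (D.ξ α) := by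
      rintro ⟨x', hx', he⟩
      have := (D.ψ α).1.injOn (D.ξ_subordinate α hx') hxs he
      exact h.notMem α hα _ hy.2 (this ▸ hx')
    obtain ⟨δ, hδ, hball⟩ := Metric.mem_nhds_iff.1
      ((D.isCompact_image α).isClosed.isOpen_compl.mem_nhds hnot)
    -- One half of `δ` is spent on the displacement of the point and the other half on the
    -- mollification radius.
    have e1 : ∀ᶠ z in 𝓝 y, dist ((D.ψ α).1 (ψ.1.symm z)) ((D.ψ α).1 (ψ.1.symm y)) < δ / 2 :=
      hcτ.eventually (Metric.ball_mem_nhds _ (half_pos hδ))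
    have e2 : ∀ᶠ ε in 𝓝[>] (0 : ℝ), ε < δ / 2 :=
      (eventually_lt_nhds (half_pos hδ)).filter_mono nhdsWithin_le_nhds
    filter_upwards [eventually_lz_of_nhds e1, eventually_lz_of_pos e2, eventually_pos_lz y]
      with p h1 h2 h3
    rw [pull_eq_zero _ (D.localConv_eq_zero T (D.kernel_eq_zero h3 fun w hw => ?_)), smul_zero_form]
    by_contra hle
    refine hball (Metric.mem_ball.2 ?_) hw
    have t := dist_triangle w ((D.ψ α).1 (ψ.1.symm p.2)) ((D.ψ α).1 (ψ.1.symm y))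
    rw [not_lt, ← dist_eq_norm, dist_comm] at hle
    linarith
  · have : ∀ᶠ z in 𝓝 y, D.χ α (ψ.1.symm z) = 0 :=
      hc.eventually (notMem_tsupport_iff_eventuallyEq.1 hx)
    filter_upwards [eventually_lz_of_nhds this] with p hp
    rw [hp, zero_smul_form]

variable {D} in
/-- The components of the manifold convolution for small parameters. -/
lemma Good.eventually_comp_conv {F : Finset ℕ} {N : Set M} (h : D.Good F N)
    (T : DistTensorField n M) {ψ : Chart n M} {y : Model n} (hy : y ∈ dom ψ N) :
    ∀ᶠ p in lz y, ∀ i j, comp (D.conv p.1 T) ψ.1 p.2 i j =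
      ∑ α ∈ F, pullM (trans ψ (D.ψ α)) (D.localConv p.1 T α) p.2 i j := by
  have e1 : ∀ᶠ p in lz y, ∀ α ∈ h.finite.toFinset.filter (fun α => α ∉ F),
      D.χ α (ψ.1.symm p.2) • pull (D.ψ α).1 (D.localConv p.1 T α) (ψ.1.symm p.2) = 0 :=
    (Finset.eventually_all _).2 fun α hα =>
      h.eventually_term_eq_zero T hy (Finset.mem_filter.1 hα).2
  filter_upwards [e1, eventually_lz_of_nhds ((isOpen_dom ψ h.isOpen).eventually_mem hy)]
    with p hp hpN i j
  have hsub : F ⊆ h.finite.toFinset := fun α hα => by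
    simp only [Set.Finite.mem_toFinset, mem_ofPred_eq]
    exact ⟨_, h.subset α hα hpN.2, hpN.2⟩
  have e2 : D.conv p.1 T (ψ.1.symm p.2) =
      ∑ α ∈ F, pull (D.ψ α).1 (D.localConv p.1 T α) (ψ.1.symm p.2) := by
    rw [h.conv_eq_sum _ _ hpN.2, ← Finset.sum_subset hsub]
    · exact Finset.sum_congr rfl fun α hα => by rw [h.χ_eq_one α hα _ hpN.2, one_smul]
    · exact fun α h1 h2 => hp α (Finset.mem_filter.2 ⟨h1, h2⟩)
  rw [comp_congr (T' := fun x => ∑ α ∈ F, pull (D.ψ α).1 (D.localConv p.1 T α) x) e2, comp_sum]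
  exact Finset.sum_congr rfl fun α hα => by
    rw [comp_pull _ (dom_subset_transDom (h.subset α hα) hpN)]

/-- The manifold convolution is smooth if its local constituents are. -/
lemma contDiffAt_comp_conv (T : DistTensorField n M) (ε : ℝ)
    (hT : ∀ α i j, ContDiff ℝ ∞ fun y => D.localConv ε T α y i j) (ψ : Chart n M) {y : Model n}
    (hy : y ∈ ψ.1.target) (i j : Fin n) :
    ContDiffAt ℝ ∞ (fun z => comp (D.conv ε T) ψ.1 z i j) y := by
  obtain ⟨F, N, h, hx⟩ := D.exists_good (ψ.1.symm y)
  have hev : ∀ᶠ z in 𝓝 y, z ∈ dom ψ N := (isOpen_dom ψ h.isOpen).eventually_mem ⟨hy, hx⟩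
  have e1 : (fun z => comp (D.conv ε T) ψ.1 z i j) =ᶠ[𝓝 y] fun z =>
      ∑ α ∈ h.finite.toFinset, D.χ α (ψ.1.symm z) *
        comp (fun x => pull (D.ψ α).1 (D.localConv ε T α) x) ψ.1 z i j := by
    filter_upwards [hev] with z hz
    rw [comp_congr (T' := fun x => ∑ α ∈ h.finite.toFinset,
      D.χ α x • pull (D.ψ α).1 (D.localConv ε T α) x) (h.conv_eq_sum ε T hz.2), comp_sum]
    exact Finset.sum_congr rfl fun α _ => comp_smul _ _ _ _ _ _
  refine ContDiffAt.congr_of_eventuallyEq (ContDiffAt.sum fun α _ => ?_) e1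
  by_cases hs : ψ.1.symm y ∈ tsupport (D.χ α)
  · have hy' : y ∈ transDom ψ (D.ψ α) := ⟨hy, D.χ_supp α hs⟩
    have h1 : ContDiffAt ℝ ∞ (fun z => D.χ α (ψ.1.symm z)) y := by
      refine (contMDiffOn_iff_contDiffOn.1 ((D.χ_smooth α).comp_contMDiffOn
        (contMDiffOn_symm_of_mem_maximalAtlas ψ.2))).contDiffAt (ψ.1.open_target.mem_nhds hy)
    refine h1.mul (ContDiffAt.congr_of_eventuallyEq (contDiffAt_pullM
      ((coordChange_trans ψ (D.ψ α)).contDiffAt hy') (fun i j => (hT α i j).contDiffAt) i j) ?_)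
    filter_upwards [(isOpen_transDom ψ (D.ψ α)).eventually_mem hy'] with z hz
    rw [comp_pull _ hz]
  · refine (contDiffAt_const (c := (0 : ℝ))).congr_of_eventuallyEq ?_
    filter_upwards [(ψ.1.continuousAt_symm hy).eventually
      (notMem_tsupport_iff_eventuallyEq.1 hs)] with z hz
    simp [hz]

end MollifierData

end ConvLocal

/-! ### The main estimate in a chart -/

section Main

variable {n : ℕ} {M : Type*} [TopologicalSpace M] [ChartedSpace (Model n) M]
  (g : LipschitzLorentzMetric n M) (D : MollifierData n M)

lemma contDiff_localConv_toDist {ε : ℝ} (hε : 0 < ε) (α : ℕ) (i j : Fin n) :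
    ContDiff ℝ ∞ fun y => D.localConv ε (toDist g.toField) α y i j := by
  have d := localData_locMetric g D α
  simp only [localConv_toDist]
  exact D.mollifier.contDiff_mol hε ((LipComp.of_contDiff d.smooth d.supp).mul
    (d.lip i j)).bddMeas.locallyIntegrable

lemma contDiff_localConv_distRicci {ε : ℝ} (hε : 0 < ε) (α : ℕ) (i j : Fin n) :
    ContDiff ℝ ∞ fun y => D.localConv ε (distRicci g.toField) α y i j := by
  simp only [localConv_distRicci g D α hε]
  exact D.mollifier.contDiff_molRicci (localData_locMetric g D α) hε i j

lemma locMetric_symm (α : ℕ) (z : Model n) (i j : Fin n) :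
    locMetric g D α z i j = locMetric g D α z j i := by
  change D.locχ α z * comp g.toField (D.ψ α).1 z i j = D.locχ α z * comp g.toField (D.ψ α).1 z j i
  congr 1
  exact (g.lorentz _).1 _ _

variable {g D} {F : Finset ℕ} {N : Set M}

lemma MollifierData.Good.locMetric_eq (h : D.Good F N) {α : ℕ} (hα : α ∈ F) {z : Model n}
    (hz : z ∈ dom (D.ψ α) N) : locMetric g D α z = comp g.toField (D.ψ α).1 z := by
  rw [locMetric, MollifierData.locχ, indicator_of_mem hz.1, h.χ_eq_one α hα _ hz.2, one_smul]

/-- The main estimate in a chart: the components of `g ⋆_M ρ_ε` approximate those of `g`, and the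
difference between the Ricci tensor of `g ⋆_M ρ_ε` and `Ric[g] ⋆_M ρ_ε` is negligible. -/
theorem MollifierData.Good.negl_ricci_sub (h : D.Good F N) {ψ : Chart n M} (hψ : N ⊆ ψ.1.source) :
    (∀ i j, Approx (dom ψ N) (fun ε z => comp (D.conv ε (toDist g.toField)) ψ.1 z i j)
      (fun z => comp g.toField ψ.1 z i j)) ∧
    (∀ y ∈ dom ψ N, ∀ᶠ p in lz y, ∀ i j, comp (D.conv p.1 (toDist g.toField)) ψ.1 p.2 i j =
      comp (D.conv p.1 (toDist g.toField)) ψ.1 p.2 j i) ∧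
    ∀ i j, Negl (dom ψ N) (fun ε y => ricciComp (comp (D.conv ε (toDist g.toField)) ψ.1) y i j -
      comp (D.conv ε (distRicci g.toField)) ψ.1 y i j) := by
  have hm := D.mollifier
  let τ : ℕ → Model n → Model n := fun α => trans ψ (D.ψ α)
  have hU := isOpen_dom ψ h.isOpen
  have hc : ∀ α ∈ F, CoordChange (τ α) (trans (D.ψ α) ψ) (dom ψ N) (dom (D.ψ α) N) :=
    fun α hα => coordChange_dom h.isOpen hψ (h.subset α hα)
  have d := localData_locMetric g D
  -- The error made by taking `ξ_α` out of the mollification. It decomposes the summand as `ξ_α`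
  -- times a mollified metric plus a negligible term, the form required by the gluing lemma.
  let C : ℕ → ℝ → Model n → Matrix (Fin n) (Fin n) ℝ := fun α ε z i j =>
    mol D.ρ ε (fun w => D.locξ α w * locMetric g D α w i j) z -
      D.locξ α z * mol D.ρ ε (fun w => locMetric g D α w i j) z
  have hC : ∀ α i j, NeglTwo (dom (D.ψ α) N) (fun ε z => C α ε z i j) ∧
      BigOEps (dom (D.ψ α) N) (fun ε z => C α ε z i j) := fun α i j =>
    hm.neglTwo_commutator ((d α).lip i j) (d α).smooth (d α).supp _
  have hdα : ∀ α ∈ F, ∀ z ∈ dom (D.ψ α) N, (locMetric g D α z).det ≠ 0 := fun α hα z hz => by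
    rw [h.locMetric_eq hα hz]
    exact (g.isLorentzMat (D.ψ α) hz.1).det_ne_zero
  have hA := fun α => hm.approx_molM (d α) (dom (D.ψ α) N)
  have hEv := fun y (hy : y ∈ dom ψ N) => h.eventually_comp_conv (toDist g.toField) hy
  obtain ⟨g1, g2⟩ := negl_ricciComp_glue hU (F := F)
    (Ea := fun α ε => pullM (τ α) (molM D.ρ ε (locMetric g D α)))
    (ζ := fun α y => D.locξ α (τ α y)) (Da := fun α ε => pullM (τ α) (C α ε))
    (G := comp g.toField ψ.1) (E := fun ε => comp (D.conv ε (toDist g.toField)) ψ.1)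
    (fun α hα i j => ((hc α hα).approx_pullM (hA α) i j).congr_lim hU fun y hy => by
      rw [comp_eq_pullM g.toField (dom_subset_transDom (h.subset α hα) hy)]
      simp only [pullM, h.locMetric_eq hα ((hc α hα).mapsTo hy)]
      rfl)
    (fun α hα i j => by
      refine ((hc α hα).neglTwo_pullM (A := fun ε z i j => ε * molM D.ρ ε (locMetric g D α) z i j)
        (fun i j => hm.neglTwo_eps_mol ((d α).lip i j) _) i j).congr
          fun y _ => Eventually.of_forall fun p => ?_
      simpa [pullM] using pullM_const_mul_add (τ := τ α) (y := p.2)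
        (E := fun z i j => p.1 * molM D.ρ p.1 (locMetric g D α) z i j)
        (B := molM D.ρ p.1 (locMetric g D α)) (C := 0) p.1 (fun i j => by simp) i j)
    (fun α hα y hy => (d α).smooth.contDiffAt.comp y ((hc α hα).contDiffAt hy))
    (fun y hy => by
      rw [← h.sum_ξ hy.2]
      refine Finset.sum_congr rfl fun α hα => ?_
      have hd := dom_subset_transDom (h.subset α hα) hy
      rw [MollifierData.locξ, indicator_of_mem (mapsTo_trans ψ (D.ψ α) hd).1, symm_trans hd])
    (fun α hα i j => (hc α hα).neglTwo_pullM (fun i j => (hC α i j).1) i j)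
    (fun α hα i j => (hc α hα).bigOEps_pullM (fun i j => (hC α i j).2) i j)
    (fun y hy => (g.isLorentzMat ψ hy.1).det_ne_zero)
    (fun i j y hy => by
      filter_upwards [hEv y hy] with p hp
      rw [hp]
      refine Finset.sum_congr rfl fun α _ => ?_
      refine (pullM_const_mul_add _ (fun i j => ?_) i j).symm
      rw [localConv_toDist]
      simp only [C, molM]
      ring)
  refine ⟨g1, fun y hy => ?_, fun i j => ?_⟩
  · filter_upwards [hEv y hy] with p hp i j
    rw [hp, hp]
    refine Finset.sum_congr rfl fun α _ => pullM_symm (fun i j => ?_) i j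
    simp only [localConv_toDist, locMetric_symm g D α _ i j]
  -- Gluing compares `Ric[g_ε]` with the weighted sum of the Ricci tensors of the pulled-back
  -- pieces. The local theorem compares the latter, chart by chart, with the summands of `Ric[g] ⋆_M
  -- ρ_ε`.
  · have hR : ∀ α ∈ F, ∀ i j, Negl (dom (D.ψ α) N) (fun ε z => (fun i j =>
        molRicci D.ρ (D.locξ α) (locMetric g D α) ε i j z -
          D.locξ α z * ricciComp (molM D.ρ ε (locMetric g D α)) z i j :
            Matrix (Fin n) (Fin n) ℝ) i j) := fun α hα i j =>
      hm.negl_molRicci_sub (d α) (isOpen_dom _ h.isOpen) (hdα α hα) i j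
    have hsum := Negl.sum fun α hα => (hc α hα).negl_pullM (hR α hα) i j
    refine ((g2 i j).sub hsum).congr fun y hy => ?_
    -- Commuting the Ricci tensor with the pull-back requires the mollified metric to be smooth,
    -- symmetric and nondegenerate near the point, which holds for small parameters.
    have hMN : ∀ᶠ p in lz y, ∀ α ∈ F, MetricNear (molM D.ρ p.1 (locMetric g D α)) (τ α p.2) :=
      (Finset.eventually_all F).2 fun α hα =>
        (tendsto_lz_map ((hc α hα).contDiffAt hy).continuousAt).eventually
          (eventually_metricNear (isOpen_dom _ h.isOpen) (hA α)
            (fun z _ => Eventually.of_forall fun p i j => by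
              simp only [molM, locMetric_symm g D α _ i j]) (hdα α hα) ((hc α hα).mapsTo hy))
    filter_upwards [hMN, h.eventually_comp_conv (distRicci g.toField) hy, eventually_pos_lz y,
      eventually_lz_of_nhds (hU.eventually_mem hy)] with p h1 h2 h3 h4
    rw [h2, sub_sub, ← Finset.sum_add_distrib]
    congr 1
    refine Finset.sum_congr rfl fun α hα => ?_
    rw [ricciComp_pullM ((hc α hα).diffeoNear h4) (h1 α hα)]
    refine (pullM_const_mul_add _ (fun i j => ?_) i j).symm
    rw [localConv_distRicci g D α h3]
    ring

end Main

/-! ### The norm induced by the Riemannian metric -/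

section TensorNorm

variable {n : ℕ}

/-- The squared norm of the matrix `B` of a `(0,2)`-tensor with respect to the matrix `H` of an
inner product. -/
def normSq (H B : Matrix (Fin n) (Fin n) ℝ) : ℝ :=
  ∑ i, ∑ j, ∑ k, ∑ l, H⁻¹ i k * H⁻¹ j l * B i j * B k l

lemma normSq_eq_trace (H B : Matrix (Fin n) (Fin n) ℝ) :
    normSq H B = (B.transpose * H⁻¹ * (B * H⁻¹.transpose)).trace := by
  simp only [normSq, Matrix.trace, Matrix.diag, Matrix.mul_apply, Matrix.transpose_apply,
    Finset.sum_mul, Finset.mul_sum]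
  rw [Finset.sum_comm]
  refine Finset.sum_congr rfl fun j _ => ?_
  rw [Finset.sum_comm]
  refine Finset.sum_congr rfl fun k _ => ?_
  rw [Finset.sum_comm]
  exact Finset.sum_congr rfl fun i _ => Finset.sum_congr rfl fun l _ => by ring

/-- Independence of the basis, from `P (PᵀHP)⁻¹ Pᵀ = H⁻¹` and the cyclicity of the trace. It allows
the norm on the tangent space to be computed from components in any chart. -/
lemma normSq_congruence {P : Matrix (Fin n) (Fin n) ℝ} (hP : IsUnit P.det)
    (H B : Matrix (Fin n) (Fin n) ℝ) :
    normSq (P.transpose * H * P) (P.transpose * B * P) = normSq H B := by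
  have hPt : IsUnit P.transpose.det := by rwa [Matrix.det_transpose]
  have e1 : P * (P.transpose * H * P)⁻¹ * P.transpose = H⁻¹ := by
    rw [Matrix.mul_inv_rev, Matrix.mul_inv_rev, ← Matrix.mul_assoc, ← Matrix.mul_assoc,
      Matrix.mul_nonsing_inv _ hP, Matrix.one_mul, Matrix.mul_assoc, Matrix.nonsing_inv_mul _ hPt,
      Matrix.mul_one]
  rw [normSq_eq_trace, normSq_eq_trace, ← e1]
  simp only [Matrix.transpose_mul, Matrix.transpose_transpose, Matrix.mul_assoc]
  rw [Matrix.trace_mul_comm]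
  simp only [Matrix.mul_assoc]

variable {M : Type*} [TopologicalSpace M] [ChartedSpace (Model n) M]

/-- The matrix of a tensor field with respect to the standard basis of the model space. -/
def mat (T : TensorField n M) (x : M) : Matrix (Fin n) (Fin n) ℝ := fun i j => ev T x (e i) (e j)

/-- The matrix of the differential of the inverse of a chart. -/
def dsymmMat (ψ : Chart n M) (y : Model n) : Matrix (Fin n) (Fin n) ℝ :=
  fun a i => dsymm ψ y (e i) a

lemma comp_eq_mat (T : TensorField n M) (ψ : Chart n M) (y : Model n) :
    comp T ψ.1 y = (dsymmMat ψ y).transpose * mat T (ψ.1.symm y) * dsymmMat ψ y := by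
  ext i j
  rw [comp_apply, ← sum_smul_e (dsymm ψ y (e i)), ← sum_smul_e (dsymm ψ y (e j))]
  simp only [map_sum, map_smul, sum_apply, smul_apply, smul_eq_mul, Matrix.mul_apply,
    Matrix.transpose_apply, Finset.sum_mul, Finset.mul_sum]
  exact Finset.sum_congr rfl fun a _ => Finset.sum_congr rfl fun b _ => by
    simp only [mat, dsymmMat]; ring

lemma isUnit_det_dsymmMat {ψ : Chart n M} {y : Model n} (hy : y ∈ ψ.1.target) :
    IsUnit (dsymmMat ψ y).det := by
  let Q : Matrix (Fin n) (Fin n) ℝ := fun a i => dchart ψ (ψ.1.symm y) (e i) a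
  have h1 : Q * dsymmMat ψ y = 1 := by
    ext c i
    have h5 := dchart_dsymm hy (e i)
    rw [← sum_smul_e (dsymm ψ y (e i)), map_sum] at h5
    have h7 := congrArg (fun v : Model n => v c) h5
    simp only [map_smul, WithLp.ofLp_sum, Finset.sum_apply, PiLp.smul_apply, smul_eq_mul] at h7
    rw [Matrix.mul_apply]
    refine (Finset.sum_congr rfl fun a _ => mul_comm _ _).trans (h7.trans ?_)
    simp [e, Matrix.one_apply]
  have h2 := congrArg Matrix.det h1
  rw [Matrix.det_mul, Matrix.det_one] at h2
  exact IsUnit.of_mul_eq_one_right _ h2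

variable [IsManifold 𝓘(ℝ, Model n) ∞ M] (h : RiemMetric n M)

/-- The norm of a tensor field in terms of its components in a chart. -/
lemma tensorNorm_eq (T : TensorField n M) {ψ : Chart n M} {y : Model n} (hy : y ∈ ψ.1.target) :
    tensorNorm h (T (ψ.1.symm y)) = √(normSq (comp h.inner ψ.1 y) (comp T ψ.1 y)) := by
  rw [comp_eq_mat, comp_eq_mat, normSq_congruence (isUnit_det_dsymmMat hy)]
  rfl

/-- The components of a smooth Riemannian metric are continuous. -/
lemma continuousAt_comp_inner {ψ : Chart n M} {y : Model n} (hy : y ∈ ψ.1.target) (i j : Fin n) :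
    ContinuousAt (fun z => comp h.inner ψ.1 z i j) y := by
  have hs := contMDiffOn_symm_of_mem_maximalAtlas (n := ∞) ψ.2
  have h1 := hs.contMDiffOn_tangentMapWithin (m := 0) (by simp) ψ.1.open_target.uniqueMDiffOn
  have hc : ∀ i : Fin n, ContMDiff 𝓘(ℝ, Model n) 𝓘(ℝ, Model n).tangent 0
      (fun z : Model n => (⟨z, (e i : Model n)⟩ : TangentBundle 𝓘(ℝ, Model n) (Model n))) :=
    fun i => contMDiff_vectorSpace_iff_contDiff.2 contDiff_const
  -- The coordinate vector fields are the images of constant vector fields under the tangent map of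
  -- the inverse chart, hence continuous.
  have hv : ∀ i : Fin n, ContMDiffAt 𝓘(ℝ, Model n) 𝓘(ℝ, Model n).tangent 0
      (fun z => (⟨ψ.1.symm z, mfderiv 𝓘(ℝ, Model n) 𝓘(ℝ, Model n) ψ.1.symm z (e i)⟩ :
        TangentBundle 𝓘(ℝ, Model n) M)) y := by
    intro i
    refine ((h1.comp (hc i).contMDiffOn fun z hz => hz).contMDiffAt
      (ψ.1.open_target.mem_nhds hy)).congr_of_eventuallyEq ?_
    filter_upwards [ψ.1.open_target.mem_nhds hy] with z hz
    simp only [Function.comp, tangentMapWithin]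
    rw [mfderivWithin_of_isOpen ψ.1.open_target hz]
  have hs0 : ContMDiffAt 𝓘(ℝ, Model n) 𝓘(ℝ, Model n) ∞ ψ.1.symm y :=
    hs.contMDiffAt (ψ.1.open_target.mem_nhds hy)
  have h0 := ((h.contMDiff (ψ.1.symm y)).comp y hs0).of_le (bot_le : (0 : WithTop ℕ∞) ≤ _)
  have h2 := ContMDiffAt.clm_bundle_apply₂ (F₁ := Model n) (F₂ := Model n) (F₃ := ℝ)
    (E₁ := fun x : M => TangentSpace 𝓘(ℝ, Model n) x)
    (E₂ := fun x : M => TangentSpace 𝓘(ℝ, Model n) x) (E₃ := Bundle.Trivial M ℝ)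
    (b := ψ.1.symm) h0 (hv i) (hv j)
  rw [Bundle.contMDiffAt_totalSpace] at h2
  exact h2.2.continuousAt

lemma det_comp_inner_ne_zero {ψ : Chart n M} {y : Model n} (hy : y ∈ ψ.1.target) :
    (comp h.inner ψ.1 y).det ≠ 0 := by
  intro h0
  obtain ⟨u, hu, hBu⟩ := Matrix.exists_mulVec_eq_zero_iff.2 h0
  let v : Model n := WithLp.toLp 2 u
  have hz : ev h.inner (ψ.1.symm y) (dsymm ψ y v) (dsymm ψ y v) = 0 := by
    rw [ev_dsymm]
    change mform (comp h.inner ψ.1 y) v v = 0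
    rw [mform_eq_dot]
    simp [v, hBu]
  refine (h.pos (ψ.1.symm y) (dsymm ψ y v) fun hv => hu ?_).ne' hz
  have h1 := dchart_dsymm hy v
  rw [show dsymm ψ y v = 0 from hv, map_zero] at h1
  simpa [v] using h1.symm

end TensorNorm

/-! ### Negligibility and continuity of norms -/

section Analysis

variable {n : ℕ} {U : Set (Model n)}

lemma Negl.sqrt {f : ℝ → Model n → ℝ} (hf : Negl U f) : Negl U (fun ε y => √(f ε y)) := by
  refine ⟨fun y hy => ?_, ?_⟩
  · obtain ⟨C, hC⟩ := (hf.bdd y hy).bound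
    refine Asymptotics.IsBigO.of_bound √C (hC.mono fun p hp => ?_)
    rw [norm_one, mul_one] at hp ⊢
    rw [Real.norm_of_nonneg (Real.sqrt_nonneg _)]
    exact Real.sqrt_le_sqrt ((le_abs_self _).trans hp)
  · filter_upwards [hf.lim] with y hy hyU
    simpa using (hy hyU).sqrt

lemma Negl.normSq {H : Model n → Matrix (Fin n) (Fin n) ℝ}
    {B : ℝ → Model n → Matrix (Fin n) (Fin n) ℝ}
    (hH : ∀ y ∈ U, ∀ i j, ContinuousAt (fun z => (H z)⁻¹ i j) y)
    (hB : ∀ i j, Negl U fun ε y => B ε y i j) : Negl U (fun ε y => normSq (H y) (B ε y)) := by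
  have hb : ∀ i j, Bdd U fun _ y => (H y)⁻¹ i j := fun i j =>
    Bdd.of_continuousAt fun y hy => hH y hy i j
  exact Negl.sum fun i _ => Negl.sum fun j _ => Negl.sum fun k _ => Negl.sum fun l _ =>
    Negl.bdd_mul (((hb i k).mul (hb j l)).mul (hB i j).bdd) (hB k l)

lemma continuousAt_normSq {H B : Model n → Matrix (Fin n) (Fin n) ℝ} {y : Model n}
    (hH : ∀ i j, ContinuousAt (fun z => (H z)⁻¹ i j) y)
    (hB : ∀ i j, ContinuousAt (fun z => B z i j) y) :
    ContinuousAt (fun z => normSq (H z) (B z)) y :=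
  tendsto_finsetSum _ fun i _ => tendsto_finsetSum _ fun j _ => tendsto_finsetSum _ fun k _ =>
    tendsto_finsetSum _ fun l _ => (((hH i k).mul (hH j l)).mul (hB i j)).mul (hB k l)

lemma continuousAt_inv_apply {H : Model n → Matrix (Fin n) (Fin n) ℝ} {y : Model n}
    (hH : ∀ i j, ContinuousAt (fun z => H z i j) y) (hd : (H y).det ≠ 0) (i j : Fin n) :
    ContinuousAt (fun z => (H z)⁻¹ i j) y := by
  have hc : ContinuousAt H y := tendsto_pi_nhds.2 fun i => tendsto_pi_nhds.2 fun j => hH i j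
  have h1 : ContinuousAt (fun z => (H z).det⁻¹ * (H z).adjugate i j) y :=
    ((Continuous.matrix_det continuous_id).continuousAt.comp hc |>.inv₀ hd).mul
      (((continuous_id.matrix_adjugate).matrix_elem i j).continuousAt.comp hc)
  refine h1.congr (Eventually.of_forall fun z => ?_)
  change _ = (H z)⁻¹ i j
  rw [Matrix.inv_def, Matrix.smul_apply, Ring.inverse_eq_inv', smul_eq_mul]

lemma MetricNear.continuousAt_ricciComp {A : Model n → Matrix (Fin n) (Fin n) ℝ} {y : Model n}
    (h : MetricNear A y) (i j : Fin n) : ContinuousAt (fun z => ricciComp A z i j) y := by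
  have hΓ := h.contDiffAt_christoffel
  refine ContinuousAt.add (tendsto_finsetSum _ fun m _ =>
    ((contDiffAt_pd (hΓ m i j) m).continuousAt).sub
      ((contDiffAt_pd (hΓ m i m) j).continuousAt)) ?_
  exact tendsto_finsetSum _ fun m _ => tendsto_finsetSum _ fun k _ =>
    ((hΓ m i j).continuousAt.mul (hΓ k k m).continuousAt).sub
      ((hΓ m i k).continuousAt.mul (hΓ k j m).continuousAt)

end Analysis

/-! ### The defect in a chart -/

section Defect

variable {n : ℕ} {M : Type*} [TopologicalSpace M] [ChartedSpace (Model n) M]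
  (g : LipschitzLorentzMetric n M) (D : MollifierData n M) (ψ : Chart n M)

lemma exists_good_chart {y : Model n} (hy : y ∈ ψ.1.target) :
    ∃ F N, D.Good F N ∧ N ⊆ ψ.1.source ∧ y ∈ dom ψ N := by
  obtain ⟨F, N, h, hx⟩ := D.exists_good (ψ.1.symm y)
  exact ⟨F, N ∩ ψ.1.source, h.mono (h.isOpen.inter ψ.1.open_source) inter_subset_left,
    inter_subset_right, hy, hx, ψ.1.map_target hy⟩

variable {ψ} in
lemma eventually_metricNear_conv {y : Model n} (hy : y ∈ ψ.1.target) :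
    ∀ᶠ p in lz y, MetricNear (comp (D.conv p.1 (toDist g.toField)) ψ.1) p.2 := by
  obtain ⟨F, N, h, hN, hyN⟩ := exists_good_chart D ψ hy
  obtain ⟨h1, h2, -⟩ := h.negl_ricci_sub (g := g) hN
  exact eventually_metricNear (isOpen_dom ψ h.isOpen) h1 h2
    (fun z hz => (g.isLorentzMat ψ hz.1).det_ne_zero) hyN

variable {ψ} in
lemma eventually_isLorentzMat_conv {y : Model n} (hy : y ∈ ψ.1.target) :
    ∀ᶠ p in lz y, IsLorentzMat (comp (D.conv p.1 (toDist g.toField)) ψ.1 p.2) := by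
  obtain ⟨F, N, h, hN, hyN⟩ := exists_good_chart D ψ hy
  obtain ⟨h1, h2, -⟩ := h.negl_ricci_sub (g := g) hN
  have ht : Tendsto (fun p : ℝ × Model n => comp (D.conv p.1 (toDist g.toField)) ψ.1 p.2) (lz y)
      (𝓝 (comp g.toField ψ.1 y)) :=
    tendsto_pi_nhds.2 fun i => tendsto_pi_nhds.2 fun j => (h1 i j).tendsto hyN
  filter_upwards [h2 y hyN, ht.eventually (g.isLorentzMat ψ hy).eventually] with p h3 h4
    using h4 h3

/-- The components of `Ric[g_ε] - Ric[g] ⋆_M ρ_ε`, where `g_ε = g ⋆_M ρ_ε`. -/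
def defectMat (ε : ℝ) (y : Model n) : Matrix (Fin n) (Fin n) ℝ := fun i j =>
  ricciComp (comp (D.conv ε (toDist g.toField)) ψ.1) y i j -
    comp (D.conv ε (distRicci g.toField)) ψ.1 y i j

lemma negl_defectMat (i j : Fin n) : Negl ψ.1.target (fun ε y => defectMat g D ψ ε y i j) :=
  Conv.of_locally fun y hy => by
    obtain ⟨F, N, h, hN, hyN⟩ := exists_good_chart D ψ hy
    exact ⟨dom ψ N, (isOpen_dom ψ h.isOpen).mem_nhds hyN, (h.negl_ricci_sub hN).2.2 i j⟩

variable [IsManifold 𝓘(ℝ, Model n) ∞ M] (h : RiemMetric n M)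

variable {g D ψ} in
lemma ricciDefect_eq {ε : ℝ} {y : Model n} (hy : y ∈ ψ.1.target)
    (hM : MetricNear (comp (D.conv ε (toDist g.toField)) ψ.1) y) :
    ricciDefect h D g.toField ε (ψ.1.symm y) =
      √(normSq (comp h.inner ψ.1 y) (defectMat g D ψ ε y)) := by
  have h1 := tensorNorm_eq h (fun x => ricci (D.conv ε (toDist g.toField)) x -
    D.conv ε (distRicci g.toField) x) hy
  have h2 : comp (fun x => ricci (D.conv ε (toDist g.toField)) x -
      D.conv ε (distRicci g.toField) x) ψ.1 y = defectMat g D ψ ε y := by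
    ext i j
    rw [comp_sub (ricci (D.conv ε (toDist g.toField))), comp_ricci _ hy hM, defectMat]
  rw [← h2]
  exact h1

lemma continuousAt_inv_comp_inner {y : Model n} (hy : y ∈ ψ.1.target) (i j : Fin n) :
    ContinuousAt (fun z => (comp h.inner ψ.1 z)⁻¹ i j) y :=
  continuousAt_inv_apply (continuousAt_comp_inner h hy) (det_comp_inner_ne_zero h hy) i j

/-- The defect is locally bounded and converges to zero almost everywhere. -/
lemma negl_ricciDefect :
    Negl ψ.1.target (fun ε y => ricciDefect h D g.toField ε (ψ.1.symm y)) := by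
  refine (Negl.sqrt (Negl.normSq (fun y hy => continuousAt_inv_comp_inner ψ h hy)
    (negl_defectMat g D ψ))).congr fun y hy => ?_
  filter_upwards [eventually_metricNear_conv g D hy,
    eventually_lz_of_nhds (ψ.1.open_target.eventually_mem hy)] with p h1 h2
  rw [ricciDefect_eq h h2 h1]

variable {g D ψ} in
-- Continuity is only needed to make the defect measurable on compact sets.
lemma continuousAt_ricciDefect_symm {ε : ℝ} (hε : 0 < ε) {y : Model n} (hy : y ∈ ψ.1.target)
    (hM : MetricNear (comp (D.conv ε (toDist g.toField)) ψ.1) y) :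
    ContinuousAt (fun z => ricciDefect h D g.toField ε (ψ.1.symm z)) y := by
  have h1 : ContinuousAt (fun z => √(normSq (comp h.inner ψ.1 z) (defectMat g D ψ ε z))) y :=
    (continuousAt_normSq (continuousAt_inv_comp_inner ψ h hy) fun i j =>
      (hM.continuousAt_ricciComp i j).sub
        (D.contDiffAt_comp_conv _ ε (contDiff_localConv_distRicci g D hε) ψ hy i j).continuousAt).sqrt
  refine h1.congr ?_
  filter_upwards [hM.eventually, ψ.1.open_target.eventually_mem hy] with z h2 h3
  rw [ricciDefect_eq h h3 h2]

end Defect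

/-! ### From local to uniform statements on compact sets -/

section Local

variable {n : ℕ} {M : Type*} [TopologicalSpace M] [ChartedSpace (Model n) M]
  (g : LipschitzLorentzMetric n M) (D : MollifierData n M)

lemma eventually_of_chart {ψ : Chart n M} {x : M} (hx : x ∈ ψ.1.source) {P : ℝ → M → Prop}
    (hP : ∀ᶠ p in lz (ψ.1 x), P p.1 (ψ.1.symm p.2)) :
    ∀ᶠ p in 𝓝[>] (0 : ℝ) ×ˢ 𝓝 x, P p.1 p.2 := by
  have ht : Tendsto (fun p : ℝ × M => (p.1, ψ.1 p.2)) (𝓝[>] (0 : ℝ) ×ˢ 𝓝 x) (lz (ψ.1 x)) :=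
    tendsto_fst.prodMk ((ψ.1.continuousAt hx).tendsto.comp tendsto_snd)
  filter_upwards [ht.eventually hP,
    tendsto_snd.eventually (ψ.1.open_source.eventually_mem hx)] with p h1 h2
  rwa [ψ.1.left_inv h2] at h1

/-- Locally uniform eventual properties hold uniformly on compact sets. -/
lemma eventually_forall_mem_of_isCompact {K : Set M} (hK : IsCompact K) {P : ℝ → M → Prop}
    (hP : ∀ x ∈ K, ∀ᶠ p in 𝓝[>] (0 : ℝ) ×ˢ 𝓝 x, P p.1 p.2) :
    ∀ᶠ ε in 𝓝[>] (0 : ℝ), ∀ x ∈ K, P ε x := by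
  refine hK.induction_on (p := fun S => ∀ᶠ ε in 𝓝[>] (0 : ℝ), ∀ x ∈ S, P ε x) (by simp)
    (fun s t hst ht => ht.mono fun ε h x hx => h x (hst hx))
    (fun s t hs ht => ?_) fun x hx => ?_
  · filter_upwards [hs, ht] with ε h1 h2 x hx using hx.elim (h1 x) (h2 x)
  · obtain ⟨pa, ha, pb, hb, H⟩ := eventually_prod_iff.1 (hP x hx)
    exact ⟨{z | pb z}, mem_nhdsWithin_of_mem_nhds hb, ha.mono fun ε h z hz => H h hz⟩

lemma eventually_isLorentzForm_conv {K : Set M} (hK : IsCompact K)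
    [IsManifold 𝓘(ℝ, Model n) ∞ M] :
    ∀ᶠ ε in 𝓝[>] (0 : ℝ), ∀ x ∈ K, IsLorentzForm (D.conv ε (toDist g.toField) x) :=
  eventually_forall_mem_of_isCompact hK fun x _ =>
    eventually_of_chart (ψ := prefChart x) (P := fun ε x =>
        IsLorentzForm (D.conv ε (toDist g.toField) x)) (mem_chart_source _ x) <| by
      have hy := (prefChart (n := n) x).1.map_source (mem_chart_source _ x)
      filter_upwards [eventually_isLorentzMat_conv g D hy,
        eventually_lz_of_nhds ((prefChart (n := n) x).1.open_target.eventually_mem hy)] with p h1 h2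
      exact (isLorentzForm_iff _ h2).2 h1

variable [IsManifold 𝓘(ℝ, Model n) ∞ M] (h : RiemMetric n M)

lemma eventually_continuousAt_ricciDefect {K : Set M} (hK : IsCompact K) :
    ∀ᶠ ε in 𝓝[>] (0 : ℝ), ∀ x ∈ K, ContinuousAt (ricciDefect h D g.toField ε) x :=
  eventually_forall_mem_of_isCompact hK fun x _ =>
    eventually_of_chart (ψ := prefChart x) (P := fun ε x =>
        ContinuousAt (ricciDefect h D g.toField ε) x) (mem_chart_source _ x) <| by
      have hy := (prefChart (n := n) x).1.map_source (mem_chart_source _ x)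
      filter_upwards [eventually_metricNear_conv g D hy, eventually_pos_lz _,
        eventually_lz_of_nhds ((prefChart (n := n) x).1.open_target.eventually_mem hy)]
        with p h1 h2 h3
      refine ((prefChart (n := n) x).1.symm.continuousAt_iff_continuousAt_comp_right
        ((prefChart (n := n) x).1.map_target h3)).2 ?_
      rw [OpenPartialHomeomorph.symm_symm, (prefChart (n := n) x).1.right_inv h3]
      exact continuousAt_ricciDefect_symm h h2 h3 h1

lemma exists_eventually_abs_ricciDefect_le {K : Set M} (hK : IsCompact K) :
    ∃ C : ℝ, 0 < C ∧ ∀ᶠ ε in 𝓝[>] (0 : ℝ), ∀ x ∈ K, ‖ricciDefect h D g.toField ε x‖ ≤ C := by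
  refine hK.induction_on (p := fun S => ∃ C : ℝ, 0 < C ∧ ∀ᶠ ε in 𝓝[>] (0 : ℝ), ∀ x ∈ S,
    ‖ricciDefect h D g.toField ε x‖ ≤ C) ⟨1, one_pos, by simp⟩
    (fun s t hst ⟨C, hC, ht⟩ => ⟨C, hC, ht.mono fun ε h x hx => h x (hst hx)⟩)
    (fun s t ⟨C, hC, hs⟩ ⟨C', hC', ht⟩ => ⟨max C C', lt_max_of_lt_left hC, ?_⟩) fun x _ => ?_
  · filter_upwards [hs, ht] with ε h1 h2 x hx
    exact hx.elim (fun hx => (h1 x hx).trans (le_max_left _ _))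
      (fun hx => (h2 x hx).trans (le_max_right _ _))
  · have hxs := mem_chart_source (Model n) x
    obtain ⟨C, hC, hb⟩ := ((negl_ricciDefect g D (prefChart x) h).bdd _
      ((prefChart (n := n) x).1.map_source hxs)).exists_pos
    have h1 := eventually_of_chart (ψ := prefChart x)
      (P := fun ε x => ‖ricciDefect h D g.toField ε x‖ ≤ C) hxs
      (hb.bound.mono fun p hp => by simpa using hp)
    obtain ⟨pa, ha, pb, hb, H⟩ := eventually_prod_iff.1 h1
    exact ⟨{z | pb z}, mem_nhdsWithin_of_mem_nhds hb, C, hC, ha.mono fun ε h z hz => H h hz⟩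

end Local

/-! ### The Riemannian volume: null sets and finiteness on compact sets -/

section Volume

variable {n : ℕ} {M : Type*} [TopologicalSpace M] [ChartedSpace (Model n) M]
  [IsManifold 𝓘(ℝ, Model n) ∞ M] (h : RiemMetric n M) (D : MollifierData n M)

/-- The summands of the Riemannian volume measure, as measures on the chart domains. -/
def chartVolume (α : ℕ) : Measure (Model n) :=
  (volume.restrict (D.ψ α).1.target).withDensity fun y =>
    ENNReal.ofReal (D.locξ α y * √(comp h.inner (D.ψ α).1 y).det)

lemma chartVolume_absolutelyContinuous (α : ℕ) :
    chartVolume h D α ≪ volume.restrict (D.ψ α).1.target :=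
  withDensity_absolutelyContinuous _ _

lemma chartVolume_eq_zero (α : ℕ) {s : Set (Model n)}
    (hs : ∀ y ∈ s, y ∈ (D.ψ α).1.target → D.locξ α y = 0) : chartVolume h D α s = 0 := by
  have ht := (D.ψ α).1.open_target.measurableSet
  have hZ : MeasurableSet ({y | D.locξ α y = 0} ∪ (D.ψ α).1.targetᶜ) :=
    (measurableSet_eq_fun (D.contDiff_locξ α).continuous.measurable measurable_const).union
      ht.compl
  refine measure_mono_null (t := {y | D.locξ α y = 0} ∪ (D.ψ α).1.targetᶜ) (fun y hy => ?_) ?_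
  · by_cases hyt : y ∈ (D.ψ α).1.target
    · exact Or.inl (hs y hy hyt)
    · exact Or.inr hyt
  · rw [chartVolume, withDensity_apply _ hZ, Measure.restrict_restrict hZ]
    refine (setLIntegral_congr_fun (hZ.inter ht) (g := fun _ => 0) fun y hy => ?_).trans
      lintegral_zero
    rcases hy.1 with h0 | h0
    · have h0 : D.locξ α y = 0 := h0
      simp [h0]
    · exact absurd hy.2 h0

/-- The density is continuous on the compact image of the support of `ξ_α` and vanishes outside it.
-/
lemma chartVolume_univ_lt_top (α : ℕ) : chartVolume h D α univ < ⊤ := by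
  have hS := D.isCompact_image α
  have hc : ContinuousOn (fun y => D.locξ α y * √(comp h.inner (D.ψ α).1 y).det)
      ((D.ψ α).1 '' tsupport (D.ξ α)) := fun y hy => by
    have hH : ContinuousAt (comp h.inner (D.ψ α).1) y :=
      tendsto_pi_nhds.2 fun i => tendsto_pi_nhds.2 fun j =>
        continuousAt_comp_inner h (D.image_subset α hy) i j
    exact ((D.contDiff_locξ α).continuous.continuousAt.mul
      ((Continuous.matrix_det continuous_id).continuousAt.comp hH).sqrt).continuousWithinAt
  obtain ⟨C, hC⟩ := hS.exists_bound_of_continuousOn hc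
  rw [chartVolume, withDensity_apply _ MeasurableSet.univ, Measure.restrict_univ]
  refine (lintegral_mono (g := ((D.ψ α).1 '' tsupport (D.ξ α)).indicator
    fun _ => ENNReal.ofReal C) fun y => ?_).trans_lt ?_
  · by_cases hy : y ∈ (D.ψ α).1 '' tsupport (D.ξ α)
    · rw [indicator_of_mem hy]
      exact ENNReal.ofReal_le_ofReal ((le_abs_self _).trans (hC y hy))
    · simp [D.locξ_eq_zero α y hy]
  · rw [lintegral_indicator_const hS.measurableSet]
    exact ENNReal.mul_lt_top ENNReal.ofReal_lt_top
      ((Measure.restrict_apply_le _ _).trans_lt hS.measure_lt_top)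

variable [MeasurableSpace M]

lemma riemVolume_eq :
    riemVolume h D = Measure.sum fun α => (chartVolume h D α).map (D.ψ α).1.symm := rfl

variable [BorelSpace M]

lemma aemeasurable_symm (α : ℕ) : AEMeasurable (D.ψ α).1.symm (chartVolume h D α) :=
  ((D.ψ α).1.continuousOn_symm.aemeasurable (D.ψ α).1.open_target.measurableSet).mono_ac
    (chartVolume_absolutelyContinuous h D α)

/-- A property that holds almost everywhere in every chart holds almost everywhere. -/
lemma ae_riemVolume_of_charts {P : M → Prop}
    (hP : ∀ α, ∀ᵐ y, y ∈ (D.ψ α).1.target → P ((D.ψ α).1.symm y)) : ∀ᵐ x ∂riemVolume h D, P x := by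
  rw [riemVolume_eq, Measure.ae_sum_iff]
  intro α
  set ψ := (D.ψ α).1
  -- The measure pushed forward to `M` is evaluated on a measurable set. The exceptional set is
  -- therefore enlarged to the complement of the chart domain together with the points that the
  -- chart sends into `Z`.
  obtain ⟨Z, hsub, hZm, hZ⟩ := exists_measurable_superset_of_null (ae_iff.1 (hP α))
  have hres : Measurable (ψ.source.domRestrict ψ) := ψ.continuousOn.domRestrict.measurable
  have hS : MeasurableSet (ψ.source ∩ ψ ⁻¹' Z) := by
    have := MeasurableSet.subtype_image ψ.open_source.measurableSet (hres hZm)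
    convert this using 1
    ext x
    simp [and_comm]
  have hT : MeasurableSet (ψ.sourceᶜ ∪ ψ.source ∩ ψ ⁻¹' Z) :=
    ψ.open_source.measurableSet.compl.union hS
  rw [ae_iff]
  refine measure_mono_null (t := ψ.sourceᶜ ∪ ψ.source ∩ ψ ⁻¹' Z) (fun x hx => ?_) ?_
  · by_cases hxs : x ∈ ψ.source
    · refine Or.inr ⟨hxs, hsub fun hh => hx ?_⟩
      have := hh (ψ.map_source hxs)
      rwa [ψ.left_inv hxs] at this
    · exact Or.inl hxs
  · rw [Measure.map_apply_of_aemeasurable (aemeasurable_symm h D α) hT]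
    refine chartVolume_absolutelyContinuous h D α ?_
    rw [Measure.restrict_apply₀']
    · refine measure_mono_null (fun y hy => ?_) hZ
      rcases hy.1 with h1 | h1
      · exact absurd (ψ.map_target hy.2) h1
      · have := h1.2
        rwa [mem_preimage, ψ.right_inv hy.2] at this
    · exact ψ.open_target.measurableSet.nullMeasurableSet

variable [T2Space M]

/-- By local finiteness only finitely many chart domains meet a compact set, and each summand has
finite total mass. -/
lemma riemVolume_lt_top {K : Set M} (hK : IsCompact K) : riemVolume h D K < ⊤ := by
  have hfin : {α | ((D.ψ α).1.source ∩ K).Nonempty}.Finite :=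
    D.locallyFinite.finite_nonempty_inter_compact hK
  rw [riemVolume_eq, Measure.sum_apply _ hK.measurableSet, tsum_eq_sum (s := hfin.toFinset)]
  · refine ENNReal.sum_lt_top.2 fun α _ => ?_
    rw [Measure.map_apply_of_aemeasurable (aemeasurable_symm h D α) hK.measurableSet]
    exact (measure_mono (subset_univ _)).trans_lt (chartVolume_univ_lt_top h D α)
  · intro α hα
    rw [Measure.map_apply_of_aemeasurable (aemeasurable_symm h D α) hK.measurableSet]
    refine chartVolume_eq_zero h D α fun y hy hyt => absurd hα (not_not.2 ?_)
    simp only [Set.Finite.mem_toFinset, mem_ofPred_eq]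
    exact ⟨_, (D.ψ α).1.map_target hyt, hy⟩

end Volume

/-! ### Bounded almost everywhere convergence and `L^p` norms -/

section Integration

variable {X : Type*} [MeasurableSpace X] {μ : Measure X} [IsFiniteMeasure μ] {f : ℝ → X → ℝ}

/-- Bounded families converging to zero almost everywhere converge to zero in `L^p`. -/
lemma tendsto_eLpNorm_zero_of_bounded {p : ℝ≥0∞} (hp1 : 1 ≤ p) (hp : p ≠ ⊤) {C : ℝ}
    (hm : ∀ᶠ ε in 𝓝[>] (0 : ℝ), AEStronglyMeasurable (f ε) μ)
    (hb : ∀ᶠ ε in 𝓝[>] (0 : ℝ), ∀ᵐ x ∂μ, ‖f ε x‖ ≤ C)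
    (hl : ∀ᵐ x ∂μ, Tendsto (fun ε => f ε x) (𝓝[>] 0) (𝓝 0)) :
    Tendsto (fun ε => eLpNorm (f ε) p μ) (𝓝[>] 0) (𝓝 0) := by
  have hp0 : p ≠ 0 := (zero_lt_one.trans_le hp1).ne'
  have hpr : 0 < p.toReal := ENNReal.toReal_pos hp0 hp
  have h1 : Tendsto (fun ε => ∫ x, ‖f ε x‖ ^ p.toReal ∂μ) (𝓝[>] 0) (𝓝 (∫ _, 0 ∂μ)) := by
    refine tendsto_integral_filter_of_dominated_convergence (fun _ => |C| ^ p.toReal)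
      (hm.mono fun ε h => (h.norm.aemeasurable.pow_const _).aestronglyMeasurable) ?_
      (integrable_const _) ?_
    · filter_upwards [hb] with ε h
      filter_upwards [h] with x hx
      rw [Real.norm_of_nonneg (by positivity)]
      exact Real.rpow_le_rpow (norm_nonneg _) (hx.trans (le_abs_self _)) hpr.le
    · filter_upwards [hl] with x hx
      have h2 := hx.norm.rpow_const (p := p.toReal) (Or.inr hpr.le)
      rwa [norm_zero, Real.zero_rpow hpr.ne'] at h2
  rw [integral_zero] at h1
  have h2 := ENNReal.tendsto_ofReal (h1.rpow_const (p := p.toReal⁻¹) (Or.inr (by positivity)))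
  rw [Real.zero_rpow (inv_ne_zero hpr.ne'), ENNReal.ofReal_zero] at h2
  refine h2.congr' ?_
  filter_upwards [hm, hb] with ε h3 h4
  rw [(MemLp.of_bound h3 C h4).eLpNorm_eq_integral_rpow_norm hp0 hp]

end Integration

/-! ### Almost everywhere convergence and measurability of the defect -/

section Conclusion

variable {n : ℕ} {M : Type*} [TopologicalSpace M] [ChartedSpace (Model n) M]
  [IsManifold 𝓘(ℝ, Model n) ∞ M] [MeasurableSpace M] [BorelSpace M]
  (g : LipschitzLorentzMetric n M) (h : RiemMetric n M) (D : MollifierData n M)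

lemma ae_tendsto_ricciDefect : ∀ᵐ x ∂riemVolume h D,
    Tendsto (fun ε => ricciDefect h D g.toField ε x) (𝓝[>] 0) (𝓝 0) :=
  ae_riemVolume_of_charts h D fun α => (negl_ricciDefect g D (D.ψ α) h).lim

lemma eventually_aestronglyMeasurable_ricciDefect [T2Space M] {K : Set M} (hK : IsCompact K) :
    ∀ᶠ ε in 𝓝[>] (0 : ℝ), AEStronglyMeasurable (ricciDefect h D g.toField ε)
      ((riemVolume h D).restrict K) :=
  (eventually_continuousAt_ricciDefect g D h hK).mono fun _ hε =>
    ContinuousOn.aestronglyMeasurable (fun x hx => (hε x hx).continuousWithinAt) hK.measurableSet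

end Conclusion

end LipRicci

end

theorem mainTheorem3 {n : ℕ} {M : Type*} [TopologicalSpace M] [T2Space M]
    [SecondCountableTopology M] [ChartedSpace (LipRicci.Model n) M]
    [IsManifold 𝓘(ℝ, LipRicci.Model n) ∞ M] [MeasurableSpace M] [BorelSpace M]
    (g : LipRicci.LipschitzLorentzMetric n M) (h : LipRicci.RiemMetric n M)
    (D : LipRicci.MollifierData n M) (K : Set M) (hK : IsCompact K) :
    -- `g_ε` is smooth, and Lorentzian on `K` for small `ε`, so that `Ric[g_ε]` makes sense on `K`
    (∀ ε ∈ Ioc (0 : ℝ) 1, ∀ (ψ : LipRicci.Chart n M) (i j : Fin n),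
      ContDiffOn ℝ ∞ (fun y => LipRicci.comp (D.conv ε (LipRicci.toDist g.toField)) ψ.1 y i j)
        ψ.1.target) ∧
    (∀ᶠ ε in 𝓝[>] (0 : ℝ), ∀ x ∈ K,
      LipRicci.IsLorentzForm (D.conv ε (LipRicci.toDist g.toField) x)) ∧
    -- convergence in `L^p(K)`, `1 ≤ p < ∞`
    (∀ p : ℝ≥0∞, 1 ≤ p → p ≠ ⊤ →
      (∀ᶠ ε in 𝓝[>] (0 : ℝ), MemLp (LipRicci.ricciDefect h D g.toField ε) p
        ((LipRicci.riemVolume h D).restrict K)) ∧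
      Tendsto (fun ε => eLpNorm (LipRicci.ricciDefect h D g.toField ε) p
        ((LipRicci.riemVolume h D).restrict K)) (𝓝[>] (0 : ℝ)) (𝓝 0)) ∧
    -- boundedness in `L^∞(K)`
    ∃ C : ℝ, 0 < C ∧ ∀ᶠ ε in 𝓝[>] (0 : ℝ),
      eLpNorm (LipRicci.ricciDefect h D g.toField ε) ⊤
        ((LipRicci.riemVolume h D).restrict K) ≤ ENNReal.ofReal C := by
  obtain ⟨C, hC, hb⟩ := LipRicci.exists_eventually_abs_ricciDefect_le g D h hK
  have hm := LipRicci.eventually_aestronglyMeasurable_ricciDefect g h D hK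
  have hl := ae_restrict_of_ae (s := K) (LipRicci.ae_tendsto_ricciDefect g h D)
  have hb' : ∀ᶠ ε in 𝓝[>] (0 : ℝ), ∀ᵐ x ∂(LipRicci.riemVolume h D).restrict K,
      ‖LipRicci.ricciDefect h D g.toField ε x‖ ≤ C :=
    hb.mono fun ε hε => (ae_restrict_mem hK.measurableSet).mono hε
  -- Finiteness of the volume of `K` makes bounded functions `p`-integrable and provides a constant
  -- dominating function.
  have : IsFiniteMeasure ((LipRicci.riemVolume h D).restrict K) :=
    ⟨by simpa using LipRicci.riemVolume_lt_top h D hK⟩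
  refine ⟨fun ε hε ψ i j y hy => ?_, LipRicci.eventually_isLorentzForm_conv g D hK,
    fun p hp1 hp => ⟨?_, ?_⟩, C, hC, ?_⟩
  · exact (D.contDiffAt_comp_conv _ ε (LipRicci.contDiff_localConv_toDist g D hε.1) ψ hy i
      j).contDiffWithinAt
  · filter_upwards [hm, hb'] with ε h1 h2 using MemLp.of_bound h1 C h2
  · exact LipRicci.tendsto_eLpNorm_zero_of_bounded hp1 hp hm hb' hl
  · filter_upwards [hb'] with ε h2
    rw [eLpNorm_exponent_top]
    exact eLpNormEssSup_le_of_ae_bound h2
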